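/- Let $M$ be a complete smooth $n$-dimensional Riemannian manifold, and let $\Omega\subset M$ be a bounded domain (a nonempty connected open bounded set; its boundary may be empty). Integrals over $\Omega$ are with respect to the Riemannian volume, $\nabla$ and $\Delta=\operatorname{div}\nabla$ are the gradient and the Laplacian of $M$, extended complex-linearly to complex-valued functions, and $|\nabla g|^2=|\nabla\operatorname{Re}g|^2+|\nabla\operatorname{Im}g|^2$. Let $\lambda_1\le\lambda_2\le\lambda_3\le\cdots$ be the eigenvalues, repeated according to multiplicity, of the Dirichlet problem $$\Delta u=-\lambda u\ \text{ in }\Omega,\qquad u=0\ \text{ on }\partial\Omega,$$ and let $\{u_j\}_{j\ge1}$ be a corresponding orthonormal basis of the real Hilbert space $L^2(\Omega)$ consisting of real eigenfunctions: $u_j$ is of class $C^2$ in $\Omega$ and satisfies $\Delta u_j=-\lambda_ju_j$ there, the boundary condition means $u_j\in H^1_0(\Omega)$, and $\int_\Omega u_iu_j=\delta_{ij}$. (If $\partial\Omega=\emptyset$, the enumeration begins with $\lambda_1=0$.) A function is in $C^3(\Omega)\cap C^2(\overline\Omega)$ if it is $C^3$ in $\Omega$ and its derivatives of order at most $2$ (in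 charts) extend continuously to $\overline\Omega$. Let $k>i\ge1$ be integers. Then the following hold, all the integrals being those of integrable functions. (1) For every complex-valued $g\in C^3(\Omega)\cap C^2(\overline\Omega)$, $$\big((\lambda_{k+1}-\lambda_i)+(\lambda_{k+2}-\lambda_i)\big)\int_\Omega|\nabla g|^2u_i^2\le\int_\Omega\big|2\nabla g\cdot\nabla u_i+u_i\Delta g\big|^2+(\lambda_{k+1}-\lambda_i)(\lambda_{k+2}-\lambda_i)\int_\Omega|gu_i|^2 .$$ (2) For every real-valued $f\in C^3(\Omega)\cap C^2(\overline\Omega)$, $$\big((\lambda_{k+2}-\lambda_i)+(\lambda_{k+1}-\lambda_i)\big)\int_\Omega|\nabla f|^2u_i^2\le2\sqrt{(\lambda_{k+2}-\lambda_i)(\lambda_{k+1}-\lambda_i)\int_\Omega|\nabla f|^4u_i^2}+\int_\Omega\big(2\nabla f\cdot\nabla u_i+u_i\Delta f\big)^2 .$$ (3) For every real-valued $f\in C^3(\Omega)\cap C^2(\overline\Omega)$ with $|\nabla f|^2=1$ in $\Omega$, $$(\lambda_{k+2}-\lambda_{k+1})^2\le16\Big(\int_\Omega(\nabla f\cdot\nabla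 u_i)^2-\tfrac14\int_\Omega(\Delta f)^2u_i^2-\tfrac12\int_\Omega(\nabla(\Delta f)\cdot\nabla f)\,u_i^2\Big)\lambda_{k+2},$$ and, with $Q_i=\lambda_i-\frac14\int_\Omega(\Delta f)^2u_i^2-\frac12\int_\Omega(\nabla(\Delta f)\cdot\nabla f)\,u_i^2$, one has $Q_i\ge0$, $$(\lambda_{k+2}-\lambda_{k+1})^2\le16\,Q_i\,\lambda_{k+2}\qquad\text{and}\qquad\lambda_{k+2}-\lambda_{k+1}\le4\,Q_i^{1/2}\sqrt{\lambda_{k+2}} .$$ -/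

import Mathlib

open Set Filter Topology MeasureTheory Bundle Manifold
open scoped ENNReal ContDiff

noncomputable section

namespace RiemDirichlet

/-- The model space `ℝⁿ` with its Euclidean structure. -/
abbrev Euc (n : ℕ) : Type := EuclideanSpace ℝ (Fin n)

section Geometry

variable {n : ℕ} {M : Type*} [MetricSpace M] [ChartedSpace (Euc n) M]
  [RiemannianBundle (fun x : M => TangentSpace (𝓡 n) x)]

/-- The coordinate vector field `∂ᵢ` of the chart `chartAt x₀`, at the point with
coordinates `y`. -/
def coordVec (x₀ : M) (y : Euc n) (i : Fin n) :
    TangentSpace (𝓡 n) ((chartAt (Euc n) x₀).symm y) :=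
  mfderiv (𝓡 n) (𝓡 n) (chartAt (Euc n) x₀).symm y (EuclideanSpace.single i (1 : ℝ))

/-- The matrix `g_{ij} = ⟨∂ᵢ, ∂ⱼ⟩` of the metric in the chart `chartAt x₀`, as a function of the
coordinates. -/
def gram (x₀ : M) (y : Euc n) : Matrix (Fin n) (Fin n) ℝ :=
  Matrix.of fun i j => inner ℝ (coordVec x₀ y i) (coordVec x₀ y j)

/-- The density `√(det g_{ij})` of the Riemannian volume in the chart `chartAt x₀`. -/
def volDensity (x₀ : M) (y : Euc n) : ℝ := Real.sqrt (gram x₀ y).det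

/-- The Riemannian volume of the domain of the chart `chartAt x₀`: the image of
`√(det g) dy` under the inverse of the chart (a measure on `M` carried by that domain). -/
def chartVolume [MeasurableSpace M] (x₀ : M) : Measure M :=
  (((volume : Measure (Euc n)).withDensity
    (fun y => ENNReal.ofReal (volDensity x₀ y))).restrict (chartAt (Euc n) x₀).target).map
    (chartAt (Euc n) x₀).symm

variable (n M) in
/-- The Riemannian volume measure, that is, the least measure which dominates
`√(det g) dy` in every chart `chartAt x₀`. As the measures `√(det g) dy` of two charts agree on the
overlap of their domains, its restriction to the domain of each chart is `√(det g) dy`. -/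
def riemVolume [MeasurableSpace M] : Measure M := ⨆ x₀ : M, chartVolume (n := n) x₀

instance (p : M) : FiniteDimensional ℝ (TangentSpace (𝓡 n) p) :=
  inferInstanceAs (FiniteDimensional ℝ (Euc n))

instance (p : M) : CompleteSpace (TangentSpace (𝓡 n) p) :=
  FiniteDimensional.complete ℝ _

variable (n) in
/-- The gradient of a real function: `⟨∇f, v⟩ = df(v)`. -/
def grad (f : M → ℝ) (p : M) : TangentSpace (𝓡 n) p :=
  (InnerProductSpace.toDual ℝ (TangentSpace (𝓡 n) p)).symm (mfderiv (𝓡 n) 𝓘(ℝ, ℝ) f p)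

/-- The partial derivative `∂ᵢ` of a function of the coordinates. -/
def partialDeriv (i : Fin n) (F : Euc n → ℝ) (y : Euc n) : ℝ :=
  fderiv ℝ F y (EuclideanSpace.single i (1 : ℝ))

/-- The Laplacian in the chart `chartAt x₀`, as a function of the coordinates:
`(det g)^{-1/2} ∑ᵢ ∂ᵢ ((det g)^{1/2} ∑ⱼ g^{ij} ∂ⱼ f)`. -/
def chartLaplacian (x₀ : M) (f : M → ℝ) (y : Euc n) : ℝ :=
  (volDensity x₀ y)⁻¹ * ∑ i, partialDeriv i (fun z => volDensity x₀ z *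
    ∑ j, (gram x₀ z)⁻¹ i j * partialDeriv j (fun w => f ((chartAt (Euc n) x₀).symm w)) z) y

variable (n) in
/-- The Laplacian `Δf = div ∇f`. At each point it is computed in the preferred chart there; the
value is the same in every chart. -/
def lap (f : M → ℝ) (p : M) : ℝ := chartLaplacian p f (chartAt (Euc n) p p)

variable (n) in
/-- `|∇g|²` for a complex-valued function `g`. -/
def cGradSq (g : M → ℂ) (p : M) : ℝ :=
  ‖grad n (fun x => (g x).re) p‖ ^ 2 + ‖grad n (fun x => (g x).im) p‖ ^ 2

variable (n) in
/-- `∇g · ∇u` for `g` complex-valued and `u` real-valued. -/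
def cGradDot (g : M → ℂ) (u : M → ℝ) (p : M) : ℂ :=
  ⟨inner ℝ (grad n (fun x => (g x).re) p) (grad n u p),
    inner ℝ (grad n (fun x => (g x).im) p) (grad n u p)⟩

variable (n) in
/-- `Δg` for a complex-valued function `g`. -/
def cLap (g : M → ℂ) (p : M) : ℂ :=
  ⟨lap n (fun x => (g x).re) p, lap n (fun x => (g x).im) p⟩

end Geometry

section Regularity

variable {n : ℕ} {M : Type*} [MetricSpace M] [ChartedSpace (Euc n) M]
  {F : Type*} [NormedAddCommGroup F] [NormedSpace ℝ F]

variable (n) in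
/-- The class `C³(Ω) ∩ C²(Ω̄)`: `g` is of class `C³` in the open set `Ω`, and its derivatives in
charts of order at most two extend continuously to the closure of `Ω`, i.e. they have a
(finite) limit, taken from within `Ω`, at each point of the closure. -/
structure C3C2Closure (Ω : Set M) (g : M → F) : Prop where
  contMDiffOn : ContMDiffOn (𝓡 n) 𝓘(ℝ, F) 3 g Ω
  limits : ∀ x₀ ∈ closure Ω, ∀ m : ℕ, m ≤ 2 →
    ∃ L, Tendsto (iteratedFDeriv ℝ m (fun y => g ((chartAt (Euc n) x₀).symm y)))
      (𝓝[(chartAt (Euc n) x₀).target ∩ (chartAt (Euc n) x₀).symm ⁻¹' Ω]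
        (chartAt (Euc n) x₀ x₀)) (𝓝 L)

end Regularity

section Dirichlet

variable {n : ℕ} {M : Type*} [MetricSpace M] [ChartedSpace (Euc n) M]
  [RiemannianBundle (fun x : M => TangentSpace (𝓡 n) x)]

variable (n) in
/-- Test functions: `C_c^∞(Ω)`. -/
structure IsTestFunction (Ω : Set M) (φ : M → ℝ) : Prop where
  smooth : ContMDiff (𝓡 n) 𝓘(ℝ, ℝ) ∞ φ
  compact : HasCompactSupport φ
  subset : tsupport φ ⊆ Ω

variable [MeasurableSpace M]

variable (n) in
/-- The boundary condition `u = 0` on `∂Ω`, for a function which is `C¹` in `Ω`, in the usual sense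
`u ∈ H¹₀(Ω)`: `u` is the limit, in the `H¹(Ω)`-norm, of functions of class `C_c^∞(Ω)`. -/
def VanishesOnBoundary (Ω : Set M) (u : M → ℝ) : Prop :=
  ∃ φ : ℕ → M → ℝ, (∀ m, IsTestFunction n Ω (φ m)) ∧
    Tendsto (fun m => ∫⁻ x in Ω, (‖u x - φ m x‖ₑ ^ 2 + ‖grad n u x - grad n (φ m) x‖ₑ ^ 2)
      ∂(riemVolume n M)) atTop (𝓝 0)

variable (n) in
/-- `u` solves the Dirichlet problem `Δu = -lam u` in `Ω`, `u = 0` on `∂Ω`. -/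
structure IsDirichletSolution (Ω : Set M) (lam : ℝ) (u : M → ℝ) : Prop where
  contMDiffOn : ContMDiffOn (𝓡 n) 𝓘(ℝ, ℝ) 2 u Ω
  equation : ∀ x ∈ Ω, lap n u x = -lam * u x
  boundary : VanishesOnBoundary n Ω u

variable (n) in
/-- `lam 1 ≤ lam 2 ≤ ⋯` are the Dirichlet eigenvalues of `Ω`, repeated according to
multiplicity, and `u 1, u 2, …` is a corresponding orthonormal basis of the real Hilbert space
`L²(Ω)` consisting of eigenfunctions. -/
structure IsDirichletEigensystem (Ω : Set M) (lam : ℕ+ → ℝ) (u : ℕ+ → M → ℝ) : Prop where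
  monotone : Monotone lam
  solution : ∀ j, IsDirichletSolution n Ω (lam j) (u j)
  orthonormal_basis : ∃ b : HilbertBasis ℕ+ ℝ (Lp ℝ 2 ((riemVolume n M).restrict Ω)),
    ∀ j, b j =ᵐ[(riemVolume n M).restrict Ω] u j

end Dirichlet

end RiemDirichlet

end

/-! The argument is a commutator estimate. For a real function g put x = g uᵢ and y = 2∇g·∇uᵢ +
uᵢΔg, formally [Δ, g]uᵢ. Integration by parts gives ⟨uⱼ, y⟩ = (λᵢ − λⱼ)⟨uⱼ, x⟩ for every j, and −⟨x,
y⟩ = ∫|∇g|²uᵢ². With α = λₖ₊₁ and β = λₖ₊₂, expand ‖y‖² + ((α − λᵢ) + (β − λᵢ))⟨x, y⟩ + (α − λᵢ)(β −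
λᵢ)‖x‖² in the basis: the j-th term is (λⱼ − α)(λⱼ − β)⟨uⱼ, x⟩², which is nonnegative because no
eigenvalue lies strictly between two consecutive ones. This is (1) for real g
(`mul_neg_inner_le_of_hilbertBasis`, `gap_inequality_real`); the complex case is the sum over real
and imaginary parts.

For (2), take g = exp(√-1 s f), that is, add the inequalities for cos(sf) and sin(sf). This gives an
inequality polynomial in s², and the discriminant condition optimises it over s
(`gap_inequality_exp`, `add_mul_le_two_sqrt_add`).

For (3), |∇f| = 1 and ∫uᵢ² = 1 turn (2) into (a − b)² ≤ D, where a² = λₖ₊₂ − λᵢ, b² = λₖ₊₁ − λᵢ and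
D = ∫(2∇f·∇uᵢ + uᵢΔf)². Multiplying by (a + b)² ≤ 4a² ≤ 4λₖ₊₂ bounds the squared gap, and an
integration by parts rewrites D (`integral_commutator_sq`). Finally ∫(∇f·∇uᵢ)² ≤ ∫|∇uᵢ|² = λᵢ.

Three analytic points support this. Green's formula is proved chart by chart and glued by a
partition of unity (`integral_mul_lap`); it is then extended to H¹₀ by approximation, so nothing is
assumed about the regularity of ∂Ω or of uᵢ up to it. Hopf–Rinow makes the closure of Ω compact, so
that the limits required of f at each point of the closure bound f, ∇f and Δf uniformly. Lastly,
∇(Δf)·∇f contains third derivatives of f, which need not be bounded near ∂Ω; but differentiating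
|∇f|² = 1 twice bounds the second derivatives of f along ∇f, and this suffices
(`C3C2Closure.exists_bound_inner_grad_lap`). -/

set_option linter.unusedSectionVars false

noncomputable section

namespace RiemDirichlet

/-! ### The metric and the gradient in a chart. -/

section ChartGeometry

variable {n : ℕ} {M : Type*} [MetricSpace M] [ChartedSpace (Euc n) M]
  [RiemannianBundle (fun x : M => TangentSpace (𝓡 n) x)]

/-- The Riemannian metric at `p`, as a function on the model space. -/
def metricAt (p : M) (v w : Euc n) : ℝ :=
  inner ℝ (show TangentSpace (𝓡 n) p from v) (show TangentSpace (𝓡 n) p from w)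

/-- The differential of the inverse of the chart `chartAt x₀`. -/
def chartFrame (x₀ : M) (y : Euc n) : Euc n →L[ℝ] Euc n :=
  mfderiv (𝓡 n) (𝓡 n) (chartAt (Euc n) x₀).symm y

lemma gram_apply (x₀ : M) (y : Euc n) (i j : Fin n) :
    gram x₀ y i j = metricAt ((chartAt (Euc n) x₀).symm y)
      (chartFrame x₀ y (EuclideanSpace.single i 1))
      (chartFrame x₀ y (EuclideanSpace.single j 1)) := rfl

lemma metricAt_comm (p : M) (v w : Euc n) : metricAt p v w = metricAt p w v :=
  real_inner_comm _ _

lemma metricAt_sum_left {ι : Type*} (p : M) (s : Finset ι) (c : ι → ℝ) (v : ι → Euc n)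
    (w : Euc n) : metricAt p (∑ i ∈ s, c i • v i) w = ∑ i ∈ s, c i * metricAt p (v i) w := by
  have := sum_inner (𝕜 := ℝ) s (fun i => (show TangentSpace (𝓡 n) p from c i • v i))
    (show TangentSpace (𝓡 n) p from w)
  refine this.trans (Finset.sum_congr rfl fun i _ => ?_)
  exact real_inner_smul_left (F := TangentSpace (𝓡 n) p) _ _ _

lemma metricAt_sum_right {ι : Type*} (p : M) (s : Finset ι) (c : ι → ℝ) (v : ι → Euc n)
    (w : Euc n) : metricAt p w (∑ i ∈ s, c i • v i) = ∑ i ∈ s, c i * metricAt p w (v i) := by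
  simp_rw [metricAt_comm p w, metricAt_sum_left]

lemma metricAt_self_pos (p : M) {v : Euc n} (hv : v ≠ 0) : 0 < metricAt p v v :=
  real_inner_self_pos (F := TangentSpace (𝓡 n) p).2 hv

lemma euc_eq_sum (v : Euc n) : v = ∑ i, v i • EuclideanSpace.single i (1 : ℝ) := by
  ext j
  simp [Pi.single_apply]

variable [IsManifold (𝓡 n) ∞ M]

lemma chartFrame_injective (x₀ : M) {y : Euc n} (hy : y ∈ (chartAt (Euc n) x₀).target) :
    Function.Injective (chartFrame x₀ y) := by
  have : IsManifold (𝓡 n) 1 M := IsManifold.of_le (n := ∞) (by simp)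
  exact (mdifferentiable_chart (I := 𝓡 n) x₀).symm.mfderiv_injective hy

lemma chartFrame_surjective (x₀ : M) {y : Euc n} (hy : y ∈ (chartAt (Euc n) x₀).target) :
    Function.Surjective (chartFrame x₀ y) := by
  have : IsManifold (𝓡 n) 1 M := IsManifold.of_le (n := ∞) (by simp)
  exact (mdifferentiable_chart (I := 𝓡 n) x₀).symm.mfderiv_surjective hy

lemma gram_isHermitian (x₀ : M) (y : Euc n) : (gram x₀ y).IsHermitian := by
  ext i j
  simp only [Matrix.conjTranspose_apply, star_trivial, gram_apply]
  exact metricAt_comm _ _ _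

lemma sum_gram (x₀ : M) (y : Euc n) (a b : Euc n) :
    ∑ i, ∑ j, a i * b j * gram x₀ y i j =
      metricAt ((chartAt (Euc n) x₀).symm y) (chartFrame x₀ y a) (chartFrame x₀ y b) := by
  conv_rhs => rw [euc_eq_sum a, euc_eq_sum b]
  simp only [map_sum, map_smul, metricAt_sum_left, metricAt_sum_right, gram_apply, Finset.mul_sum]
  rw [Finset.sum_comm]
  exact Finset.sum_congr rfl fun i _ => Finset.sum_congr rfl fun j _ => by ring

lemma gram_posDef (x₀ : M) {y : Euc n} (hy : y ∈ (chartAt (Euc n) x₀).target) :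
    (gram x₀ y).PosDef := by
  refine Matrix.PosDef.of_dotProduct_mulVec_pos (gram_isHermitian x₀ y) fun v hv => ?_
  have h := sum_gram x₀ y (WithLp.toLp 2 v) (WithLp.toLp 2 v)
  have h2 : star v ⬝ᵥ (gram x₀ y).mulVec v = ∑ i, ∑ j, v i * v j * gram x₀ y i j := by
    simp only [dotProduct, Matrix.mulVec, Finset.mul_sum, star_trivial]
    exact Finset.sum_congr rfl fun i _ => Finset.sum_congr rfl fun j _ => by ring
  rw [h2]
  refine lt_of_lt_of_eq ?_ h.symm
  apply metricAt_self_pos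
  intro h0
  apply hv
  have := chartFrame_injective x₀ hy (h0.trans (map_zero _).symm)
  simpa using congrArg WithLp.ofLp this

lemma det_gram_pos (x₀ : M) {y : Euc n} (hy : y ∈ (chartAt (Euc n) x₀).target) :
    0 < (gram x₀ y).det := (gram_posDef x₀ hy).det_pos

lemma volDensity_pos (x₀ : M) {y : Euc n} (hy : y ∈ (chartAt (Euc n) x₀).target) :
    0 < volDensity x₀ y := Real.sqrt_pos.2 (det_gram_pos x₀ hy)

variable [IsContMDiffRiemannianBundle (𝓡 n) ∞ (Euc n) (fun x : M => TangentSpace (𝓡 n) x)]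

/-- The coordinate fields are the tangent map of the inverse chart applied to constant fields, hence
smooth sections, and the bundle metric of two smooth sections is smooth. -/
lemma contDiffOn_gram (x₀ : M) (i j : Fin n) :
    ContDiffOn ℝ ∞ (fun y => gram x₀ y i j) (chartAt (Euc n) x₀).target := by
  have hT := (chartAt (Euc n) x₀).open_target
  have key : ∀ i : Fin n, ContMDiffOn (𝓡 n) ((𝓡 n).prod 𝓘(ℝ, Euc n)) ∞
      (fun y : Euc n => (⟨(chartAt (Euc n) x₀).symm y, coordVec x₀ y i⟩ :
        TotalSpace (Euc n) (fun x : M => TangentSpace (𝓡 n) x)))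
      (chartAt (Euc n) x₀).target := by
    intro i
    have h1 := (contMDiffOn_chart_symm (I := 𝓡 n) (n := ∞) (x := x₀)).contMDiffOn_tangentMapWithin
      (m := ∞) (by simp) hT.uniqueMDiffOn
    have h2 : ContMDiff (𝓡 n) ((𝓡 n).prod 𝓘(ℝ, Euc n)) ∞
        (fun y : Euc n => (⟨y, EuclideanSpace.single i (1 : ℝ)⟩ : TangentBundle (𝓡 n) (Euc n))) :=
      fun y => contMDiffAt_vectorSpace_iff_contDiffAt.2 contDiffAt_const
    refine (h1.comp h2.contMDiffOn (fun y hy => hy)).congr fun y hy => ?_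
    simp only [Function.comp, tangentMapWithin]
    rw [mfderivWithin_of_isOpen hT hy]
    rfl
  rw [← contMDiffOn_iff_contDiffOn]
  exact ContMDiffOn.inner_bundle (IB := 𝓡 n) (key i) (key j)

lemma contDiffOn_det_gram (x₀ : M) :
    ContDiffOn ℝ ∞ (fun y => (gram x₀ y).det) (chartAt (Euc n) x₀).target := by
  simp only [Matrix.det_apply]
  refine ContDiffOn.sum fun σ _ => ?_
  exact (contDiffOn_prod fun i _ => contDiffOn_gram x₀ _ _).const_smul _

lemma contDiffOn_volDensity (x₀ : M) :
    ContDiffOn ℝ ∞ (volDensity x₀) (chartAt (Euc n) x₀).target :=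
  (contDiffOn_det_gram x₀).sqrt fun _ hy => (det_gram_pos x₀ hy).ne'

/-- Cramer's rule: the entries of the adjugate are polynomials in the metric coefficients, and the
determinant is positive on the chart. -/
lemma contDiffOn_gram_inv (x₀ : M) (i j : Fin n) :
    ContDiffOn ℝ ∞ (fun y => (gram x₀ y)⁻¹ i j) (chartAt (Euc n) x₀).target := by
  have h : ContDiffOn ℝ ∞ (fun y => (gram x₀ y).adjugate i j) (chartAt (Euc n) x₀).target := by
    simp only [Matrix.adjugate_apply, Matrix.det_apply]
    refine ContDiffOn.sum fun σ _ => ?_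
    refine (contDiffOn_prod fun k _ => ?_).const_smul _
    by_cases hk : σ k = j
    · simp only [hk, Matrix.updateRow_self]
      exact contDiffOn_const
    · simp only [Matrix.updateRow_ne hk]
      exact contDiffOn_gram x₀ _ _
  simp only [Matrix.inv_def, Matrix.smul_apply, smul_eq_mul, Ring.inverse_eq_inv']
  exact ((contDiffOn_det_gram x₀).inv fun y hy => (det_gram_pos x₀ hy).ne').mul h

omit [IsContMDiffRiemannianBundle (𝓡 n) ∞ (Euc n) (fun x : M => TangentSpace (𝓡 n) x)]

lemma mdifferentiableAt_chart_symm (x₀ : M) {y : Euc n} (hy : y ∈ (chartAt (Euc n) x₀).target) :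
    MDifferentiableAt (𝓡 n) (𝓡 n) (chartAt (Euc n) x₀).symm y := by
  have : IsManifold (𝓡 n) 1 M := IsManifold.of_le (n := ∞) (by simp)
  exact (mdifferentiable_chart (I := 𝓡 n) x₀).mdifferentiableAt_symm hy

lemma partialDeriv_chart (x₀ : M) {y : Euc n} (hy : y ∈ (chartAt (Euc n) x₀).target) {f : M → ℝ}
    (hf : MDifferentiableAt (𝓡 n) 𝓘(ℝ, ℝ) f ((chartAt (Euc n) x₀).symm y)) (i : Fin n) :
    partialDeriv i (fun w => f ((chartAt (Euc n) x₀).symm w)) y =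
      metricAt ((chartAt (Euc n) x₀).symm y) (grad n f ((chartAt (Euc n) x₀).symm y))
        (chartFrame x₀ y (EuclideanSpace.single i 1)) := by
  have h1 := mfderiv_comp y hf (mdifferentiableAt_chart_symm x₀ hy)
  rw [mfderiv_eq_fderiv] at h1
  unfold partialDeriv
  change (fderiv ℝ (f ∘ (chartAt (Euc n) x₀).symm) y) _ = _
  rw [h1]
  exact (InnerProductSpace.toDual_symm_apply (𝕜 := ℝ)
    (E := TangentSpace (𝓡 n) ((chartAt (Euc n) x₀).symm y))
    (x := chartFrame x₀ y (EuclideanSpace.single i 1))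
    (y := mfderiv (𝓡 n) 𝓘(ℝ, ℝ) f ((chartAt (Euc n) x₀).symm y))).symm

/-- The coordinate expression `∑ᵢ ∂ᵢf ∑ⱼ gⁱʲ ∂ⱼh` of `⟨∇f, ∇h⟩`. -/
lemma inner_grad_chart (x₀ : M) {y : Euc n} (hy : y ∈ (chartAt (Euc n) x₀).target) {f h : M → ℝ}
    (hf : MDifferentiableAt (𝓡 n) 𝓘(ℝ, ℝ) f ((chartAt (Euc n) x₀).symm y))
    (hh : MDifferentiableAt (𝓡 n) 𝓘(ℝ, ℝ) h ((chartAt (Euc n) x₀).symm y)) :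
    inner ℝ (grad n f ((chartAt (Euc n) x₀).symm y)) (grad n h ((chartAt (Euc n) x₀).symm y)) =
      ∑ i, partialDeriv i (fun w => f ((chartAt (Euc n) x₀).symm w)) y *
        ∑ j, (gram x₀ y)⁻¹ i j * partialDeriv j (fun w => h ((chartAt (Euc n) x₀).symm w)) y := by
  -- `a` and `b` are the coordinates of the two gradients. Lowering the index gives the partial
  -- derivatives (`hF`, `hH`), and applying the inverse matrix recovers `b` (`hinv`).
  obtain ⟨a, ha⟩ := chartFrame_surjective x₀ hy (grad n f ((chartAt (Euc n) x₀).symm y))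
  obtain ⟨b, hb⟩ := chartFrame_surjective x₀ hy (grad n h ((chartAt (Euc n) x₀).symm y))
  have hsingle : ∀ (c : Euc n) (i : Fin n),
      metricAt ((chartAt (Euc n) x₀).symm y) (chartFrame x₀ y c)
        (chartFrame x₀ y (EuclideanSpace.single i 1)) = ∑ j, gram x₀ y i j * c j := by
    intro c i
    rw [← sum_gram]
    refine Finset.sum_congr rfl fun k _ => ?_
    rw [Finset.sum_eq_single i (fun j _ hj => by simp [hj]) (by simp)]
    rw [← (gram_isHermitian x₀ y).apply k i]
    simp [mul_comm]
  have hF : ∀ i, partialDeriv i (fun w => f ((chartAt (Euc n) x₀).symm w)) y =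
      ∑ j, gram x₀ y i j * a j := fun i => by
    rw [partialDeriv_chart x₀ hy hf, ← hsingle a i]
    exact congrArg (fun v => metricAt _ v _) ha.symm
  have hH : ∀ i, partialDeriv i (fun w => h ((chartAt (Euc n) x₀).symm w)) y =
      ∑ j, gram x₀ y i j * b j := fun i => by
    rw [partialDeriv_chart x₀ hy hh, ← hsingle b i]
    exact congrArg (fun v => metricAt _ v _) hb.symm
  have hinv : ∀ i, ∑ j, (gram x₀ y)⁻¹ i j *
      partialDeriv j (fun w => h ((chartAt (Euc n) x₀).symm w)) y = b i := by
    intro i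
    simp only [hH]
    have h1 : (gram x₀ y)⁻¹.mulVec ((gram x₀ y).mulVec b) = b := by
      rw [Matrix.mulVec_mulVec, Matrix.nonsing_inv_mul _ (det_gram_pos x₀ hy).ne'.isUnit,
        Matrix.one_mulVec]
    exact congrFun h1 i
  simp only [hinv, hF]
  have h2 : inner ℝ (grad n f ((chartAt (Euc n) x₀).symm y))
      (grad n h ((chartAt (Euc n) x₀).symm y)) =
      metricAt ((chartAt (Euc n) x₀).symm y) (chartFrame x₀ y b) (chartFrame x₀ y a) := by
    rw [ha, hb]
    exact metricAt_comm _ _ _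
  rw [h2, ← sum_gram]
  refine Finset.sum_congr rfl fun i _ => ?_
  rw [Finset.sum_mul]
  exact Finset.sum_congr rfl fun j _ => by ring

end ChartGeometry

/-! ### The Riemannian volume and its independence of charts. -/

section Volume

variable {n : ℕ} {M : Type*} [MetricSpace M] [ChartedSpace (Euc n) M]
  [RiemannianBundle (fun x : M => TangentSpace (𝓡 n) x)] [IsManifold (𝓡 n) ∞ M]

/-- The change of coordinates from `chartAt x₀` to `chartAt x₁`. -/
def chartTransition (x₀ x₁ : M) (y : Euc n) : Euc n :=
  chartAt (Euc n) x₁ ((chartAt (Euc n) x₀).symm y)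

lemma differentiableAt_chartTransition {x₀ x₁ : M} {y : Euc n}
    (hy : y ∈ (chartAt (Euc n) x₀).target)
    (hy' : (chartAt (Euc n) x₀).symm y ∈ (chartAt (Euc n) x₁).source) :
    DifferentiableAt ℝ (chartTransition x₀ x₁) y := by
  have : IsManifold (𝓡 n) 1 M := IsManifold.of_le (n := ∞) (by simp)
  have h1 := (mdifferentiable_chart (I := 𝓡 n) x₁).mdifferentiableAt hy'
  exact (h1.comp y (mdifferentiableAt_chart_symm x₀ hy)).differentiableAt

lemma chartFrame_eq_comp {x₀ x₁ : M} {y : Euc n}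
    (hy : y ∈ (chartAt (Euc n) x₀).target)
    (hy' : (chartAt (Euc n) x₀).symm y ∈ (chartAt (Euc n) x₁).source) (v : Euc n) :
    chartFrame x₀ y v =
      chartFrame x₁ (chartTransition x₀ x₁ y) (fderiv ℝ (chartTransition x₀ x₁) y v) := by
  have ht : chartTransition x₀ x₁ y ∈ (chartAt (Euc n) x₁).target :=
    (chartAt (Euc n) x₁).map_source hy'
  have hev : (chartAt (Euc n) x₀).symm =ᶠ[𝓝 y]
      (chartAt (Euc n) x₁).symm ∘ chartTransition x₀ x₁ := by
    have hO : IsOpen ((chartAt (Euc n) x₀).target ∩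
        (chartAt (Euc n) x₀).symm ⁻¹' (chartAt (Euc n) x₁).source) :=
      (chartAt (Euc n) x₀).isOpen_inter_preimage_symm (chartAt (Euc n) x₁).open_source
    filter_upwards [hO.mem_nhds ⟨hy, hy'⟩] with z hz
    exact ((chartAt (Euc n) x₁).left_inv hz.2).symm
  have h1 := hev.mfderiv_eq (I := 𝓡 n) (I' := 𝓡 n)
  have h2 := mfderiv_comp y (mdifferentiableAt_chart_symm x₁ ht)
    (differentiableAt_chartTransition hy hy').mdifferentiableAt
  rw [mfderiv_eq_fderiv] at h2
  exact DFunLike.congr_fun (h1.trans h2) v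

/-- If `A` is the Jacobian matrix of the transition, the Gram matrices satisfy G₀ = Aᵀ G₁ A; take
determinants and square roots. -/
lemma volDensity_chartTransition {x₀ x₁ : M} {y : Euc n}
    (hy : y ∈ (chartAt (Euc n) x₀).target)
    (hy' : (chartAt (Euc n) x₀).symm y ∈ (chartAt (Euc n) x₁).source) :
    volDensity x₀ y = |(fderiv ℝ (chartTransition x₀ x₁) y).det| *
      volDensity x₁ (chartTransition x₀ x₁ y) := by
  set J := fderiv ℝ (chartTransition x₀ x₁) y with hJ
  let b := (EuclideanSpace.basisFun (Fin n) ℝ).toBasis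
  let A := LinearMap.toMatrix b b (J : Euc n →ₗ[ℝ] Euc n)
  have hA : ∀ i j, A i j = J (EuclideanSpace.single j 1) i := by
    intro i j
    simp [A, b, LinearMap.toMatrix_apply]
  have hp : (chartAt (Euc n) x₁).symm (chartTransition x₀ x₁ y) = (chartAt (Euc n) x₀).symm y :=
    (chartAt (Euc n) x₁).left_inv hy'
  have hG : gram x₀ y = A.transpose * gram x₁ (chartTransition x₀ x₁ y) * A := by
    ext i j
    rw [gram_apply, chartFrame_eq_comp hy hy', chartFrame_eq_comp hy hy', ← hp, ← hJ, ← sum_gram]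
    simp only [Matrix.mul_apply, Matrix.transpose_apply, hA, Finset.sum_mul]
    rw [Finset.sum_comm]
    exact Finset.sum_congr rfl fun k _ => Finset.sum_congr rfl fun l _ => by ring
  have hdet : A.det = J.det := LinearMap.det_toMatrix b _
  unfold volDensity
  rw [hG, Matrix.det_mul, Matrix.det_mul, Matrix.det_transpose, hdet,
    show J.det * (gram x₁ (chartTransition x₀ x₁ y)).det * J.det =
      J.det ^ 2 * (gram x₁ (chartTransition x₀ x₁ y)).det by ring,
    Real.sqrt_mul (sq_nonneg _), Real.sqrt_sq_eq_abs]

variable [MeasurableSpace M] [BorelSpace M]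

lemma aemeasurable_chart_symm (x₀ : M) (μ : Measure (Euc n)) :
    AEMeasurable (chartAt (Euc n) x₀).symm (μ.restrict (chartAt (Euc n) x₀).target) :=
  (chartAt (Euc n) x₀).continuousOn_symm.aemeasurable (chartAt (Euc n) x₀).open_target.measurableSet

lemma measurableSet_chart_preimage (x₀ : M) {A : Set M} (hA : MeasurableSet A) :
    MeasurableSet ((chartAt (Euc n) x₀).target ∩ (chartAt (Euc n) x₀).symm ⁻¹' A) := by
  have h := (chartAt (Euc n) x₀).continuousOn_symm.domRestrict.measurable hA
  have := (chartAt (Euc n) x₀).open_target.measurableSet.subtype_image h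
  convert this using 1
  ext y
  simp [and_comm]

lemma chartVolume_apply (x₀ : M) {A : Set M} (hA : MeasurableSet A) :
    chartVolume (n := n) x₀ A =
      ∫⁻ y in (chartAt (Euc n) x₀).target ∩ (chartAt (Euc n) x₀).symm ⁻¹' A,
        ENNReal.ofReal (volDensity x₀ y) := by
  have hT : MeasurableSet (chartAt (Euc n) x₀).target :=
    (chartAt (Euc n) x₀).open_target.measurableSet
  rw [chartVolume, Measure.map_apply_of_aemeasurable (aemeasurable_chart_symm x₀ _) hA,
    Measure.restrict_apply₀' hT.nullMeasurableSet, inter_comm,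
    withDensity_apply _ (measurableSet_chart_preimage x₀ hA)]

lemma chartVolume_compl_source (x₀ : M) :
    chartVolume (n := n) x₀ (chartAt (Euc n) x₀).sourceᶜ = 0 := by
  rw [chartVolume_apply x₀ (chartAt (Euc n) x₀).open_source.measurableSet.compl]
  have : (chartAt (Euc n) x₀).target ∩
      (chartAt (Euc n) x₀).symm ⁻¹' (chartAt (Euc n) x₀).sourceᶜ = ∅ := by
    ext y
    simp only [mem_inter_iff, mem_preimage, mem_compl_iff, mem_empty_iff_false, iff_false, not_and,
      not_not]
    exact fun hy => (chartAt (Euc n) x₀).map_target hy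
  rw [this, Measure.restrict_empty, lintegral_zero_measure]

/-- The change of variables formula for the transition map, whose Jacobian is absorbed by the
transformation law of the density. -/
lemma chartVolume_eq_of_subset {x₀ x₁ : M} {A : Set M} (hA : MeasurableSet A)
    (h0 : A ⊆ (chartAt (Euc n) x₀).source) (h1 : A ⊆ (chartAt (Euc n) x₁).source) :
    chartVolume (n := n) x₁ A = chartVolume (n := n) x₀ A := by
  rw [chartVolume_apply x₀ hA, chartVolume_apply x₁ hA]
  set B := (chartAt (Euc n) x₀).target ∩ (chartAt (Euc n) x₀).symm ⁻¹' A with hB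
  have himg : (chartAt (Euc n) x₁).target ∩ (chartAt (Euc n) x₁).symm ⁻¹' A =
      chartTransition x₀ x₁ '' B := by
    ext z
    constructor
    · rintro ⟨hz, hzA⟩
      refine ⟨chartAt (Euc n) x₀ ((chartAt (Euc n) x₁).symm z),
        ⟨(chartAt (Euc n) x₀).map_source (h0 hzA), ?_⟩, ?_⟩
      · rw [mem_preimage, (chartAt (Euc n) x₀).left_inv (h0 hzA)]
        exact hzA
      · rw [chartTransition, (chartAt (Euc n) x₀).left_inv (h0 hzA),
          (chartAt (Euc n) x₁).right_inv hz]
    · rintro ⟨y, ⟨hy, hyA⟩, rfl⟩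
      refine ⟨(chartAt (Euc n) x₁).map_source (h1 hyA), ?_⟩
      rw [mem_preimage, chartTransition, (chartAt (Euc n) x₁).left_inv (h1 hyA)]
      exact hyA
  have hinj : InjOn (chartTransition x₀ x₁) B := by
    rintro y ⟨hy, hyA⟩ z ⟨hz, hzA⟩ h
    have h2 := (chartAt (Euc n) x₁).injOn (h1 hyA) (h1 hzA) h
    exact (chartAt (Euc n) x₀).symm.injOn hy hz h2
  rw [himg, lintegral_image_eq_lintegral_abs_det_fderiv_mul volume
    (measurableSet_chart_preimage x₀ hA)
    (fun y hy => (differentiableAt_chartTransition hy.1 (h1 hy.2)).hasFDerivAt.hasFDerivWithinAt)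
    hinj]
  refine setLIntegral_congr_fun (measurableSet_chart_preimage x₀ hA) fun y hy => ?_
  rw [← ENNReal.ofReal_mul (abs_nonneg _), ← volDensity_chartTransition hy.1 (h1 hy.2)]

/-- On the domain of a chart, the Riemannian volume is `√(det g) dy`. -/
lemma riemVolume_restrict_source (x₀ : M) :
    (riemVolume n M).restrict (chartAt (Euc n) x₀).source = chartVolume (n := n) x₀ := by
  have hS : MeasurableSet (chartAt (Euc n) x₀).source :=
    (chartAt (Euc n) x₀).open_source.measurableSet
  have hself : (chartVolume (n := n) x₀).restrict (chartAt (Euc n) x₀).source =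
      chartVolume (n := n) x₀ :=
    Measure.restrict_eq_self_of_ae_mem (chartVolume_compl_source x₀)
  apply le_antisymm
  -- A supremum of measures is below any common upper bound. Each chart volume is split along the
  -- domain of the chart at `x₀`, inside which all chart volumes agree on the overlaps.
  · have hle : riemVolume n M ≤
        (riemVolume n M).restrict (chartAt (Euc n) x₀).sourceᶜ + chartVolume (n := n) x₀ := by
      refine iSup_le fun x₁ => ?_
      rw [← Measure.restrict_compl_add_restrict (μ := chartVolume (n := n) x₁) hS]
      refine add_le_add (Measure.restrict_mono le_rfl (le_iSup _ x₁)) ?_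
      refine Measure.le_iff.2 fun A hA => ?_
      rw [Measure.restrict_apply hA]
      have hS1 : MeasurableSet (chartAt (Euc n) x₁).source :=
        (chartAt (Euc n) x₁).open_source.measurableSet
      have hself1 : (chartVolume (n := n) x₁).restrict (chartAt (Euc n) x₁).source =
          chartVolume (n := n) x₁ :=
        Measure.restrict_eq_self_of_ae_mem (chartVolume_compl_source x₁)
      rw [← hself1, Measure.restrict_apply (hA.inter hS),
        chartVolume_eq_of_subset (x₀ := x₀) ((hA.inter hS).inter hS1)
          (fun p hp => hp.1.2) (fun p hp => hp.2)]
      exact measure_mono fun p hp => hp.1.1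
    refine (Measure.restrict_mono le_rfl hle).trans ?_
    rw [Measure.restrict_add, Measure.restrict_restrict hS, inter_compl_self,
      Measure.restrict_empty, zero_add, hself]
  · rw [← hself]
    exact Measure.restrict_mono le_rfl (le_iSup (fun x₁ => chartVolume (n := n) x₁) x₀)

variable [IsContMDiffRiemannianBundle (𝓡 n) ∞ (Euc n) (fun x : M => TangentSpace (𝓡 n) x)]

/-- The density is continuous, hence integrable, on a closed coordinate ball. Local finiteness is
what makes compactly supported continuous functions integrable below. -/
instance : IsLocallyFiniteMeasure (riemVolume n M) := by
  refine ⟨fun p => ?_⟩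
  set c := chartAt (Euc n) p with hc
  have hT : c.target ∈ 𝓝 (c p) := c.open_target.mem_nhds (mem_chart_target _ p)
  obtain ⟨r, hr, hrT⟩ := Metric.nhds_basis_closedBall.mem_iff.1 hT
  have hU : IsOpen (c.source ∩ c ⁻¹' Metric.ball (c p) r) :=
    c.isOpen_inter_preimage Metric.isOpen_ball
  refine ⟨c.source ∩ c ⁻¹' Metric.ball (c p) r,
    hU.mem_nhds ⟨mem_chart_source _ p, Metric.mem_ball_self hr⟩, ?_⟩
  have h1 : riemVolume n M (c.source ∩ c ⁻¹' Metric.ball (c p) r) =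
      chartVolume (n := n) p (c.source ∩ c ⁻¹' Metric.ball (c p) r) := by
    rw [← riemVolume_restrict_source, Measure.restrict_apply hU.measurableSet]
    congr 1
    ext z
    simp only [mem_inter_iff]
    tauto
  rw [h1, chartVolume_apply p hU.measurableSet]
  have hcont : ContinuousOn (volDensity p) (Metric.closedBall (c p) r) :=
    (contDiffOn_volDensity p).continuousOn.mono hrT
  have hint : IntegrableOn (volDensity p) (Metric.closedBall (c p) r) :=
    hcont.integrableOn_compact (isCompact_closedBall _ _)
  refine lt_of_le_of_lt (lintegral_mono_set (t := Metric.closedBall (c p) r) ?_)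
    hint.lintegral_lt_top
  rintro y ⟨hy, -, hyb⟩
  rw [mem_preimage, c.right_inv hy] at hyb
  exact Metric.ball_subset_closedBall hyb

lemma setIntegral_source (x₀ : M) {f : M → ℝ} {A : Set M} (hA : MeasurableSet A)
    (hAS : A ⊆ (chartAt (Euc n) x₀).source)
    (hf : AEStronglyMeasurable f ((riemVolume n M).restrict A)) :
    ∫ x in A, f x ∂(riemVolume n M) =
      ∫ y in (chartAt (Euc n) x₀).target ∩ (chartAt (Euc n) x₀).symm ⁻¹' A,
        volDensity x₀ y * f ((chartAt (Euc n) x₀).symm y) := by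
  set c := chartAt (Euc n) x₀ with hc
  have hT : MeasurableSet c.target := c.open_target.measurableSet
  have hB := measurableSet_chart_preimage (n := n) x₀ hA
  have hvd : AEMeasurable (fun y => ENNReal.ofReal (volDensity x₀ y))
      (volume.restrict (c.target ∩ c.symm ⁻¹' A)) :=
    (((contDiffOn_volDensity x₀).continuousOn.mono inter_subset_left).aemeasurable
      hB).ennreal_ofReal
  have hres : (riemVolume n M).restrict A =
      ((volume.restrict (c.target ∩ c.symm ⁻¹' A)).withDensity
        (fun y => ENNReal.ofReal (volDensity x₀ y))).map c.symm := by
    have h1 : (riemVolume n M).restrict A = (chartVolume (n := n) x₀).restrict A := by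
      rw [← riemVolume_restrict_source, Measure.restrict_restrict hA, inter_eq_left.2 hAS]
    ext D hD
    rw [h1, Measure.restrict_apply hD, chartVolume_apply x₀ (hD.inter hA),
      ← restrict_withDensity hB, Measure.map_apply_of_aemeasurable _ hD]
    · rw [Measure.restrict_apply₀' hB.nullMeasurableSet, withDensity_apply']
      congr 2
      ext z
      simp only [mem_inter_iff, mem_preimage]
      tauto
    · exact (c.continuousOn_symm.mono inter_subset_left).aemeasurable hB
  have hcm : AEMeasurable c.symm ((volume.restrict (c.target ∩ c.symm ⁻¹' A)).withDensity
        (fun y => ENNReal.ofReal (volDensity x₀ y))) := by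
    rw [← restrict_withDensity hB]
    exact (c.continuousOn_symm.mono inter_subset_left).aemeasurable hB
  rw [hres] at hf ⊢
  rw [integral_map hcm hf, integral_withDensity_eq_integral_toReal_smul₀ hvd (by simp)]
  refine setIntegral_congr_fun hB fun y hy => ?_
  simp only [smul_eq_mul]
  rw [ENNReal.toReal_ofReal (volDensity_pos x₀ hy.1).le]

end Volume

/-! ### Differentiation rules for the gradient. -/

section GradientCalculus

variable {n : ℕ} {M : Type*} [MetricSpace M] [ChartedSpace (Euc n) M]
  [RiemannianBundle (fun x : M => TangentSpace (𝓡 n) x)]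

lemma inner_grad_left (f : M → ℝ) (p : M) (v : TangentSpace (𝓡 n) p) :
    inner ℝ (grad n f p) v = (show ℝ from mfderiv (𝓡 n) 𝓘(ℝ, ℝ) f p v) :=
  InnerProductSpace.toDual_symm_apply (𝕜 := ℝ) (E := TangentSpace (𝓡 n) p)

lemma grad_add {f h : M → ℝ} {p : M} (hf : MDifferentiableAt (𝓡 n) 𝓘(ℝ, ℝ) f p)
    (hh : MDifferentiableAt (𝓡 n) 𝓘(ℝ, ℝ) h p) :
    grad n (fun x => f x + h x) p = grad n f p + grad n h p := by
  refine ext_inner_right ℝ fun v => ?_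
  rw [inner_add_left, inner_grad_left, inner_grad_left, inner_grad_left]
  exact DFunLike.congr_fun (hf.hasMFDerivAt.add hh.hasMFDerivAt).mfderiv v

lemma grad_sub {f h : M → ℝ} {p : M} (hf : MDifferentiableAt (𝓡 n) 𝓘(ℝ, ℝ) f p)
    (hh : MDifferentiableAt (𝓡 n) 𝓘(ℝ, ℝ) h p) :
    grad n (fun x => f x - h x) p = grad n f p - grad n h p := by
  refine ext_inner_right ℝ fun v => ?_
  rw [inner_sub_left, inner_grad_left, inner_grad_left, inner_grad_left]
  exact DFunLike.congr_fun (hf.hasMFDerivAt.sub hh.hasMFDerivAt).mfderiv v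

lemma grad_mul {f h : M → ℝ} {p : M} (hf : MDifferentiableAt (𝓡 n) 𝓘(ℝ, ℝ) f p)
    (hh : MDifferentiableAt (𝓡 n) 𝓘(ℝ, ℝ) h p) :
    grad n (fun x => f x * h x) p = f p • grad n h p + h p • grad n f p := by
  refine ext_inner_right ℝ fun v => ?_
  rw [inner_add_left, real_inner_smul_left, real_inner_smul_left, inner_grad_left,
    inner_grad_left, inner_grad_left]
  exact DFunLike.congr_fun (hf.hasMFDerivAt.mul hh.hasMFDerivAt).mfderiv v

lemma grad_comp {θ : ℝ → ℝ} {f : M → ℝ} {p : M} (hf : MDifferentiableAt (𝓡 n) 𝓘(ℝ, ℝ) f p)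
    (hθ : DifferentiableAt ℝ θ (f p)) :
    grad n (fun x => θ (f x)) p = deriv θ (f p) • grad n f p := by
  refine ext_inner_right ℝ fun v => ?_
  rw [real_inner_smul_left, inner_grad_left, inner_grad_left]
  have h := mfderiv_comp p hθ.mdifferentiableAt hf
  rw [mfderiv_eq_fderiv] at h
  refine (DFunLike.congr_fun h v).trans ?_
  exact (fderiv_eq_smul_deriv (f := θ) (x := f p) _).trans (mul_comm _ _)

lemma grad_congr {f h : M → ℝ} {p : M} (hfh : f =ᶠ[𝓝 p] h) : grad n f p = grad n h p := by
  refine ext_inner_right ℝ fun v => ?_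
  rw [inner_grad_left, inner_grad_left]
  exact DFunLike.congr_fun (hfh.mfderiv_eq (I := 𝓡 n) (I' := 𝓘(ℝ, ℝ))) v

lemma grad_eq_zero_of_notMem_tsupport {f : M → ℝ} {p : M} (hp : p ∉ tsupport f) :
    grad n f p = 0 := by
  rw [grad_congr (notMem_tsupport_iff_eventuallyEq.1 hp)]
  refine ext_inner_right ℝ fun v => ?_
  rw [inner_grad_left, inner_zero_left]
  exact DFunLike.congr_fun (mfderiv_const (I := 𝓡 n) (I' := 𝓘(ℝ, ℝ)) (c := (0 : ℝ))) v

end GradientCalculus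

/-! ### Partial derivatives and regularity of coordinate expressions. -/

section ChartCalculus

variable {n : ℕ}

lemma contDiffOn_partialDeriv {O : Set (Euc n)} (hO : IsOpen O) {F : Euc n → ℝ}
    {k l : WithTop ℕ∞} (hF : ContDiffOn ℝ l F O) (hk : k + 1 ≤ l) (i : Fin n) :
    ContDiffOn ℝ k (partialDeriv i F) O :=
  (hF.fderiv_of_isOpen hO hk).clm_apply contDiffOn_const

lemma partialDeriv_congr {F H : Euc n → ℝ} {y : Euc n} (h : F =ᶠ[𝓝 y] H) (i : Fin n) :
    partialDeriv i F y = partialDeriv i H y := by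
  unfold partialDeriv
  rw [h.fderiv_eq]

lemma partialDeriv_mul {F H : Euc n → ℝ} {y : Euc n} (hF : DifferentiableAt ℝ F y)
    (hH : DifferentiableAt ℝ H y) (i : Fin n) :
    partialDeriv i (fun z => F z * H z) y = F y * partialDeriv i H y + H y * partialDeriv i F y := by
  unfold partialDeriv
  rw [fderiv_fun_mul hF hH]
  simp

lemma partialDeriv_sum {ι : Type*} (s : Finset ι) {F : ι → Euc n → ℝ} {y : Euc n}
    (hF : ∀ j ∈ s, DifferentiableAt ℝ (F j) y) (i : Fin n) :
    partialDeriv i (fun z => ∑ j ∈ s, F j z) y = ∑ j ∈ s, partialDeriv i (F j) y := by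
  unfold partialDeriv
  rw [fderiv_fun_sum hF]
  simp

lemma partialDeriv_comp {θ : ℝ → ℝ} {F : Euc n → ℝ} {y : Euc n} (hF : DifferentiableAt ℝ F y)
    (hθ : DifferentiableAt ℝ θ (F y)) (i : Fin n) :
    partialDeriv i (fun z => θ (F z)) y = deriv θ (F y) * partialDeriv i F y := by
  unfold partialDeriv
  have := fderiv_comp y hθ hF
  change fderiv ℝ (θ ∘ F) y _ = _
  rw [this, ContinuousLinearMap.comp_apply, fderiv_eq_smul_deriv, smul_eq_mul, mul_comm]

variable {M : Type*} [MetricSpace M] [ChartedSpace (Euc n) M]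
  [RiemannianBundle (fun x : M => TangentSpace (𝓡 n) x)]

variable (n) in
/-- The expression of a function in the chart `chartAt x₀`. -/
abbrev inChart (x₀ : M) (f : M → ℝ) : Euc n → ℝ := fun w => f ((chartAt (Euc n) x₀).symm w)

variable (n) in
/-- The domain of coordinates corresponding to `A`. -/
def chartDom (x₀ : M) (A : Set M) : Set (Euc n) :=
  (chartAt (Euc n) x₀).target ∩ (chartAt (Euc n) x₀).symm ⁻¹' A

lemma isOpen_chartDom (x₀ : M) {A : Set M} (hA : IsOpen A) :
    IsOpen (chartDom n x₀ A) :=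
  (chartAt (Euc n) x₀).isOpen_inter_preimage_symm hA

/-- The coordinates `√(det g) ∑ⱼ gⁱʲ ∂ⱼf` of the gradient density. -/
def gradFlux (x₀ : M) (f : M → ℝ) (i : Fin n) (z : Euc n) : ℝ :=
  volDensity x₀ z * ∑ j, (gram x₀ z)⁻¹ i j * partialDeriv j (inChart n x₀ f) z

lemma chartLaplacian_eq (x₀ : M) (f : M → ℝ) (y : Euc n) :
    chartLaplacian x₀ f y = (volDensity x₀ y)⁻¹ * ∑ i, partialDeriv i (gradFlux x₀ f i) y := rfl

variable [IsManifold (𝓡 n) ∞ M]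

lemma contDiffOn_inChart (x₀ : M) {A : Set M} {f : M → ℝ} {k : WithTop ℕ∞} (hk : k ≤ (∞ : WithTop ℕ∞))
    (hf : ContMDiffOn (𝓡 n) 𝓘(ℝ, ℝ) k f A) : ContDiffOn ℝ k (inChart n x₀ f) (chartDom n x₀ A) := by
  rw [← contMDiffOn_iff_contDiffOn]
  exact hf.comp (((contMDiffOn_chart_symm (I := 𝓡 n) (n := ∞) (x := x₀)).of_le hk).mono
    inter_subset_left) (fun y hy => hy.2)

/-- The preferred charts at the points of `A` cover `A`, so regularity may be tested in them alone.
-/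
lemma contMDiffOn_of_inChart {A : Set M} (hA : IsOpen A) {f : M → ℝ} {k : WithTop ℕ∞}
    (hk : k ≤ (∞ : WithTop ℕ∞)) (hf : ∀ x₀ ∈ A, ContDiffOn ℝ k (inChart n x₀ f) (chartDom n x₀ A)) :
    ContMDiffOn (𝓡 n) 𝓘(ℝ, ℝ) k f A := by
  intro p hp
  have h1 : ContMDiffOn (𝓡 n) 𝓘(ℝ, ℝ) k (inChart n p f) (chartDom n p A) := (hf p hp).contMDiffOn
  have h2 := h1.comp (t := chartDom n p A) (s := (chartAt (Euc n) p).source ∩ A)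
    (((contMDiffOn_chart (I := 𝓡 n) (n := ∞) (x := p)).of_le hk).mono inter_subset_left)
    (fun q hq => ⟨(chartAt (Euc n) p).map_source hq.1, by
      rw [mem_preimage, (chartAt (Euc n) p).left_inv hq.1]; exact hq.2⟩)
  have h3 : ContMDiffOn (𝓡 n) 𝓘(ℝ, ℝ) k f ((chartAt (Euc n) p).source ∩ A) :=
    h2.congr fun q hq => by simp [inChart, (chartAt (Euc n) p).left_inv hq.1]
  exact (h3.contMDiffAt (((chartAt (Euc n) p).open_source.inter hA).mem_nhds
    ⟨mem_chart_source _ p, hp⟩)).contMDiffWithinAt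

lemma mdifferentiableAt_of_contMDiffOn {A : Set M} (hA : IsOpen A) {f : M → ℝ} {k : WithTop ℕ∞}
    (hk : k ≠ 0) (hf : ContMDiffOn (𝓡 n) 𝓘(ℝ, ℝ) k f A) {p : M} (hp : p ∈ A) :
    MDifferentiableAt (𝓡 n) 𝓘(ℝ, ℝ) f p :=
  (hf.contMDiffAt (hA.mem_nhds hp)).mdifferentiableAt hk

variable [IsContMDiffRiemannianBundle (𝓡 n) ∞ (Euc n) (fun x : M => TangentSpace (𝓡 n) x)]

lemma contDiffOn_gradFlux (x₀ : M) {A : Set M} (hA : IsOpen A) {f : M → ℝ} {k l : WithTop ℕ∞}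
    (hl : l ≤ (∞ : WithTop ℕ∞)) (hk : k + 1 ≤ l) (hf : ContMDiffOn (𝓡 n) 𝓘(ℝ, ℝ) l f A) (i : Fin n) :
    ContDiffOn ℝ k (gradFlux x₀ f i) (chartDom n x₀ A) := by
  have hk' : k ≤ (∞ : WithTop ℕ∞) := (le_self_add.trans hk).trans hl
  refine (((contDiffOn_volDensity x₀).of_le hk').mono inter_subset_left).mul ?_
  refine ContDiffOn.sum fun j _ => ?_
  exact (((contDiffOn_gram_inv x₀ i j).of_le hk').mono inter_subset_left).mul
    (contDiffOn_partialDeriv (isOpen_chartDom x₀ hA) (contDiffOn_inChart x₀ hl hf) hk j)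

lemma contDiffOn_chartLaplacian (x₀ : M) {A : Set M} (hA : IsOpen A) {f : M → ℝ}
    {k l : WithTop ℕ∞} (hl : l ≤ (∞ : WithTop ℕ∞)) (hk : k + 1 + 1 ≤ l)
    (hf : ContMDiffOn (𝓡 n) 𝓘(ℝ, ℝ) l f A) :
    ContDiffOn ℝ k (chartLaplacian x₀ f) (chartDom n x₀ A) := by
  have hk' : k ≤ (∞ : WithTop ℕ∞) := ((le_self_add.trans le_self_add).trans hk).trans hl
  refine ((((contDiffOn_volDensity x₀).of_le hk').mono inter_subset_left).inv
    fun y hy => (volDensity_pos x₀ hy.1).ne').mul ?_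
  exact ContDiffOn.sum fun i _ => contDiffOn_partialDeriv (isOpen_chartDom x₀ hA)
    (contDiffOn_gradFlux x₀ hA hl hk hf i) le_rfl i

lemma continuousOn_inner_grad {A : Set M} (hA : IsOpen A) {f h : M → ℝ}
    (hf : ContMDiffOn (𝓡 n) 𝓘(ℝ, ℝ) 1 f A) (hh : ContMDiffOn (𝓡 n) 𝓘(ℝ, ℝ) 1 h A) :
    ContinuousOn (fun p => inner ℝ (grad n f p) (grad n h p)) A := by
  refine (contMDiffOn_zero_iff (I := 𝓡 n) (I' := 𝓘(ℝ, ℝ))).1 ?_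
  refine contMDiffOn_of_inChart hA (by simp) fun x₀ _ => ?_
  have hO := isOpen_chartDom (n := n) x₀ hA
  have key : ContDiffOn ℝ 0 (fun y => ∑ i, partialDeriv i (inChart n x₀ f) y *
        ∑ j, (gram x₀ y)⁻¹ i j * partialDeriv j (inChart n x₀ h) y) (chartDom n x₀ A) := by
    refine ContDiffOn.sum fun i _ => ?_
    refine (contDiffOn_partialDeriv hO (contDiffOn_inChart x₀ (by simp) hf) (by simp) i).mul ?_
    refine ContDiffOn.sum fun j _ => ?_
    exact (((contDiffOn_gram_inv x₀ i j).of_le (by simp)).mono inter_subset_left).mul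
      (contDiffOn_partialDeriv hO (contDiffOn_inChart x₀ (by simp) hh) (by simp) j)
  refine key.congr fun y hy => ?_
  exact inner_grad_chart x₀ hy.1 (mdifferentiableAt_of_contMDiffOn hA one_ne_zero hf hy.2)
    (mdifferentiableAt_of_contMDiffOn hA one_ne_zero hh hy.2)

lemma continuousOn_norm_grad {A : Set M} (hA : IsOpen A) {f : M → ℝ}
    (hf : ContMDiffOn (𝓡 n) 𝓘(ℝ, ℝ) 1 f A) : ContinuousOn (fun p => ‖grad n f p‖) A := by
  simp only [norm_eq_sqrt_real_inner]
  exact (continuousOn_inner_grad hA hf hf).sqrt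

end ChartCalculus

/-! ### Green's formula and chart independence of the Laplacian. -/

section GreenFormula

lemma integrable_of_continuousOn_of_forall_notMem {X : Type*} [TopologicalSpace X] [T2Space X]
    [MeasurableSpace X] [OpensMeasurableSpace X] {μ : Measure X} [IsFiniteMeasureOnCompacts μ]
    {F : X → ℝ} {K : Set X} (hK : IsCompact K) (hF : ContinuousOn F K) (h0 : ∀ x ∉ K, F x = 0) :
    Integrable F μ := by
  rw [← integrableOn_iff_integrable_of_support_subset (s := K)
    (fun x hx => by_contra fun h => hx (h0 x h))]
  exact hF.integrableOn_compact hK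

variable {n : ℕ} {M : Type*} [MetricSpace M] [ChartedSpace (Euc n) M]
  [RiemannianBundle (fun x : M => TangentSpace (𝓡 n) x)] [IsManifold (𝓡 n) ∞ M]

/-- Compactness makes the image of the support closed in the model space. The extension by zero
therefore vanishes near every point outside the chart target, and stays smooth there. -/
lemma tsupport_indicator_inChart_subset (x₀ : M) {ψ : M → ℝ} (hc : HasCompactSupport ψ)
    (hs : tsupport ψ ⊆ (chartAt (Euc n) x₀).source) :
    tsupport ((chartAt (Euc n) x₀).target.indicator (inChart n x₀ ψ)) ⊆
      chartAt (Euc n) x₀ '' tsupport ψ := by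
  have hK : IsCompact (chartAt (Euc n) x₀ '' tsupport ψ) :=
    IsCompact.image_of_continuousOn hc ((chartAt (Euc n) x₀).continuousOn.mono hs)
  refine closure_minimal (fun y hy => ?_) hK.isClosed
  have hyT : y ∈ (chartAt (Euc n) x₀).target := by
    by_contra h
    exact hy (indicator_of_notMem h _)
  rw [Function.mem_support, indicator_of_mem hyT] at hy
  exact ⟨_, subset_tsupport _ hy, (chartAt (Euc n) x₀).right_inv hyT⟩

lemma contDiff_indicator_inChart (x₀ : M) {ψ : M → ℝ} {k : WithTop ℕ∞}
    (hk : k ≤ (∞ : WithTop ℕ∞)) (hψ : ContMDiff (𝓡 n) 𝓘(ℝ, ℝ) k ψ) (hc : HasCompactSupport ψ)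
    (hs : tsupport ψ ⊆ (chartAt (Euc n) x₀).source) :
    ContDiff ℝ k ((chartAt (Euc n) x₀).target.indicator (inChart n x₀ ψ)) := by
  rw [contDiff_iff_contDiffAt]
  intro y
  by_cases hy : y ∈ (chartAt (Euc n) x₀).target
  · have h1 : ContDiffOn ℝ k (inChart n x₀ ψ) (chartAt (Euc n) x₀).target :=
      (contDiffOn_inChart x₀ (A := univ) hk hψ.contMDiffOn).mono fun z hz => ⟨hz, mem_univ _⟩
    have hT := (chartAt (Euc n) x₀).open_target.mem_nhds hy
    refine (h1.contDiffAt hT).congr_of_eventuallyEq ?_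
    filter_upwards [hT] with z hz using indicator_of_mem hz _
  · have h2 : y ∉ tsupport ((chartAt (Euc n) x₀).target.indicator (inChart n x₀ ψ)) := fun h => by
      obtain ⟨p, hp, rfl⟩ := tsupport_indicator_inChart_subset x₀ hc hs h
      exact hy ((chartAt (Euc n) x₀).map_source (hs hp))
    exact (contDiffAt_const (c := (0 : ℝ))).congr_of_eventuallyEq
      (notMem_tsupport_iff_eventuallyEq.1 h2)

lemma tsupport_indicator_comp_chart_subset (x₀ : M) {φ : Euc n → ℝ} (hc : HasCompactSupport φ)
    (hs : tsupport φ ⊆ (chartAt (Euc n) x₀).target) :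
    tsupport ((chartAt (Euc n) x₀).source.indicator (fun p => φ (chartAt (Euc n) x₀ p))) ⊆
      (chartAt (Euc n) x₀).symm '' tsupport φ := by
  have hK : IsCompact ((chartAt (Euc n) x₀).symm '' tsupport φ) :=
    IsCompact.image_of_continuousOn hc ((chartAt (Euc n) x₀).continuousOn_symm.mono hs)
  refine closure_minimal (fun p hp => ?_) hK.isClosed
  have hpS : p ∈ (chartAt (Euc n) x₀).source := by
    by_contra h
    exact hp (indicator_of_notMem h _)
  rw [Function.mem_support, indicator_of_mem hpS] at hp
  exact ⟨_, subset_tsupport _ hp, (chartAt (Euc n) x₀).left_inv hpS⟩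

lemma hasCompactSupport_indicator_comp_chart (x₀ : M) {φ : Euc n → ℝ} (hc : HasCompactSupport φ)
    (hs : tsupport φ ⊆ (chartAt (Euc n) x₀).target) :
    HasCompactSupport
      ((chartAt (Euc n) x₀).source.indicator (fun p => φ (chartAt (Euc n) x₀ p))) :=
  (IsCompact.image_of_continuousOn hc
    ((chartAt (Euc n) x₀).continuousOn_symm.mono hs)).of_isClosed_subset (isClosed_tsupport _)
      (tsupport_indicator_comp_chart_subset x₀ hc hs)

lemma contMDiff_indicator_comp_chart (x₀ : M) {φ : Euc n → ℝ} {k : WithTop ℕ∞}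
    (hk : k ≤ (∞ : WithTop ℕ∞)) (hφ : ContDiff ℝ k φ) (hc : HasCompactSupport φ)
    (hs : tsupport φ ⊆ (chartAt (Euc n) x₀).target) :
    ContMDiff (𝓡 n) 𝓘(ℝ, ℝ) k
      ((chartAt (Euc n) x₀).source.indicator (fun p => φ (chartAt (Euc n) x₀ p))) := by
  intro p
  by_cases hp : p ∈ (chartAt (Euc n) x₀).source
  · have h1 : ContMDiffOn (𝓡 n) 𝓘(ℝ, ℝ) k (fun p => φ (chartAt (Euc n) x₀ p))
        (chartAt (Euc n) x₀).source :=
      hφ.contMDiff.comp_contMDiffOn ((contMDiffOn_chart (I := 𝓡 n) (n := ∞) (x := x₀)).of_le hk)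
    have hS := (chartAt (Euc n) x₀).open_source.mem_nhds hp
    refine (h1.contMDiffAt hS).congr_of_eventuallyEq ?_
    filter_upwards [hS] with z hz using indicator_of_mem hz _
  · have h2 : p ∉ tsupport
        ((chartAt (Euc n) x₀).source.indicator (fun p => φ (chartAt (Euc n) x₀ p))) := fun h => by
      obtain ⟨y, hy, rfl⟩ := tsupport_indicator_comp_chart_subset x₀ hc hs h
      exact hp ((chartAt (Euc n) x₀).map_target (hs hy))
    exact (contMDiffAt_const (c := (0 : ℝ))).congr_of_eventuallyEq
      (notMem_tsupport_iff_eventuallyEq.1 h2)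

variable [IsContMDiffRiemannianBundle (𝓡 n) ∞ (Euc n) (fun x : M => TangentSpace (𝓡 n) x)]
  [MeasurableSpace M] [BorelSpace M]

/-- Integration by parts in a single chart. -/
lemma integral_mul_chartLaplacian (x₀ : M) {A : Set M} (hA : IsOpen A)
    (hAS : A ⊆ (chartAt (Euc n) x₀).source) {v ψ : M → ℝ}
    (hv : ContMDiffOn (𝓡 n) 𝓘(ℝ, ℝ) 2 v A) (hψ : ContMDiff (𝓡 n) 𝓘(ℝ, ℝ) 1 ψ)
    (hc : HasCompactSupport ψ) (hs : tsupport ψ ⊆ A) :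
    ∫ x in A, ψ x * chartLaplacian x₀ v (chartAt (Euc n) x₀ x) ∂(riemVolume n M) =
      -∫ x in A, inner ℝ (grad n ψ x) (grad n v x) ∂(riemVolume n M) := by
  set c := chartAt (Euc n) x₀ with hcdef
  have hO := isOpen_chartDom (n := n) x₀ hA
  set O := chartDom n x₀ A with hOdef
  have hsS : tsupport ψ ⊆ c.source := hs.trans hAS
  set Ψ := c.target.indicator (inChart n x₀ ψ) with hΨdef
  have hΨ : ContDiff ℝ 1 Ψ := contDiff_indicator_inChart x₀ (by simp) hψ hc hsS
  have hts : tsupport Ψ ⊆ c '' tsupport ψ := tsupport_indicator_inChart_subset x₀ hc hsS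
  have htsO : tsupport Ψ ⊆ O := hts.trans <| by
    rintro _ ⟨p, hp, rfl⟩
    refine ⟨c.map_source (hsS hp), ?_⟩
    rw [mem_preimage, c.left_inv (hsS hp)]
    exact hs hp
  have hK : IsCompact (tsupport Ψ) := (IsCompact.image_of_continuousOn hc
    (c.continuousOn.mono hsS)).of_isClosed_subset (isClosed_tsupport _) hts
  have hW : ∀ i, ContDiffOn ℝ 1 (gradFlux x₀ v i) O := fun i =>
    contDiffOn_gradFlux x₀ hA (l := 2) ENat.LEInfty.out (by norm_num) hv i
  have hdW : ∀ i, ContinuousOn (partialDeriv i (gradFlux x₀ v i)) O := fun i =>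
    (contDiffOn_partialDeriv hO (k := 0) (hW i) (by simp) i).continuousOn
  have hdΨ : ∀ i, Continuous (partialDeriv i Ψ) := fun i =>
    (hΨ.continuous_fderiv one_ne_zero).clm_apply continuous_const
  have hΨ0 : ∀ y ∉ tsupport Ψ, Ψ y = 0 := fun y hy => image_eq_zero_of_notMem_tsupport hy
  have hdΨ0 : ∀ i, ∀ y ∉ tsupport Ψ, partialDeriv i Ψ y = 0 := fun i y hy => by
    rw [partialDeriv_congr (notMem_tsupport_iff_eventuallyEq.1 hy)]
    simp [partialDeriv]
  have int1 : ∀ i, Integrable (fun y => Ψ y * partialDeriv i (gradFlux x₀ v i) y) := fun i =>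
    integrable_of_continuousOn_of_forall_notMem hK
      (hΨ.continuous.continuousOn.mul ((hdW i).mono htsO)) fun y hy => by simp [hΨ0 y hy]
  have int2 : ∀ i, Integrable (fun y => partialDeriv i Ψ y * gradFlux x₀ v i y) := fun i =>
    integrable_of_continuousOn_of_forall_notMem hK
      ((hdΨ i).continuousOn.mul ((hW i).continuousOn.mono htsO)) fun y hy => by simp [hdΨ0 i y hy]
  have int3 : ∀ i, Integrable (fun y => Ψ y * gradFlux x₀ v i y) := fun i =>
    integrable_of_continuousOn_of_forall_notMem hK
      (hΨ.continuous.continuousOn.mul ((hW i).continuousOn.mono htsO))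
      fun y hy => by simp [hΨ0 y hy]
  -- The flux is differentiable only in `O`, but this is needed only on the support of `Ψ`, so
  -- integration by parts over the whole model space applies.
  have ibp : ∀ i, ∫ y, Ψ y * partialDeriv i (gradFlux x₀ v i) y =
      -∫ y, partialDeriv i Ψ y * gradFlux x₀ v i y := fun i =>
    integral_mul_fderiv_eq_neg_fderiv_mul_of_integrable (int2 i) (int1 i) (int3 i)
      (fun y _ => hΨ.differentiable one_ne_zero y)
      (fun y hy => ((hW i).differentiableOn one_ne_zero).differentiableAt (hO.mem_nhds (htsO hy)))
  have hL : ContinuousOn (fun x => ψ x * chartLaplacian x₀ v (c x)) A := by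
    refine hψ.continuous.continuousOn.mul ?_
    refine (contDiffOn_chartLaplacian x₀ hA (k := 0) (l := 2) ENat.LEInfty.out
      (by norm_num) hv).continuousOn.comp (c.continuousOn.mono hAS) fun x hx => ?_
    refine ⟨c.map_source (hAS hx), ?_⟩
    rw [mem_preimage, c.left_inv (hAS hx)]
    exact hx
  have hR : ContinuousOn (fun x => inner ℝ (grad n ψ x) (grad n v x)) A :=
    continuousOn_inner_grad hA hψ.contMDiffOn (hv.of_le (by norm_num))
  rw [setIntegral_source x₀ hA.measurableSet hAS (hL.aestronglyMeasurable hA.measurableSet),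
    setIntegral_source x₀ hA.measurableSet hAS (hR.aestronglyMeasurable hA.measurableSet)]
  -- The weight of the volume cancels the factor in front of the Laplacian, leaving a Euclidean
  -- divergence.
  have e1 : ∫ y in O, volDensity x₀ y * (ψ (c.symm y) * chartLaplacian x₀ v (c (c.symm y))) =
      ∑ i, ∫ y, Ψ y * partialDeriv i (gradFlux x₀ v i) y := by
    rw [← integral_finsetSum _ fun i _ => int1 i]
    refine Eq.trans ?_ (setIntegral_eq_integral_of_forall_compl_eq_zero (s := O) ?_)
    · refine setIntegral_congr_fun hO.measurableSet fun y hy => ?_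
      have hvd := (volDensity_pos x₀ hy.1).ne'
      have hΨy : Ψ y = ψ (c.symm y) := indicator_of_mem hy.1 _
      simp only [hΨy, c.right_inv hy.1, chartLaplacian_eq, ← Finset.mul_sum]
      field_simp
    · intro y hy
      simp [hΨ0 y fun h => hy (htsO h)]
  have e2 : ∫ y in O, volDensity x₀ y * inner ℝ (grad n ψ (c.symm y)) (grad n v (c.symm y)) =
      ∑ i, ∫ y, partialDeriv i Ψ y * gradFlux x₀ v i y := by
    rw [← integral_finsetSum _ fun i _ => int2 i]
    refine Eq.trans ?_ (setIntegral_eq_integral_of_forall_compl_eq_zero (s := O) ?_)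
    · refine setIntegral_congr_fun hO.measurableSet fun y hy => ?_
      rw [inner_grad_chart x₀ hy.1 (hψ.mdifferentiableAt one_ne_zero)
        (mdifferentiableAt_of_contMDiffOn hA two_ne_zero hv hy.2), Finset.mul_sum]
      refine Finset.sum_congr rfl fun i _ => ?_
      have : Ψ =ᶠ[𝓝 y] inChart n x₀ ψ := by
        filter_upwards [c.open_target.mem_nhds hy.1] with z hz using indicator_of_mem hz _
      rw [partialDeriv_congr this, gradFlux]
      ring
    · intro y hy
      simp [hdΨ0 _ y fun h => hy (htsO h)]
  rw [show c.target ∩ c.symm ⁻¹' A = O from rfl, e1, e2, ← Finset.sum_neg_distrib]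
  exact Finset.sum_congr rfl fun i _ => ibp i

/-- No coordinate computation is needed: both expressions satisfy the integration by parts formula,
whose right side ∫⟨∇ψ, ∇v⟩ does not mention the chart. Their difference is thus orthogonal to all
test functions, so it vanishes almost everywhere, and by continuity everywhere on the overlap. -/
lemma chartLaplacian_congr_chart {A : Set M} (hA : IsOpen A) {v : M → ℝ}
    (hv : ContMDiffOn (𝓡 n) 𝓘(ℝ, ℝ) 2 v A) {x₀ x₁ p : M} (hpA : p ∈ A)
    (h0 : p ∈ (chartAt (Euc n) x₀).source) (h1 : p ∈ (chartAt (Euc n) x₁).source) :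
    chartLaplacian x₀ v (chartAt (Euc n) x₀ p) = chartLaplacian x₁ v (chartAt (Euc n) x₁ p) := by
  set c := chartAt (Euc n) x₀ with hcdef
  set U := A ∩ c.source ∩ (chartAt (Euc n) x₁).source with hUdef
  have hU : IsOpen U := (hA.inter c.open_source).inter (chartAt (Euc n) x₁).open_source
  have hU0 : U ⊆ c.source := fun q hq => hq.1.2
  have hU1 : U ⊆ (chartAt (Euc n) x₁).source := fun q hq => hq.2
  have hvU : ContMDiffOn (𝓡 n) 𝓘(ℝ, ℝ) 2 v U := hv.mono fun q hq => hq.1.1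
  have hO := isOpen_chartDom (n := n) x₀ hU
  set O := chartDom n x₀ U with hOdef
  have hcont : ∀ x, U ⊆ (chartAt (Euc n) x).source →
      ContinuousOn (fun q => chartLaplacian x v (chartAt (Euc n) x q)) U := by
    intro x hx
    refine (contDiffOn_chartLaplacian x hU (k := 0) (l := 2) ENat.LEInfty.out
      (by norm_num) hvU).continuousOn.comp ((chartAt (Euc n) x).continuousOn.mono hx) fun q hq => ?_
    refine ⟨(chartAt (Euc n) x).map_source (hx hq), ?_⟩
    rw [mem_preimage, (chartAt (Euc n) x).left_inv (hx hq)]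
    exact hq
  set D : M → ℝ := fun q => chartLaplacian x₀ v (c q) -
    chartLaplacian x₁ v (chartAt (Euc n) x₁ q) with hDdef
  have hD : ContinuousOn D U := (hcont x₀ hU0).sub (hcont x₁ hU1)
  have hDO : ContinuousOn (fun y => volDensity x₀ y * D (c.symm y)) O :=
    ((contDiffOn_volDensity x₀).continuousOn.mono inter_subset_left).mul
      (hD.comp (c.continuousOn_symm.mono inter_subset_left) fun y hy => hy.2)
  have hae : ∀ᵐ y ∂(volume : Measure (Euc n)), y ∈ O → volDensity x₀ y * D (c.symm y) = 0 := by
    refine hO.ae_eq_zero_of_integral_contDiff_smul_eq_zero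
      (hDO.locallyIntegrableOn hO.measurableSet) fun φ hφ hφc hφs => ?_
    have hφT : tsupport φ ⊆ c.target := hφs.trans inter_subset_left
    set ψ := c.source.indicator (fun q => φ (c q)) with hψdef
    have hψ : ContMDiff (𝓡 n) 𝓘(ℝ, ℝ) 1 ψ :=
      contMDiff_indicator_comp_chart x₀ (by simp) (hφ.of_le (by simp)) hφc hφT
    have hψc : HasCompactSupport ψ := hasCompactSupport_indicator_comp_chart x₀ hφc hφT
    have hψs : tsupport ψ ⊆ U := (tsupport_indicator_comp_chart_subset x₀ hφc hφT).trans <| by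
      rintro _ ⟨y, hy, rfl⟩
      exact (hφs hy).2
    have hint : ∀ x, U ⊆ (chartAt (Euc n) x).source → IntegrableOn
        (fun q => ψ q * chartLaplacian x v (chartAt (Euc n) x q)) U (riemVolume n M) :=
      fun x hx => (integrable_of_continuousOn_of_forall_notMem hψc
        (hψ.continuous.continuousOn.mul ((hcont x hx).mono hψs)) fun q hq => by
          simp [image_eq_zero_of_notMem_tsupport hq]).integrableOn
    have e0 : ∫ q in U, ψ q * D q ∂(riemVolume n M) = 0 := by
      simp only [hDdef, mul_sub]
      rw [integral_sub (hint x₀ hU0) (hint x₁ hU1),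
        integral_mul_chartLaplacian x₀ hU hU0 hvU hψ hψc hψs,
        integral_mul_chartLaplacian x₁ hU hU1 hvU hψ hψc hψs, sub_self]
    rw [setIntegral_source x₀ (f := fun q => ψ q * D q) hU.measurableSet hU0
      ((hψ.continuous.continuousOn.mul hD).aestronglyMeasurable hU.measurableSet)] at e0
    rw [← e0, ← setIntegral_eq_integral_of_forall_compl_eq_zero (s := O)]
    · refine setIntegral_congr_fun hO.measurableSet fun y hy => ?_
      have hψy : ψ (c.symm y) = φ y := by
        rw [hψdef, indicator_of_mem (c.map_target hy.1), c.right_inv hy.1]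
      simp only [smul_eq_mul]
      rw [hψy]
      ring
    · intro y hy
      rw [image_eq_zero_of_notMem_tsupport fun h => hy (hφs h), zero_smul]
  have heq : EqOn (fun y => volDensity x₀ y * D (c.symm y)) (fun _ => 0) O :=
    Measure.eqOn_open_of_ae_eq ((ae_restrict_iff' hO.measurableSet).2 hae) hO hDO
      continuousOn_const
  have hp : c p ∈ O := ⟨c.map_source h0, by
    rw [mem_preimage, c.left_inv h0]; exact ⟨⟨hpA, h0⟩, h1⟩⟩
  have := heq hp
  simp only [c.left_inv h0, mul_eq_zero, (volDensity_pos x₀ hp.1).ne', false_or] at this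
  exact sub_eq_zero.1 this

lemma lap_eq_chartLaplacian {A : Set M} (hA : IsOpen A) {v : M → ℝ}
    (hv : ContMDiffOn (𝓡 n) 𝓘(ℝ, ℝ) 2 v A) {x₀ p : M} (hpA : p ∈ A)
    (h0 : p ∈ (chartAt (Euc n) x₀).source) :
    lap n v p = chartLaplacian x₀ v (chartAt (Euc n) x₀ p) :=
  chartLaplacian_congr_chart hA hv hpA (mem_chart_source _ p) h0

lemma lap_chart_symm {A : Set M} (hA : IsOpen A) {v : M → ℝ}
    (hv : ContMDiffOn (𝓡 n) 𝓘(ℝ, ℝ) 2 v A) (x₀ : M) {y : Euc n} (hy : y ∈ chartDom n x₀ A) :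
    lap n v ((chartAt (Euc n) x₀).symm y) = chartLaplacian x₀ v y := by
  rw [lap_eq_chartLaplacian hA hv hy.2 ((chartAt (Euc n) x₀).map_target hy.1),
    (chartAt (Euc n) x₀).right_inv hy.1]

/-- The chart in the definition of `lap` moves with the point; chart independence allows it to be
frozen locally before differentiating. -/
lemma contMDiffOn_lap {A : Set M} (hA : IsOpen A) {v : M → ℝ} {k l : WithTop ℕ∞}
    (hl : l ≤ (∞ : WithTop ℕ∞)) (hk : k + 1 + 1 ≤ l) (hv : ContMDiffOn (𝓡 n) 𝓘(ℝ, ℝ) l v A) :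
    ContMDiffOn (𝓡 n) 𝓘(ℝ, ℝ) k (lap n v) A := by
  have h2 : (2 : WithTop ℕ∞) ≤ l := by
    refine le_trans ?_ hk
    rw [add_assoc, one_add_one_eq_two]
    exact le_add_self
  refine contMDiffOn_of_inChart hA (((le_self_add.trans le_self_add).trans hk).trans hl)
    fun x₀ _ => ?_
  exact (contDiffOn_chartLaplacian x₀ hA hl hk hv).congr fun y hy =>
    lap_chart_symm hA (hv.of_le h2) x₀ hy

lemma grad_finset_sum {ι : Type*} (s : Finset ι) {f : ι → M → ℝ} {p : M}
    (hf : ∀ i ∈ s, MDifferentiableAt (𝓡 n) 𝓘(ℝ, ℝ) (f i) p) :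
    grad n (fun x => ∑ i ∈ s, f i x) p = ∑ i ∈ s, grad n (f i) p := by
  classical
  suffices h : MDifferentiableAt (𝓡 n) 𝓘(ℝ, ℝ) (fun x => ∑ i ∈ s, f i x) p ∧
      grad n (fun x => ∑ i ∈ s, f i x) p = ∑ i ∈ s, grad n (f i) p from h.2
  induction s using Finset.induction_on with
  | empty =>
    simp only [Finset.sum_empty]
    exact ⟨mdifferentiableAt_const, grad_eq_zero_of_notMem_tsupport (by simp [tsupport])⟩
  | insert a s ha ih =>
    obtain ⟨h1, h2⟩ := ih fun i hi => hf i (Finset.mem_insert_of_mem hi)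
    have h3 := hf a (Finset.mem_insert_self a s)
    simp only [Finset.sum_insert ha]
    exact ⟨h3.add h1, by rw [grad_add h3 h1, h2]⟩

/-- **Green's formula**: `∫ ψ Δv = -∫ ⟨∇ψ, ∇v⟩` for `v` of class `C²` in an open set and `ψ` of
class `C¹` with compact support in it. -/
theorem integral_mul_lap [SigmaCompactSpace M] {A : Set M} (hA : IsOpen A) {v ψ : M → ℝ}
    (hv : ContMDiffOn (𝓡 n) 𝓘(ℝ, ℝ) 2 v A) (hψ : ContMDiff (𝓡 n) 𝓘(ℝ, ℝ) 1 ψ)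
    (hc : HasCompactSupport ψ) (hs : tsupport ψ ⊆ A) :
    ∫ x in A, ψ x * lap n v x ∂(riemVolume n M) =
      -∫ x in A, inner ℝ (grad n ψ x) (grad n v x) ∂(riemVolume n M) := by
  -- Finitely many charts cover the support, so the partition of unity is indexed by a finite type
  -- and all sums below are finite.
  obtain ⟨t, ht⟩ := hc.isCompact.elim_finite_subcover (fun x : M => (chartAt (Euc n) x).source)
    (fun x => (chartAt (Euc n) x).open_source)
    (fun x _ => mem_iUnion.2 ⟨x, mem_chart_source _ x⟩)
  obtain ⟨ρ, hρ⟩ := SmoothPartitionOfUnity.exists_isSubordinate (𝓡 n) (isClosed_tsupport ψ)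
    (fun x : t => (chartAt (Euc n) (x : M)).source) (fun x => (chartAt (Euc n) (x : M)).open_source)
    (fun x hx => by
      obtain ⟨i, hi, hxi⟩ := mem_iUnion₂.1 (ht hx)
      exact mem_iUnion.2 ⟨⟨i, hi⟩, hxi⟩)
  have hsum : ∀ x, ψ x = ∑ i, ρ i x * ψ x := by
    intro x
    rw [← Finset.sum_mul]
    by_cases hx : x ∈ tsupport ψ
    · rw [← finsum_eq_sum_of_fintype, ρ.sum_eq_one hx, one_mul]
    · rw [image_eq_zero_of_notMem_tsupport hx, mul_zero]
  have hρψ : ∀ i, ContMDiff (𝓡 n) 𝓘(ℝ, ℝ) 1 (fun x => ρ i x * ψ x) := fun i =>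
    ((ρ i).contMDiff.of_le (by simp)).mul hψ
  have hts : ∀ i, tsupport (fun x => ρ i x * ψ x) ⊆ tsupport ψ := fun i =>
    tsupport_mul_subset_right
  have hts' : ∀ i, tsupport (fun x => ρ i x * ψ x) ⊆ (chartAt (Euc n) (i : M)).source := fun i =>
    tsupport_mul_subset_left.trans (hρ i)
  have hcs : ∀ i, HasCompactSupport (fun x => ρ i x * ψ x) := fun i =>
    hc.of_isClosed_subset (isClosed_tsupport _) (hts i)
  have hlap : ContinuousOn (lap n v) A :=
    (contMDiffOn_lap hA (k := 0) ENat.LEInfty.out (by norm_num) hv).continuousOn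
  have int1 : ∀ i, IntegrableOn (fun x => ρ i x * ψ x * lap n v x) A (riemVolume n M) := fun i =>
    (integrable_of_continuousOn_of_forall_notMem (hcs i)
      ((hρψ i).continuous.continuousOn.mul (hlap.mono ((hts i).trans hs))) fun q hq => by
        simp [image_eq_zero_of_notMem_tsupport hq]).integrableOn
  have hgrad : ∀ i, ContinuousOn
      (fun x => inner ℝ (grad n (fun x => ρ i x * ψ x) x) (grad n v x)) A := fun i =>
    continuousOn_inner_grad hA (hρψ i).contMDiffOn (hv.of_le (by norm_num))
  have int2 : ∀ i, IntegrableOn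
      (fun x => inner ℝ (grad n (fun x => ρ i x * ψ x) x) (grad n v x)) A (riemVolume n M) :=
    fun i => (integrable_of_continuousOn_of_forall_notMem (hcs i)
      ((hgrad i).mono ((hts i).trans hs)) fun q hq => by
        simp [grad_eq_zero_of_notMem_tsupport hq]).integrableOn
  have local_green : ∀ i, ∫ x in A, ρ i x * ψ x * lap n v x ∂(riemVolume n M) =
      -∫ x in A, inner ℝ (grad n (fun x => ρ i x * ψ x) x) (grad n v x) ∂(riemVolume n M) := by
    intro i
    -- Both integrands vanish outside `B`, so the formula in the single chart can be used there.
    set B := A ∩ (chartAt (Euc n) (i : M)).source with hB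
    have hBo : IsOpen B := hA.inter (chartAt (Euc n) (i : M)).open_source
    have hsB : tsupport (fun x => ρ i x * ψ x) ⊆ B := subset_inter ((hts i).trans hs) (hts' i)
    have h1 := integral_mul_chartLaplacian (i : M) hBo inter_subset_right
      (hv.mono inter_subset_left) (hρψ i) (hcs i) hsB
    rw [setIntegral_eq_of_subset_of_forall_sdiff_eq_zero hA.measurableSet
        (inter_subset_left : B ⊆ A) (fun x hx => ?_),
      setIntegral_eq_of_subset_of_forall_sdiff_eq_zero (f := fun x =>
        inner ℝ (grad n (fun x => ρ i x * ψ x) x) (grad n v x)) hA.measurableSet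
        (inter_subset_left : B ⊆ A) (fun x hx => ?_), ← h1]
    · refine setIntegral_congr_fun hBo.measurableSet fun x hx => ?_
      simp only [lap_eq_chartLaplacian hA hv hx.1 hx.2]
    · simp [grad_eq_zero_of_notMem_tsupport fun h => hx.2 (hsB h)]
    · have := image_eq_zero_of_notMem_tsupport fun h => hx.2 (hsB h)
      rw [this, zero_mul]
  have e1 : ∫ x in A, ψ x * lap n v x ∂(riemVolume n M) =
      ∑ i, ∫ x in A, ρ i x * ψ x * lap n v x ∂(riemVolume n M) := by
    rw [← integral_finsetSum _ fun i _ => int1 i]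
    refine integral_congr_ae (Eventually.of_forall fun x => ?_)
    simp only [← Finset.sum_mul, ← hsum]
  have e2 : ∫ x in A, inner ℝ (grad n ψ x) (grad n v x) ∂(riemVolume n M) =
      ∑ i, ∫ x in A, inner ℝ (grad n (fun x => ρ i x * ψ x) x) (grad n v x) ∂(riemVolume n M) := by
    rw [← integral_finsetSum _ fun i _ => int2 i]
    refine integral_congr_ae (Eventually.of_forall fun x => ?_)
    simp only [← sum_inner]
    rw [← grad_finset_sum _ fun i _ => (hρψ i).mdifferentiableAt one_ne_zero]
    congr 2
    exact funext hsum
  rw [e1, e2, ← Finset.sum_neg_distrib]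
  exact Finset.sum_congr rfl fun i _ => local_green i

/-- The flux of θ∘f is θ'(f) times the flux of f. In the product rule, the term where θ'(f) is
differentiated reassembles into |∇f|². -/
lemma lap_comp {A : Set M} (hA : IsOpen A) {f : M → ℝ} {θ : ℝ → ℝ} (hθ : ContDiff ℝ 2 θ)
    (hf : ContMDiffOn (𝓡 n) 𝓘(ℝ, ℝ) 2 f A) {p : M} (hp : p ∈ A) :
    lap n (fun x => θ (f x)) p =
      deriv θ (f p) * lap n f p + deriv (deriv θ) (f p) * ‖grad n f p‖ ^ 2 := by
  set c := chartAt (Euc n) p with hc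
  have hO := isOpen_chartDom (n := n) p hA
  have hy : c p ∈ chartDom n p A :=
    ⟨mem_chart_target _ p, by rw [mem_preimage, c.left_inv (mem_chart_source _ p)]; exact hp⟩
  have hF := contDiffOn_inChart p ENat.LEInfty.out hf
  have hFd : ∀ z ∈ chartDom n p A, DifferentiableAt ℝ (inChart n p f) z := fun z hz =>
    (hF.differentiableOn two_ne_zero).differentiableAt (hO.mem_nhds hz)
  have hflux : ∀ i, gradFlux p (fun x => θ (f x)) i =ᶠ[𝓝 (c p)]
      fun z => deriv θ (inChart n p f z) * gradFlux p f i z := by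
    intro i
    filter_upwards [hO.mem_nhds hy] with z hz
    have h1 : ∀ j, partialDeriv j (inChart n p fun x => θ (f x)) z =
        deriv θ (inChart n p f z) * partialDeriv j (inChart n p f) z := fun j =>
      partialDeriv_comp (hFd z hz) (hθ.differentiable two_ne_zero _) j
    simp only [gradFlux, h1, Finset.mul_sum]
    exact Finset.sum_congr rfl fun j _ => by ring
  have hθ' : Differentiable ℝ (deriv θ) :=
    ((contDiff_succ_iff_deriv (n := 1)).1 hθ).2.2.differentiable one_ne_zero
  have hW : ∀ i, DifferentiableAt ℝ (gradFlux p f i) (c p) := fun i =>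
    ((contDiffOn_gradFlux p hA (k := 1) (l := 2) ENat.LEInfty.out (by norm_num) hf
      i).differentiableOn one_ne_zero).differentiableAt (hO.mem_nhds hy)
  have hpart : ∀ i, partialDeriv i (gradFlux p (fun x => θ (f x)) i) (c p) =
      deriv θ (f p) * partialDeriv i (gradFlux p f i) (c p) +
        gradFlux p f i (c p) * (deriv (deriv θ) (f p) * partialDeriv i (inChart n p f) (c p)) := by
    intro i
    have e : inChart n p f (c p) = f p := congrArg f (c.left_inv (mem_chart_source _ p))
    have hd : DifferentiableAt ℝ (fun z => deriv θ (inChart n p f z)) (c p) :=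
      hθ'.differentiableAt.comp _ (hFd _ hy)
    rw [partialDeriv_congr (hflux i), partialDeriv_mul hd (hW i), partialDeriv_comp (hFd _ hy) hθ'.differentiableAt, e]
  have hnorm : ‖grad n f p‖ ^ 2 = ∑ i, partialDeriv i (inChart n p f) (c p) *
        ∑ j, (gram p (c p))⁻¹ i j * partialDeriv j (inChart n p f) (c p) := by
    have hd := mdifferentiableAt_of_contMDiffOn hA two_ne_zero hf hy.2
    rw [← inner_grad_chart p hy.1 hd hd, real_inner_self_eq_norm_sq,
      c.left_inv (mem_chart_source _ p)]
  change chartLaplacian p _ (c p) = _ * chartLaplacian p f (c p) + _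
  have hvd := (volDensity_pos p hy.1).ne'
  rw [chartLaplacian_eq, chartLaplacian_eq, hnorm]
  simp only [hpart, Finset.sum_add_distrib, mul_add, Finset.mul_sum]
  congr 1
  · exact Finset.sum_congr rfl fun i _ => by ring
  · refine Finset.sum_congr rfl fun i _ => ?_
    simp only [gradFlux, Finset.mul_sum, Finset.sum_mul]
    refine Finset.sum_congr rfl fun j _ => ?_
    field_simp

end GreenFormula

/-! ### Hopf–Rinow: bounded closed sets are compact. -/

section HopfRinow

/-- A complete locally compact metric space in which points can be interpolated up to an arbitrarily
small error is proper. -/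
lemma properSpace_of_exists_dist_add_lt {X : Type*} [MetricSpace X] [CompleteSpace X]
    [LocallyCompactSpace X]
    (hX : ∀ (x y : X) (s ε : ℝ), 0 ≤ s → s ≤ dist x y → 0 < ε →
      ∃ z, dist x z = s ∧ dist x z + dist z y < dist x y + ε) : ProperSpace X := by
  refine ⟨fun x => ?_⟩
  -- The set of compact radii is open to the right: a point at distance at most r + δ/2 from `x` is
  -- within δ of an interpolating point of the ball of radius `r`, and a δ-thickening of that ball
  -- lies in a compact set.
  have step : ∀ r, 0 ≤ r → IsCompact (Metric.closedBall x r) →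
      ∃ ε > 0, IsCompact (Metric.closedBall x (r + ε)) := by
    intro r hr hK
    obtain ⟨K', hK', hKK'⟩ := exists_compact_superset hK
    obtain ⟨δ, hδ, hsub⟩ := hK.exists_thickening_subset_open isOpen_interior hKK'
    refine ⟨δ / 2, half_pos hδ,
      hK'.of_isClosed_subset Metric.isClosed_closedBall fun y hy => interior_subset (hsub ?_)⟩
    rw [Metric.mem_closedBall, dist_comm] at hy
    rw [Metric.mem_thickening_iff]
    by_cases h : dist x y ≤ r
    · exact ⟨y, by rwa [Metric.mem_closedBall, dist_comm], by simpa using hδ⟩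
    · obtain ⟨z, hz, hzy⟩ := hX x y r (δ / 2) hr (not_le.1 h).le (half_pos hδ)
      refine ⟨z, by rw [Metric.mem_closedBall, dist_comm, hz], ?_⟩
      rw [dist_comm]
      linarith
  -- The set of compact radii is closed from the left: every point of the R-ball is within ε/2 of
  -- the ball of radius R − ε/4, so a finite ε/2-net of the latter is an ε-net of the former. The
  -- maximum with 0 keeps the interpolation parameter nonnegative.
  have limit : ∀ R, 0 < R → (∀ r < R, IsCompact (Metric.closedBall x r)) →
      IsCompact (Metric.closedBall x R) := by
    intro R hR hc
    rw [isCompact_iff_totallyBounded_isComplete]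
    refine ⟨Metric.totallyBounded_iff.2 fun ε hε => ?_, Metric.isClosed_closedBall.isComplete⟩
    obtain ⟨t, ht, hcov⟩ := Metric.totallyBounded_iff.1
      (hc (max (R - ε / 4) 0) (max_lt (by linarith) hR)).totallyBounded (ε / 2) (half_pos hε)
    refine ⟨t, ht, fun y hy => ?_⟩
    rw [Metric.mem_closedBall, dist_comm] at hy
    obtain ⟨z, hz, hzy⟩ : ∃ z, dist x z ≤ max (R - ε / 4) 0 ∧ dist z y < ε / 2 := by
      by_cases h : dist x y ≤ max (R - ε / 4) 0
      · exact ⟨y, h, by simpa using hε⟩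
      · obtain ⟨z, hz, hzy⟩ := hX x y (max (R - ε / 4) 0) (ε / 4) (le_max_right _ _)
          (not_le.1 h).le (by linarith)
        have := le_max_left (R - ε / 4) 0
        exact ⟨z, hz.le, by linarith⟩
    have hz' := hcov (show z ∈ Metric.closedBall x _ by rwa [Metric.mem_closedBall, dist_comm])
    simp only [mem_iUnion, Metric.mem_ball] at hz' ⊢
    obtain ⟨w, hw, hzw⟩ := hz'
    refine ⟨w, hw, ?_⟩
    have := dist_triangle y z w
    rw [dist_comm y z] at this
    linarith
  by_contra! hcon
  obtain ⟨r₀, hr₀⟩ := hcon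
  -- The ball whose radius is the infimum of `S` is compact by `limit`, and then `step` contradicts
  -- the choice of the infimum.
  set S := {r | ¬ IsCompact (Metric.closedBall x r)} with hS
  have hbd : ∀ r ∈ S, 0 ≤ r := by
    intro r hr
    by_contra! h
    exact hr (by simp [Metric.closedBall_eq_empty.2 h])
  have hbdd : BddBelow S := ⟨0, hbd⟩
  have hR0 : 0 ≤ sInf S := le_csInf ⟨r₀, hr₀⟩ hbd
  have hlt : ∀ r < sInf S, IsCompact (Metric.closedBall x r) := fun r hr => by
    by_contra h
    exact absurd (csInf_le hbdd (show r ∈ S from h)) (not_le.2 hr)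
  have hRc : IsCompact (Metric.closedBall x (sInf S)) := by
    rcases hR0.eq_or_lt with h | h
    · rw [← h, Metric.closedBall_zero]
      exact isCompact_singleton
    · exact limit _ h hlt
  obtain ⟨ε, hε, hc⟩ := step _ hR0 hRc
  have : sInf S + ε ≤ sInf S := le_csInf ⟨r₀, hr₀⟩ fun r hr => by
    by_contra! h
    exact hr (hc.of_isClosed_subset Metric.isClosed_closedBall
      (Metric.closedBall_subset_closedBall h.le))
  linarith

/-- The point is taken on a curve of length less than dist x y + ε, where the distance to `x` equals
`s` by the intermediate value theorem. The lengths of the two arcs bound the two distances and add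
up. -/
lemma exists_dist_add_lt (n : ℕ) {M : Type*} [MetricSpace M] [ChartedSpace (Euc n) M]
    [RiemannianBundle (fun x : M => TangentSpace (𝓡 n) x)] [IsManifold (𝓡 n) ∞ M]
    [IsContMDiffRiemannianBundle (𝓡 n) ∞ (Euc n) (fun x : M => TangentSpace (𝓡 n) x)]
    [IsRiemannianManifold (𝓡 n) M] (x y : M) (s ε : ℝ) (hs : 0 ≤ s) (hsd : s ≤ dist x y) (hε : 0 < ε) :
    ∃ z, dist x z = s ∧ dist x z + dist z y < dist x y + ε := by
  have h1 : Manifold.riemannianEDist (𝓡 n) x y < ENNReal.ofReal (dist x y + ε) := by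
    rw [← IsRiemannianManifold.out (I := 𝓡 n), edist_dist]
    exact (ENNReal.ofReal_lt_ofReal_iff (by positivity)).2 (by linarith)
  obtain ⟨γ, h0, h1', hγ, hlen⟩ := Manifold.exists_lt_of_riemannianEDist_lt h1
  have hcont : ContinuousOn (fun t => dist x (γ t)) (Icc 0 1) :=
    (continuous_const.dist continuous_id).comp_continuousOn hγ.continuousOn
  obtain ⟨t, ht, hts⟩ := intermediate_value_Icc zero_le_one hcont
    (show s ∈ Icc _ _ by simp only [h0, h1', dist_self]; exact ⟨hs, hsd⟩)
  refine ⟨γ t, hts, ?_⟩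
  have e1 := Manifold.riemannianEDist_le_pathELength (I := 𝓡 n)
    (hγ.mono (Icc_subset_Icc_right ht.2)) h0 rfl ht.1
  have e2 := Manifold.riemannianEDist_le_pathELength (I := 𝓡 n)
    (hγ.mono (Icc_subset_Icc_left ht.1)) rfl h1' ht.2
  rw [← IsRiemannianManifold.out (I := 𝓡 n), edist_dist] at e1 e2
  have e3 := (add_le_add e1 e2).trans_lt
    ((Manifold.pathELength_add ht.1 ht.2).trans_lt hlen)
  rw [← ENNReal.ofReal_add dist_nonneg dist_nonneg] at e3
  exact (ENNReal.ofReal_lt_ofReal_iff (by positivity)).1 e3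

/-- **Hopf–Rinow**: in a complete Riemannian manifold, closed bounded sets are compact. -/
theorem properSpace_of_completeSpace (n : ℕ) (M : Type*) [MetricSpace M] [ChartedSpace (Euc n) M]
    [RiemannianBundle (fun x : M => TangentSpace (𝓡 n) x)] [IsManifold (𝓡 n) ∞ M]
    [IsContMDiffRiemannianBundle (𝓡 n) ∞ (Euc n) (fun x : M => TangentSpace (𝓡 n) x)]
    [IsRiemannianManifold (𝓡 n) M] [CompleteSpace M] : ProperSpace M := by
  have : LocallyCompactSpace M := ChartedSpace.locallyCompactSpace (Euc n) M
  exact properSpace_of_exists_dist_add_lt (exists_dist_add_lt n)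

end HopfRinow

/-! ### H¹₀ functions and integration by parts without boundary terms. -/

section Sobolev

/-- Hölder's inequality bounds the L¹ distance of `F m` and `G` by ‖a m‖₂‖b‖₂. This is the passage
to the limit from compactly supported functions to H¹₀. -/
lemma tendsto_integral_of_abs_sub_le_mul {X : Type*} [MeasurableSpace X] {μ : Measure X}
    {F : ℕ → X → ℝ} {G : X → ℝ} {a : ℕ → X → ℝ} {b : X → ℝ} (hF : ∀ m, Integrable (F m) μ)
    (hG : Integrable G μ) (ha : ∀ m, AEStronglyMeasurable (a m) μ) (hb : MemLp b 2 μ)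
    (hlim : Tendsto (fun m => eLpNorm (a m) 2 μ) atTop (𝓝 0))
    (hle : ∀ m, ∀ᵐ x ∂μ, |F m x - G x| ≤ |a m x| * |b x|) :
    Tendsto (fun m => ∫ x, F m x ∂μ) atTop (𝓝 (∫ x, G x ∂μ)) := by
  refine tendsto_integral_of_L1' G hG.1 (Eventually.of_forall hF) ?_
  have hlim' : Tendsto (fun m => eLpNorm (a m) 2 μ * eLpNorm b 2 μ) atTop (𝓝 0) := by
    have := ENNReal.Tendsto.mul_const hlim (Or.inr hb.eLpNorm_ne_top)
    rwa [zero_mul] at this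
  refine tendsto_of_tendsto_of_tendsto_of_le_of_le tendsto_const_nhds hlim'
    (fun m => zero_le) fun m => ?_
  calc eLpNorm (F m - G) 1 μ ≤ eLpNorm (a m • b) 1 μ := by
        refine eLpNorm_mono_ae ?_
        filter_upwards [hle m] with x hx
        simpa [abs_mul] using hx
    _ ≤ eLpNorm (a m) 2 μ * eLpNorm b 2 μ := eLpNorm_smul_le_mul_eLpNorm hb.1 (ha m)

variable {n : ℕ} {M : Type*} [MetricSpace M] [ChartedSpace (Euc n) M]
  [RiemannianBundle (fun x : M => TangentSpace (𝓡 n) x)] [MeasurableSpace M]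

variable (n) in
/-- Functions of class `C¹` in `Ω` which are limits in `H¹(Ω)` of `C¹` functions with compact support
in `Ω`. -/
structure IsH10 (Ω : Set M) (w : M → ℝ) : Prop where
  contMDiffOn : ContMDiffOn (𝓡 n) 𝓘(ℝ, ℝ) 1 w Ω
  approx : ∃ φ : ℕ → M → ℝ, (∀ m, ContMDiff (𝓡 n) 𝓘(ℝ, ℝ) 1 (φ m)) ∧
    (∀ m, HasCompactSupport (φ m)) ∧ (∀ m, tsupport (φ m) ⊆ Ω) ∧
    Tendsto (fun m => eLpNorm (fun x => w x - φ m x) 2 ((riemVolume n M).restrict Ω)) atTop (𝓝 0) ∧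
    Tendsto (fun m => eLpNorm (fun x => ‖grad n w x - grad n (φ m) x‖) 2
      ((riemVolume n M).restrict Ω)) atTop (𝓝 0)

variable (n) in
/-- Functions of class `C²` in `Ω` which are bounded, with bounded gradient and Laplacian. -/
structure IsBoundedC2 (Ω : Set M) (g : M → ℝ) : Prop where
  contMDiffOn : ContMDiffOn (𝓡 n) 𝓘(ℝ, ℝ) 2 g Ω
  bound : ∃ C : ℝ, ∀ x ∈ Ω, |g x| ≤ C ∧ ‖grad n g x‖ ≤ C ∧ |lap n g x| ≤ C

lemma contMDiff_mul_of_tsupport_subset {Ω : Set M} (hΩ : IsOpen Ω) {k : WithTop ℕ∞} {f φ : M → ℝ}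
    (hf : ContMDiffOn (𝓡 n) 𝓘(ℝ, ℝ) k f Ω) (hφ : ContMDiff (𝓡 n) 𝓘(ℝ, ℝ) k φ)
    (hs : tsupport φ ⊆ Ω) : ContMDiff (𝓡 n) 𝓘(ℝ, ℝ) k (fun x => f x * φ x) :=
  contMDiff_of_tsupport fun x hx =>
    (hf.contMDiffAt (hΩ.mem_nhds (hs (tsupport_mul_subset_right hx)))).mul (hφ x)

lemma tendsto_eLpNorm_two_zero {X : Type*} [MeasurableSpace X] {μ : Measure X} {f : ℕ → X → ℝ}
    {g : ℕ → X → ℝ≥0∞} (hfg : ∀ m x, ‖f m x‖ₑ ^ 2 ≤ g m x)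
    (hg : Tendsto (fun m => ∫⁻ x, g m x ∂μ) atTop (𝓝 0)) :
    Tendsto (fun m => eLpNorm (f m) 2 μ) atTop (𝓝 0) := by
  have h1 : Tendsto (fun m => (∫⁻ x, g m x ∂μ) ^ (1 / 2 : ℝ)) atTop (𝓝 0) := by
    have := (ENNReal.continuous_rpow_const (y := (1 / 2 : ℝ))).tendsto 0 |>.comp hg
    rwa [ENNReal.zero_rpow_of_pos (by norm_num)] at this
  refine tendsto_of_tendsto_of_tendsto_of_le_of_le tendsto_const_nhds h1 (fun m => zero_le)
    fun m => ?_
  rw [eLpNorm_eq_lintegral_rpow_enorm_toReal two_ne_zero ENNReal.ofNat_ne_top]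
  simp only [ENNReal.toReal_ofNat]
  refine ENNReal.rpow_le_rpow (lintegral_mono fun x => ?_) (by norm_num)
  rw [show ‖f m x‖ₑ ^ (2 : ℝ) = ‖f m x‖ₑ ^ 2 by exact_mod_cast ENNReal.rpow_natCast _ 2]
  exact hfg m x

lemma VanishesOnBoundary.isH10 {Ω : Set M} {u : M → ℝ}
    (hu : ContMDiffOn (𝓡 n) 𝓘(ℝ, ℝ) 1 u Ω) (h : VanishesOnBoundary n Ω u) : IsH10 n Ω u := by
  obtain ⟨φ, hφ, hlim⟩ := h
  refine ⟨hu, φ, fun m => (hφ m).smooth.of_le (by simp), fun m => (hφ m).compact,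
    fun m => (hφ m).subset, ?_, ?_⟩
  · exact tendsto_eLpNorm_two_zero (fun m x => le_self_add) hlim
  · refine tendsto_eLpNorm_two_zero (fun m x => ?_) hlim
    rw [enorm_norm]
    exact le_add_self

variable [BorelSpace M] [IsManifold (𝓡 n) ∞ M]
  [IsContMDiffRiemannianBundle (𝓡 n) ∞ (Euc n) (fun x : M => TangentSpace (𝓡 n) x)]

lemma continuousOn_norm_grad_sub {Ω : Set M} (hΩ : IsOpen Ω) {f h : M → ℝ}
    (hf : ContMDiffOn (𝓡 n) 𝓘(ℝ, ℝ) 1 f Ω) (hh : ContMDiffOn (𝓡 n) 𝓘(ℝ, ℝ) 1 h Ω) :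
    ContinuousOn (fun x => ‖grad n f x - grad n h x‖) Ω := by
  refine (continuousOn_norm_grad hΩ (f := fun x => f x - h x) (hf.sub hh)).congr fun x hx => ?_
  simp only
  rw [grad_sub (mdifferentiableAt_of_contMDiffOn hΩ one_ne_zero hf hx)
    (mdifferentiableAt_of_contMDiffOn hΩ one_ne_zero hh hx)]

lemma memLp_of_hasCompactSupport {Ω : Set M} {φ : M → ℝ} {K : Set M} (hK : IsCompact K)
    (hφ : Continuous φ) (h0 : ∀ x ∉ K, φ x = 0) :
    MemLp φ 2 ((riemVolume n M).restrict Ω) := by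
  have h : MemLp φ 2 (riemVolume n M) := by
    rw [memLp_two_iff_integrable_sq
      (hφ.aestronglyMeasurable)]
    exact integrable_of_continuousOn_of_forall_notMem hK (hφ.pow 2).continuousOn fun x hx => by
      simp [h0 x hx]
  exact h.restrict Ω

section H10

variable {Ω : Set M} (hΩ : IsOpen Ω)

include hΩ

lemma IsH10.memLp {w : M → ℝ} (hw : IsH10 n Ω w) : MemLp w 2 ((riemVolume n M).restrict Ω) := by
  obtain ⟨φ, h1, hc, hs, hlim, -⟩ := hw.approx
  obtain ⟨m, hm⟩ := (hlim.eventually (gt_mem_nhds ENNReal.zero_lt_top)).exists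
  have e1 : MemLp (fun x => w x - φ m x) 2 ((riemVolume n M).restrict Ω) :=
    ⟨(hw.contMDiffOn.continuousOn.sub (h1 m).continuous.continuousOn).aestronglyMeasurable
      hΩ.measurableSet, hm⟩
  have e2 : MemLp (φ m) 2 ((riemVolume n M).restrict Ω) :=
    memLp_of_hasCompactSupport (hc m) (h1 m).continuous
      fun x hx => image_eq_zero_of_notMem_tsupport hx
  refine (e1.add e2).ae_eq (Eventually.of_forall fun x => ?_)
  simp

lemma IsH10.memLp_grad {w : M → ℝ} (hw : IsH10 n Ω w) :
    MemLp (fun x => ‖grad n w x‖) 2 ((riemVolume n M).restrict Ω) := by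
  obtain ⟨φ, h1, hc, hs, -, hlim⟩ := hw.approx
  obtain ⟨m, hm⟩ := (hlim.eventually (gt_mem_nhds ENNReal.zero_lt_top)).exists
  have e1 : MemLp (fun x => ‖grad n w x - grad n (φ m) x‖) 2 ((riemVolume n M).restrict Ω) :=
    ⟨(continuousOn_norm_grad_sub hΩ hw.contMDiffOn (h1 m).contMDiffOn).aestronglyMeasurable
      hΩ.measurableSet, hm⟩
  have e2 : MemLp (fun x => ‖grad n (φ m) x‖) 2 ((riemVolume n M).restrict Ω) :=
    memLp_of_hasCompactSupport (hc m)
      (continuousOn_univ.1 (continuousOn_norm_grad isOpen_univ (h1 m).contMDiffOn))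
      fun x hx => by rw [grad_eq_zero_of_notMem_tsupport hx, norm_zero]
  refine (e1.add e2).of_le ((continuousOn_norm_grad hΩ hw.contMDiffOn).aestronglyMeasurable
    hΩ.measurableSet) (Eventually.of_forall fun x => ?_)
  simp only [Pi.add_apply, norm_norm]
  rw [Real.norm_of_nonneg (by positivity)]
  exact norm_le_norm_sub_add _ _

/-- The approximations of `w` are multiplied by `g`. The gradient error is (w − φ)∇g + g∇(w − φ),
which is controlled because g and ∇g are bounded. -/
lemma IsH10.mul {g w : M → ℝ} (hg : IsBoundedC2 n Ω g) (hw : IsH10 n Ω w) :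
    IsH10 n Ω (fun x => g x * w x) := by
  obtain ⟨φ, h1, hc, hs, hlim0, hlim1⟩ := hw.approx
  obtain ⟨C, hC⟩ := hg.bound
  have hg1 : ContMDiffOn (𝓡 n) 𝓘(ℝ, ℝ) 1 g Ω := hg.contMDiffOn.of_le (by norm_num)
  refine ⟨hg1.mul hw.contMDiffOn, fun m x => g x * φ m x,
    fun m => contMDiff_mul_of_tsupport_subset hΩ hg1 (h1 m) (hs m), fun m => (hc m).mul_left,
    fun m => tsupport_mul_subset_right.trans (hs m), ?_, ?_⟩
  · have hlim : Tendsto (fun m => ENNReal.ofReal C *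
        eLpNorm (fun x => w x - φ m x) 2 ((riemVolume n M).restrict Ω)) atTop (𝓝 0) := by
      have := ENNReal.Tendsto.const_mul (a := ENNReal.ofReal C) hlim0
        (Or.inr ENNReal.ofReal_ne_top)
      rwa [mul_zero] at this
    refine tendsto_of_tendsto_of_tendsto_of_le_of_le tendsto_const_nhds hlim (fun m => zero_le)
      fun m => ?_
    refine eLpNorm_le_mul_eLpNorm_of_ae_le_mul
      (ae_restrict_of_forall_mem hΩ.measurableSet fun x hx => ?_) 2
    rw [← mul_sub, norm_mul]
    exact mul_le_mul_of_nonneg_right (hC x hx).1 (norm_nonneg _)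
  · have hlim : Tendsto (fun m => ENNReal.ofReal C *
        (eLpNorm (fun x => w x - φ m x) 2 ((riemVolume n M).restrict Ω) +
          eLpNorm (fun x => ‖grad n w x - grad n (φ m) x‖) 2 ((riemVolume n M).restrict Ω)))
        atTop (𝓝 0) := by
      have := ENNReal.Tendsto.const_mul (a := ENNReal.ofReal C) (hlim0.add hlim1)
        (Or.inr ENNReal.ofReal_ne_top)
      rwa [add_zero, mul_zero] at this
    refine tendsto_of_tendsto_of_tendsto_of_le_of_le tendsto_const_nhds hlim (fun m => zero_le)
      fun m => ?_
    have hm1 : AEStronglyMeasurable (fun x => |w x - φ m x|) ((riemVolume n M).restrict Ω) :=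
      ((hw.contMDiffOn.continuousOn.sub (h1 m).continuous.continuousOn).abs).aestronglyMeasurable
        hΩ.measurableSet
    have hm2 : AEStronglyMeasurable (fun x => ‖grad n w x - grad n (φ m) x‖)
        ((riemVolume n M).restrict Ω) :=
      (continuousOn_norm_grad_sub hΩ hw.contMDiffOn (h1 m).contMDiffOn).aestronglyMeasurable
        hΩ.measurableSet
    have habs : eLpNorm (fun x => w x - φ m x) 2 ((riemVolume n M).restrict Ω) =
        eLpNorm (fun x => |w x - φ m x|) 2 ((riemVolume n M).restrict Ω) :=
      eLpNorm_congr_norm_ae (Eventually.of_forall fun x => by simp)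
    rw [habs]
    refine le_trans ?_ (mul_le_mul_right (eLpNorm_add_le hm1 hm2 one_le_two) _)
    refine eLpNorm_le_mul_eLpNorm_of_ae_le_mul
      (ae_restrict_of_forall_mem hΩ.measurableSet fun x hx => ?_) 2
    have dg := mdifferentiableAt_of_contMDiffOn hΩ one_ne_zero hg1 hx
    have dw := mdifferentiableAt_of_contMDiffOn hΩ one_ne_zero hw.contMDiffOn hx
    have dφ := (h1 m).mdifferentiableAt one_ne_zero (x := x)
    simp only [Pi.add_apply, norm_norm]
    rw [grad_mul dg dw, grad_mul dg dφ, Real.norm_of_nonneg (by positivity),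
      show g x • grad n w x + w x • grad n g x - (g x • grad n (φ m) x + φ m x • grad n g x) =
        (w x - φ m x) • grad n g x + g x • (grad n w x - grad n (φ m) x) by module]
    refine (norm_add_le _ _).trans ?_
    rw [norm_smul, norm_smul, Real.norm_eq_abs, Real.norm_eq_abs]
    have k1 := mul_le_mul_of_nonneg_left (hC x hx).2.1 (abs_nonneg (w x - φ m x))
    have k2 := mul_le_mul_of_nonneg_right (hC x hx).1 (norm_nonneg (grad n w x - grad n (φ m) x))
    linarith

lemma continuousOn_lap {f : M → ℝ} (hf : ContMDiffOn (𝓡 n) 𝓘(ℝ, ℝ) 2 f Ω) :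
    ContinuousOn (lap n f) Ω :=
  (contMDiffOn_lap hΩ (k := 0) ENat.LEInfty.out (by norm_num) hf).continuousOn

/-- `2 ∇g · ∇u + u Δg` is square integrable. -/
lemma IsBoundedC2.memLp_commutator {g u : M → ℝ} (hg : IsBoundedC2 n Ω g) (hu : IsH10 n Ω u) :
    MemLp (fun x => 2 * inner ℝ (grad n g x) (grad n u x) + u x * lap n g x) 2
      ((riemVolume n M).restrict Ω) := by
  obtain ⟨C, hC⟩ := hg.bound
  have c1 : ContinuousOn (fun x => 2 * inner ℝ (grad n g x) (grad n u x)) Ω :=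
    continuousOn_const.mul
      (continuousOn_inner_grad hΩ (hg.contMDiffOn.of_le (by norm_num)) hu.contMDiffOn)
  have c2 : ContinuousOn (fun x => u x * lap n g x) Ω :=
    hu.contMDiffOn.continuousOn.mul (continuousOn_lap hΩ hg.contMDiffOn)
  refine MemLp.add ?_ ?_
  · refine (hu.memLp_grad hΩ).of_le_mul (c := 2 * C) (c1.aestronglyMeasurable hΩ.measurableSet)
      (ae_restrict_of_forall_mem hΩ.measurableSet fun x hx => ?_)
    rw [norm_mul, norm_norm, mul_assoc, Real.norm_ofNat]
    refine mul_le_mul_of_nonneg_left ((norm_inner_le_norm _ _).trans ?_) zero_le_two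
    exact mul_le_mul_of_nonneg_right (hC x hx).2.1 (norm_nonneg _)
  · refine (hu.memLp hΩ).of_le_mul (c := C) (c2.aestronglyMeasurable hΩ.measurableSet)
      (ae_restrict_of_forall_mem hΩ.measurableSet fun x hx => ?_)
    rw [norm_mul, mul_comm]
    exact mul_le_mul_of_nonneg_right (hC x hx).2.2 (norm_nonneg _)

lemma memLp_norm_grad_mul {g u : M → ℝ} (hg : IsBoundedC2 n Ω g) (hu : IsH10 n Ω u) :
    MemLp (fun x => ‖grad n g x‖ * u x) 2 ((riemVolume n M).restrict Ω) := by
  obtain ⟨C, hC⟩ := hg.bound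
  refine (hu.memLp hΩ).of_le_mul (c := C)
    (((continuousOn_norm_grad hΩ (hg.contMDiffOn.of_le (by norm_num))).mul
      hu.contMDiffOn.continuousOn).aestronglyMeasurable hΩ.measurableSet)
    (ae_restrict_of_forall_mem hΩ.measurableSet fun x hx => ?_)
  rw [norm_mul, norm_norm]
  exact mul_le_mul_of_nonneg_right (hC x hx).2.1 (norm_nonneg _)

lemma memLp_inner_grad {g u : M → ℝ} (hg : IsBoundedC2 n Ω g) (hu : IsH10 n Ω u) :
    MemLp (fun x => inner ℝ (grad n g x) (grad n u x)) 2 ((riemVolume n M).restrict Ω) := by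
  obtain ⟨C, hC⟩ := hg.bound
  refine (hu.memLp_grad hΩ).of_le_mul (c := C)
    ((continuousOn_inner_grad hΩ (hg.contMDiffOn.of_le (by norm_num))
      hu.contMDiffOn).aestronglyMeasurable hΩ.measurableSet)
    (ae_restrict_of_forall_mem hΩ.measurableSet fun x hx => ?_)
  rw [norm_norm]
  exact (norm_inner_le_norm _ _).trans (mul_le_mul_of_nonneg_right (hC x hx).2.1 (norm_nonneg _))

lemma integrable_inner_grad {u w : M → ℝ} (hu : IsH10 n Ω u) (hw : IsH10 n Ω w) :
    Integrable (fun x => inner ℝ (grad n u x) (grad n w x)) ((riemVolume n M).restrict Ω) := by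
  refine ((hu.memLp_grad hΩ).integrable_mul (hw.memLp_grad hΩ)).mono'
    ((continuousOn_inner_grad hΩ hu.contMDiffOn hw.contMDiffOn).aestronglyMeasurable
      hΩ.measurableSet) (Eventually.of_forall fun x => norm_inner_le_norm _ _)

lemma isH10_of_hasCompactSupport {φ : M → ℝ} (hφ : ContMDiff (𝓡 n) 𝓘(ℝ, ℝ) 1 φ)
    (hc : HasCompactSupport φ) (hs : tsupport φ ⊆ Ω) : IsH10 n Ω φ :=
  ⟨hφ.contMDiffOn, fun _ => φ, fun _ => hφ, fun _ => hc, fun _ => hs, by simp, by simp⟩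

/-- An identity of bilinear expressions in `w` and `∇w` extends from test functions to `H¹₀`. -/
lemma IsH10.tendsto_integral {w : M → ℝ} (hw : IsH10 n Ω w) :
    ∃ φ : ℕ → M → ℝ, (∀ m, ContMDiff (𝓡 n) 𝓘(ℝ, ℝ) 1 (φ m)) ∧
      (∀ m, HasCompactSupport (φ m)) ∧ (∀ m, tsupport (φ m) ⊆ Ω) ∧
      (∀ b : M → ℝ, MemLp b 2 ((riemVolume n M).restrict Ω) →
        Tendsto (fun m => ∫ x in Ω, b x * φ m x ∂(riemVolume n M)) atTop
          (𝓝 (∫ x in Ω, b x * w x ∂(riemVolume n M)))) ∧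
      (∀ (b v : M → ℝ), ContinuousOn b Ω → ContMDiffOn (𝓡 n) 𝓘(ℝ, ℝ) 1 v Ω →
        MemLp (fun x => b x * ‖grad n v x‖) 2 ((riemVolume n M).restrict Ω) →
        Tendsto (fun m => ∫ x in Ω, b x * inner ℝ (grad n v x) (grad n (φ m) x) ∂(riemVolume n M))
          atTop (𝓝 (∫ x in Ω, b x * inner ℝ (grad n v x) (grad n w x) ∂(riemVolume n M)))) := by
  obtain ⟨φ, h1, hc, hs, hlim0, hlim1⟩ := hw.approx
  refine ⟨φ, h1, hc, hs, fun b hb => ?_, fun b v hbc hv hb => ?_⟩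
  · have hφ := fun m => (isH10_of_hasCompactSupport hΩ (h1 m) (hc m) (hs m)).memLp hΩ
    refine tendsto_integral_of_abs_sub_le_mul (fun m => hb.integrable_mul (hφ m))
      (hb.integrable_mul (hw.memLp hΩ)) (fun m => ((hw.memLp hΩ).sub (hφ m)).1) hb hlim0
      fun m => Eventually.of_forall fun x => ?_
    rw [← mul_sub, abs_mul, mul_comm, Pi.sub_apply, abs_sub_comm]
  · have hint : ∀ z : M → ℝ, IsH10 n Ω z →
        Integrable (fun x => b x * inner ℝ (grad n v x) (grad n z x))
          ((riemVolume n M).restrict Ω) := fun z hz => by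
      refine (hb.integrable_mul (hz.memLp_grad hΩ)).mono
        ((hbc.mul (continuousOn_inner_grad hΩ hv hz.contMDiffOn)).aestronglyMeasurable
          hΩ.measurableSet) (Eventually.of_forall fun x => ?_)
      simp only [norm_mul, norm_norm, Pi.mul_apply, mul_assoc]
      exact mul_le_mul_of_nonneg_left (norm_inner_le_norm _ _) (norm_nonneg _)
    refine tendsto_integral_of_abs_sub_le_mul
      (fun m => hint _ (isH10_of_hasCompactSupport hΩ (h1 m) (hc m) (hs m))) (hint w hw)
      (fun m => (continuousOn_norm_grad_sub hΩ hw.contMDiffOn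
        (h1 m).contMDiffOn).aestronglyMeasurable hΩ.measurableSet) hb hlim1
      fun m => Eventually.of_forall fun x => ?_
    rw [← mul_sub, ← inner_sub_right, abs_mul, abs_mul, abs_norm, abs_norm, norm_sub_rev]
    refine (mul_le_mul_of_nonneg_left (abs_real_inner_le_norm _ _) (abs_nonneg _)).trans_eq ?_
    ring

variable [SigmaCompactSpace M]

/-- `∫ (2 ∇g · ∇u + u Δg) w = ∫ w ∇g · ∇u - ∫ u ∇g · ∇w`. -/
theorem integral_commutator_mul {g u w : M → ℝ} (hg : IsBoundedC2 n Ω g) (hu : IsH10 n Ω u)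
    (hw : IsH10 n Ω w) :
    ∫ x in Ω, (2 * inner ℝ (grad n g x) (grad n u x) + u x * lap n g x) * w x ∂(riemVolume n M) =
      (∫ x in Ω, inner ℝ (grad n g x) (grad n u x) * w x ∂(riemVolume n M)) -
        ∫ x in Ω, u x * inner ℝ (grad n g x) (grad n w x) ∂(riemVolume n M) := by
  obtain ⟨φ, h1, hc, hs, hl0, hl1⟩ := hw.tendsto_integral hΩ
  have hg1 : ContMDiffOn (𝓡 n) 𝓘(ℝ, ℝ) 1 g Ω := hg.contMDiffOn.of_le (by norm_num)
  have hug : MemLp (fun x => u x * ‖grad n g x‖) 2 ((riemVolume n M).restrict Ω) := by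
    simpa only [mul_comm] using memLp_norm_grad_mul hΩ hg hu
  have l1 := hl0 _ (hg.memLp_commutator hΩ hu)
  have l2 := hl0 _ (memLp_inner_grad hΩ hg hu)
  have l3 := hl1 u g hu.contMDiffOn.continuousOn hg1 hug
  -- With `w` replaced by a compactly supported `φ m`, the identity is Green's formula for `g`
  -- tested against u φₘ; only first derivatives of `u` enter.
  refine tendsto_nhds_unique l1 ((l2.sub l3).congr fun m => ?_)
  have hψ := contMDiff_mul_of_tsupport_subset hΩ hu.contMDiffOn (h1 m) (hs m)
  have hψc : HasCompactSupport (fun x => u x * φ m x) := (hc m).mul_left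
  have hψs : tsupport (fun x => u x * φ m x) ⊆ Ω := tsupport_mul_subset_right.trans (hs m)
  have hφ := isH10_of_hasCompactSupport hΩ (h1 m) (hc m) (hs m)
  have green := integral_mul_lap hΩ hg.contMDiffOn hψ hψc hψs
  have i1 : Integrable (fun x => inner ℝ (grad n g x) (grad n u x) * φ m x)
      ((riemVolume n M).restrict Ω) := (memLp_inner_grad hΩ hg hu).integrable_mul (hφ.memLp hΩ)
  have i2 : Integrable (fun x => u x * inner ℝ (grad n g x) (grad n (φ m) x))
      ((riemVolume n M).restrict Ω) := by
    refine (hug.integrable_mul (hφ.memLp_grad hΩ)).mono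
      ((hu.contMDiffOn.continuousOn.mul (continuousOn_inner_grad hΩ hg1
        (h1 m).contMDiffOn)).aestronglyMeasurable hΩ.measurableSet)
      (Eventually.of_forall fun x => ?_)
    simp only [norm_mul, norm_norm, Pi.mul_apply, mul_assoc]
    exact mul_le_mul_of_nonneg_left (norm_inner_le_norm _ _) (norm_nonneg _)
  have i3 : Integrable (fun x => (2 * inner ℝ (grad n g x) (grad n u x) + u x * lap n g x) * φ m x)
      ((riemVolume n M).restrict Ω) := (hg.memLp_commutator hΩ hu).integrable_mul (hφ.memLp hΩ)
  have e1 : ∫ x in Ω, u x * φ m x * lap n g x ∂(riemVolume n M) =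
      (∫ x in Ω, (2 * inner ℝ (grad n g x) (grad n u x) + u x * lap n g x) * φ m x
        ∂(riemVolume n M)) -
      2 * ∫ x in Ω, inner ℝ (grad n g x) (grad n u x) * φ m x ∂(riemVolume n M) := by
    rw [← integral_const_mul, ← integral_sub i3 (i1.const_mul 2)]
    exact integral_congr_ae (Eventually.of_forall fun x => by ring)
  have e2 : ∫ x in Ω, inner ℝ (grad n (fun x => u x * φ m x) x) (grad n g x) ∂(riemVolume n M) =
      (∫ x in Ω, u x * inner ℝ (grad n g x) (grad n (φ m) x) ∂(riemVolume n M)) +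
      ∫ x in Ω, inner ℝ (grad n g x) (grad n u x) * φ m x ∂(riemVolume n M) := by
    rw [← integral_add i2 i1]
    refine setIntegral_congr_fun hΩ.measurableSet fun x hx => ?_
    rw [grad_mul (mdifferentiableAt_of_contMDiffOn hΩ one_ne_zero hu.contMDiffOn hx)
      ((h1 m).mdifferentiableAt one_ne_zero), inner_add_left, real_inner_smul_left,
      real_inner_smul_left, real_inner_comm (grad n (φ m) x), real_inner_comm (grad n u x)]
    ring
  rw [e1, e2] at green
  linarith

/-- The weak form of the equation `Δu = -lam u`. -/
theorem IsDirichletSolution.integral_inner_grad {u w : M → ℝ} {lam : ℝ}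
    (hu : IsDirichletSolution n Ω lam u) (hw : IsH10 n Ω w) :
    ∫ x in Ω, inner ℝ (grad n u x) (grad n w x) ∂(riemVolume n M) =
      lam * ∫ x in Ω, u x * w x ∂(riemVolume n M) := by
  have hu0 : IsH10 n Ω u := hu.boundary.isH10 (hu.contMDiffOn.of_le (by norm_num))
  obtain ⟨φ, h1, hc, hs, hl0, hl1⟩ := hw.tendsto_integral hΩ
  have l1 := hl0 _ (hu0.memLp hΩ)
  have l2 := hl1 (fun _ => 1) u continuousOn_const hu0.contMDiffOn
    (by simpa only [one_mul] using hu0.memLp_grad hΩ)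
  simp only [one_mul] at l2
  refine tendsto_nhds_unique l2 ((l1.const_mul lam).congr fun m => ?_)
  have green := integral_mul_lap hΩ hu.contMDiffOn (h1 m) (hc m) (hs m)
  have e1 : ∫ x in Ω, φ m x * lap n u x ∂(riemVolume n M) =
      -(lam * ∫ x in Ω, u x * φ m x ∂(riemVolume n M)) := by
    rw [← integral_const_mul, ← integral_neg]
    refine setIntegral_congr_fun hΩ.measurableSet fun x hx => ?_
    simp only [hu.equation x hx]
    ring
  rw [e1, neg_inj] at green
  rw [green]
  exact integral_congr_ae (Eventually.of_forall fun x => real_inner_comm _ _)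

end H10

end Sobolev

/-! ### The commutator inequality in the basis of eigenfunctions. -/

section Spectral

/-- By Parseval, right side minus left side is a sum over `j`. Since (c − λ)² + ((α − c) + (β −
c))(c − λ) + (α − c)(β − c) = (λ − α)(λ − β), each term is the product in `hgap` times the square of
a coefficient of `x`. -/
lemma mul_neg_inner_le_of_hilbertBasis {ι H : Type*} [NormedAddCommGroup H] [InnerProductSpace ℝ H]
    (b : HilbertBasis ι ℝ H) {lam : ι → ℝ} {c α β : ℝ} {x y : H}
    (hxy : ∀ j, inner ℝ (b j) y = (c - lam j) * inner ℝ (b j) x)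
    (hgap : ∀ j, 0 ≤ (lam j - α) * (lam j - β)) :
    ((α - c) + (β - c)) * -inner ℝ x y ≤ ‖y‖ ^ 2 + (α - c) * (β - c) * ‖x‖ ^ 2 := by
  have h1 := b.hasSum_inner_mul_inner y y
  have h2 := (b.hasSum_inner_mul_inner x y).mul_left ((α - c) + (β - c))
  have h3 := (b.hasSum_inner_mul_inner x x).mul_left ((α - c) * (β - c))
  have h := ((h1.add h2).add h3).nonneg fun j => by
    rw [real_inner_comm (b j) y, real_inner_comm (b j) x, hxy]
    have := mul_nonneg (hgap j) (sq_nonneg (inner ℝ (b j) x))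
    nlinarith [this]
  rw [real_inner_self_eq_norm_sq, real_inner_self_eq_norm_sq] at h
  linarith

/-- Every index is at most k + 1 or at least k + 2, so no eigenvalue lies strictly between the two;
hence the need for consecutive eigenvalues. -/
lemma Monotone.gap_mul_nonneg {lam : ℕ+ → ℝ} (h : Monotone lam) (j k : ℕ+) :
    0 ≤ (lam j - lam (k + 1)) * (lam j - lam (k + 2)) := by
  rcases le_or_gt j (k + 1) with hj | hj
  · have h1 := h hj
    have h2 : lam (k + 1) ≤ lam (k + 2) := h (by
      rw [← PNat.coe_le_coe]; simp [PNat.add_coe])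
    exact mul_nonneg_of_nonpos_of_nonpos (by linarith) (by linarith)
  · have h2 : k + 2 ≤ j := by
      rw [← PNat.coe_lt_coe] at hj
      rw [← PNat.coe_le_coe]
      simp only [PNat.add_coe, PNat.one_coe] at hj ⊢
      exact hj
    have h1 := h h2
    have h3 := h hj.le
    exact mul_nonneg (by linarith) (by linarith)

lemma inner_eq_integral_of_ae_eq {X : Type*} [MeasurableSpace X] {μ : Measure X}
    {F G : Lp ℝ 2 μ} {f g : X → ℝ} (hF : F =ᵐ[μ] f) (hG : G =ᵐ[μ] g) :
    inner ℝ F G = ∫ x, f x * g x ∂μ := by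
  rw [L2.inner_def]
  refine integral_congr_ae ?_
  filter_upwards [hF, hG] with x hf hg
  rw [hf, hg]
  exact mul_comm _ _

/-- Unless the claim is trivial, SX − D > 0. Then Y t² − (SX − D) t + P is nonnegative for all real
t: for t ≥ 0 by the hypothesis with s = √t, and for t < 0 because no term is negative. Its
discriminant is therefore at most 0. -/
lemma add_mul_le_two_sqrt_add {S X D Y P : ℝ} (hY : 0 ≤ Y) (hP : 0 ≤ P)
    (h : ∀ s : ℝ, S * (s ^ 2 * X) ≤ s ^ 2 * D + s ^ 4 * Y + P) :
    S * X ≤ 2 * Real.sqrt (P * Y) + D := by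
  by_cases hK : S * X - D ≤ 0
  · have := Real.sqrt_nonneg (P * Y)
    linarith
  push Not at hK
  have h0 : ∀ t : ℝ, 0 ≤ Y * (t * t) + (-(S * X - D)) * t + P := by
    intro t
    rcases le_or_gt 0 t with ht | ht
    · have := h (Real.sqrt t)
      rw [show Real.sqrt t ^ 4 = (Real.sqrt t ^ 2) ^ 2 by ring, Real.sq_sqrt ht] at this
      nlinarith
    · have := mul_nonneg hY (mul_self_nonneg t)
      nlinarith
  have hd := discrim_le_zero h0
  rw [discrim] at hd
  have : S * X - D ≤ Real.sqrt (2 ^ 2 * (P * Y)) := Real.le_sqrt_of_sq_le (by nlinarith)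
  rw [Real.sqrt_mul (by norm_num), Real.sqrt_sq (by norm_num)] at this
  linarith

variable {n : ℕ} {M : Type*} [MetricSpace M] [ChartedSpace (Euc n) M]
  [RiemannianBundle (fun x : M => TangentSpace (𝓡 n) x)] [MeasurableSpace M]
  [BorelSpace M] [IsManifold (𝓡 n) ∞ M]
  [IsContMDiffRiemannianBundle (𝓡 n) ∞ (Euc n) (fun x : M => TangentSpace (𝓡 n) x)]
  [SigmaCompactSpace M]

section Eigensystem

variable {Ω : Set M} (hΩ : IsOpen Ω) {lam : ℕ+ → ℝ} {u : ℕ+ → M → ℝ}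
  (hu : IsDirichletEigensystem n Ω lam u)

include hΩ hu

lemma IsDirichletEigensystem.isH10 (j : ℕ+) : IsH10 n Ω (u j) :=
  (hu.solution j).boundary.isH10 ((hu.solution j).contMDiffOn.of_le (by norm_num))

lemma IsDirichletEigensystem.integral_sq (j : ℕ+) :
    ∫ x in Ω, u j x ^ 2 ∂(riemVolume n M) = 1 := by
  obtain ⟨b, hb⟩ := hu.orthonormal_basis
  have h := inner_eq_integral_of_ae_eq (hb j) (hb j)
  rw [real_inner_self_eq_norm_sq, b.orthonormal.1 j] at h
  simp only [sq]
  rw [← h]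
  norm_num

lemma IsDirichletEigensystem.integral_norm_grad_sq (j : ℕ+) :
    ∫ x in Ω, ‖grad n (u j) x‖ ^ 2 ∂(riemVolume n M) = lam j := by
  have h := (hu.solution j).integral_inner_grad hΩ (hu.isH10 hΩ j)
  simp only [real_inner_self_eq_norm_sq, ← sq] at h
  rw [h, hu.integral_sq hΩ, mul_one]

lemma IsDirichletEigensystem.nonneg (j : ℕ+) : 0 ≤ lam j := by
  rw [← hu.integral_norm_grad_sq hΩ j]
  exact integral_nonneg fun x => sq_nonneg _

/-- The weak equation of `u i` tested against g uⱼ. The first integral is symmetric in `i` and `j`,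
so it drops out when the roles are exchanged and the two identities are subtracted. -/
lemma integral_inner_grad_mul {g : M → ℝ} (hg : IsBoundedC2 n Ω g) (i j : ℕ+) :
    (∫ x in Ω, g x * inner ℝ (grad n (u i) x) (grad n (u j) x) ∂(riemVolume n M)) +
      ∫ x in Ω, inner ℝ (grad n g x) (grad n (u i) x) * u j x ∂(riemVolume n M) =
      lam i * ∫ x in Ω, u i x * (g x * u j x) ∂(riemVolume n M) := by
  obtain ⟨C, hC⟩ := hg.bound
  have hg1 : ContMDiffOn (𝓡 n) 𝓘(ℝ, ℝ) 1 g Ω := hg.contMDiffOn.of_le (by norm_num)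
  have hi := hu.isH10 hΩ i
  have hj := hu.isH10 hΩ j
  rw [← (hu.solution i).integral_inner_grad hΩ (hj.mul hΩ hg), ← integral_add]
  · refine setIntegral_congr_fun hΩ.measurableSet fun x hx => ?_
    rw [grad_mul (mdifferentiableAt_of_contMDiffOn hΩ one_ne_zero hg1 hx)
      (mdifferentiableAt_of_contMDiffOn hΩ one_ne_zero hj.contMDiffOn hx), inner_add_right,
      real_inner_smul_right, real_inner_smul_right, real_inner_comm (grad n (u i) x)]
    ring
  · refine ((integrable_inner_grad hΩ hi hj).norm.const_mul C).mono'
      ((hg1.continuousOn.mul (continuousOn_inner_grad hΩ hi.contMDiffOn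
        hj.contMDiffOn)).aestronglyMeasurable hΩ.measurableSet)
      (ae_restrict_of_forall_mem hΩ.measurableSet fun x hx => ?_)
    rw [norm_mul]
    exact mul_le_mul_of_nonneg_right (hC x hx).1 (norm_nonneg _)
  · exact (memLp_inner_grad hΩ hg hi).integrable_mul (hj.memLp hΩ)

/-- The coefficients of `2 ∇g · ∇uᵢ + uᵢ Δg` in the basis of eigenfunctions. -/
lemma integral_mul_commutator {g : M → ℝ} (hg : IsBoundedC2 n Ω g) (i j : ℕ+) :
    ∫ x in Ω, u j x * (2 * inner ℝ (grad n g x) (grad n (u i) x) + u i x * lap n g x)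
        ∂(riemVolume n M) =
      (lam i - lam j) * ∫ x in Ω, u j x * (g x * u i x) ∂(riemVolume n M) := by
  -- The right side of `h1` is antisymmetric in `i` and `j`, and is exactly the difference of `h2`
  -- and `h3`.
  have h1 := integral_commutator_mul hΩ hg (hu.isH10 hΩ i) (hu.isH10 hΩ j)
  have h2 := integral_inner_grad_mul hΩ hu hg i j
  have h3 := integral_inner_grad_mul hΩ hu hg j i
  have e0 : ∫ x in Ω, u j x * (2 * inner ℝ (grad n g x) (grad n (u i) x) + u i x * lap n g x)
        ∂(riemVolume n M) = ∫ x in Ω,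
        (2 * inner ℝ (grad n g x) (grad n (u i) x) + u i x * lap n g x) * u j x
        ∂(riemVolume n M) := integral_congr_ae (Eventually.of_forall fun x => mul_comm _ _)
  have e1 : ∫ x in Ω, u i x * (g x * u j x) ∂(riemVolume n M) =
      ∫ x in Ω, u j x * (g x * u i x) ∂(riemVolume n M) :=
    integral_congr_ae (Eventually.of_forall fun x => by ring)
  have e2 : ∫ x in Ω, g x * inner ℝ (grad n (u j) x) (grad n (u i) x) ∂(riemVolume n M) =
      ∫ x in Ω, g x * inner ℝ (grad n (u i) x) (grad n (u j) x) ∂(riemVolume n M) :=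
    integral_congr_ae (Eventually.of_forall fun x => by
      simp only [real_inner_comm (grad n (u i) x)])
  have e3 : ∫ x in Ω, inner ℝ (grad n g x) (grad n (u j) x) * u i x ∂(riemVolume n M) =
      ∫ x in Ω, u i x * inner ℝ (grad n g x) (grad n (u j) x) ∂(riemVolume n M) :=
    integral_congr_ae (Eventually.of_forall fun x => mul_comm _ _)
  rw [e1] at h2
  rw [e2, e3] at h3
  rw [e0, h1]
  linarith

/-- Take w = g uᵢ in `integral_commutator_mul`: expanding ∇(g uᵢ), the terms containing ∇uᵢ cancel.
-/
lemma integral_commutator_mul_self {g : M → ℝ} (hg : IsBoundedC2 n Ω g) (i : ℕ+) :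
    ∫ x in Ω, g x * u i x * (2 * inner ℝ (grad n g x) (grad n (u i) x) + u i x * lap n g x)
        ∂(riemVolume n M) = -∫ x in Ω, ‖grad n g x‖ ^ 2 * u i x ^ 2 ∂(riemVolume n M) := by
  have hi := hu.isH10 hΩ i
  have hgi := hi.mul hΩ hg
  have hg1 : ContMDiffOn (𝓡 n) 𝓘(ℝ, ℝ) 1 g Ω := hg.contMDiffOn.of_le (by norm_num)
  have h1 := integral_commutator_mul hΩ hg hi hgi
  have i1 : Integrable (fun x => inner ℝ (grad n g x) (grad n (u i) x) * (g x * u i x))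
      ((riemVolume n M).restrict Ω) := (memLp_inner_grad hΩ hg hi).integrable_mul (hgi.memLp hΩ)
  have i2 : Integrable (fun x => ‖grad n g x‖ ^ 2 * u i x ^ 2) ((riemVolume n M).restrict Ω) := by
    simpa only [mul_pow] using (memLp_norm_grad_mul hΩ hg hi).integrable_sq
  have e1 : ∫ x in Ω, u i x * inner ℝ (grad n g x) (grad n (fun y => g y * u i y) x)
      ∂(riemVolume n M) =
      (∫ x in Ω, inner ℝ (grad n g x) (grad n (u i) x) * (g x * u i x) ∂(riemVolume n M)) +
      ∫ x in Ω, ‖grad n g x‖ ^ 2 * u i x ^ 2 ∂(riemVolume n M) := by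
    rw [← integral_add i1 i2]
    refine setIntegral_congr_fun hΩ.measurableSet fun x hx => ?_
    rw [grad_mul (mdifferentiableAt_of_contMDiffOn hΩ one_ne_zero hg1 hx)
      (mdifferentiableAt_of_contMDiffOn hΩ one_ne_zero hi.contMDiffOn hx), inner_add_right,
      real_inner_smul_right, real_inner_smul_right, real_inner_self_eq_norm_sq]
    ring
  rw [e1] at h1
  have e0 : ∫ x in Ω, g x * u i x * (2 * inner ℝ (grad n g x) (grad n (u i) x) +
      u i x * lap n g x) ∂(riemVolume n M) = ∫ x in Ω,
        (2 * inner ℝ (grad n g x) (grad n (u i) x) + u i x * lap n g x) * (g x * u i x)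
        ∂(riemVolume n M) := integral_congr_ae (Eventually.of_forall fun x => mul_comm _ _)
  rw [e0, h1]
  ring

/-- The eigenvalue inequality for a real function. -/
theorem gap_inequality_real {g : M → ℝ} (hg : IsBoundedC2 n Ω g) (i k : ℕ+) :
    ((lam (k + 1) - lam i) + (lam (k + 2) - lam i)) *
        ∫ x in Ω, ‖grad n g x‖ ^ 2 * u i x ^ 2 ∂(riemVolume n M) ≤
      (∫ x in Ω, (2 * inner ℝ (grad n g x) (grad n (u i) x) + u i x * lap n g x) ^ 2
        ∂(riemVolume n M)) +
      (lam (k + 1) - lam i) * (lam (k + 2) - lam i) *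
        ∫ x in Ω, (g x * u i x) ^ 2 ∂(riemVolume n M) := by
  obtain ⟨b, hb⟩ := hu.orthonormal_basis
  have hi := hu.isH10 hΩ i
  have hG := (hi.mul hΩ hg).memLp hΩ
  have hH := hg.memLp_commutator hΩ hi
  have key := mul_neg_inner_le_of_hilbertBasis b (lam := lam) (c := lam i) (α := lam (k + 1))
    (β := lam (k + 2)) (x := hG.toLp) (y := hH.toLp) (fun j => by
      rw [inner_eq_integral_of_ae_eq (hb j) hH.coeFn_toLp,
        inner_eq_integral_of_ae_eq (hb j) hG.coeFn_toLp]
      exact integral_mul_commutator hΩ hu hg i j) (fun j => Monotone.gap_mul_nonneg hu.monotone j k)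
  rw [← real_inner_self_eq_norm_sq, ← real_inner_self_eq_norm_sq,
    inner_eq_integral_of_ae_eq hG.coeFn_toLp hH.coeFn_toLp,
    inner_eq_integral_of_ae_eq hG.coeFn_toLp hG.coeFn_toLp,
    inner_eq_integral_of_ae_eq hH.coeFn_toLp hH.coeFn_toLp,
    integral_commutator_mul_self hΩ hu hg i, neg_neg] at key
  simpa only [sq] using key

end Eigensystem

end Spectral

/-! ### Exponential test functions and the gap estimates. -/

section GapEstimates

variable {n : ℕ} {M : Type*} [MetricSpace M] [ChartedSpace (Euc n) M]
  [RiemannianBundle (fun x : M => TangentSpace (𝓡 n) x)] [MeasurableSpace M]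
  [BorelSpace M] [IsManifold (𝓡 n) ∞ M]
  [IsContMDiffRiemannianBundle (𝓡 n) ∞ (Euc n) (fun x : M => TangentSpace (𝓡 n) x)]

lemma IsBoundedC2.comp {Ω : Set M} (hΩ : IsOpen Ω) {f : M → ℝ} (hf : IsBoundedC2 n Ω f)
    {θ : ℝ → ℝ} (hθ : ContDiff ℝ 2 θ) {B : ℝ} (h0 : ∀ t, |θ t| ≤ B) (h1 : ∀ t, |deriv θ t| ≤ B)
    (h2 : ∀ t, |deriv (deriv θ) t| ≤ B) : IsBoundedC2 n Ω (fun x => θ (f x)) := by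
  obtain ⟨C, hC⟩ := hf.bound
  have hB : 0 ≤ B := (abs_nonneg _).trans (h0 0)
  refine ⟨hθ.contMDiff.comp_contMDiffOn hf.contMDiffOn, max B (max (B * C) (B * C + B * C ^ 2)),
    fun x hx => ⟨(h0 _).trans (le_max_left _ _), ?_, ?_⟩⟩
  · refine le_trans ?_ ((le_max_left _ _).trans (le_max_right _ _))
    rw [grad_comp (mdifferentiableAt_of_contMDiffOn hΩ two_ne_zero hf.contMDiffOn hx)
      (hθ.differentiable two_ne_zero _), norm_smul]
    exact mul_le_mul (h1 _) (hC x hx).2.1 (norm_nonneg _) hB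
  · refine le_trans ?_ ((le_max_right _ _).trans (le_max_right _ _))
    rw [lap_comp hΩ hθ hf.contMDiffOn hx]
    refine (abs_add_le _ _).trans ?_
    rw [abs_mul, abs_mul]
    refine add_le_add (mul_le_mul (h1 _) (hC x hx).2.2 (abs_nonneg _) hB)
      (mul_le_mul (h2 _) ?_ (abs_nonneg _) hB)
    rw [abs_of_nonneg (sq_nonneg _)]
    exact pow_le_pow_left₀ (norm_nonneg _) (hC x hx).2.1 2

lemma deriv_cos_mul (s : ℝ) :
    deriv (fun t => Real.cos (s * t)) = fun t => -s * Real.sin (s * t) := by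
  funext t
  have := ((Real.hasDerivAt_cos (s * t)).comp t ((hasDerivAt_id t).const_mul s)).deriv
  simp only [mul_one, Function.comp_def] at this
  rw [this]
  ring

lemma deriv_sin_mul (s : ℝ) :
    deriv (fun t => Real.sin (s * t)) = fun t => s * Real.cos (s * t) := by
  funext t
  have := ((Real.hasDerivAt_sin (s * t)).comp t ((hasDerivAt_id t).const_mul s)).deriv
  simp only [mul_one, Function.comp_def] at this
  rw [this]
  ring

lemma deriv_deriv_cos_mul (s t : ℝ) :
    deriv (deriv (fun t => Real.cos (s * t))) t = -s ^ 2 * Real.cos (s * t) := by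
  rw [deriv_cos_mul, deriv_const_mul_field, deriv_sin_mul]
  ring

lemma deriv_deriv_sin_mul (s t : ℝ) :
    deriv (deriv (fun t => Real.sin (s * t))) t = -s ^ 2 * Real.sin (s * t) := by
  rw [deriv_sin_mul, deriv_const_mul_field, deriv_cos_mul]
  ring

variable [SigmaCompactSpace M] {Ω : Set M} (hΩ : IsOpen Ω) {lam : ℕ+ → ℝ} {u : ℕ+ → M → ℝ}
  (hu : IsDirichletEigensystem n Ω lam u)

include hΩ in
lemma integrableOn_norm_grad_pow_mul_sq {f v : M → ℝ} (hf : IsBoundedC2 n Ω f)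
    (hv : IsH10 n Ω v) (m : ℕ) :
    IntegrableOn (fun x => ‖grad n f x‖ ^ m * v x ^ 2) Ω (riemVolume n M) := by
  obtain ⟨C, hC⟩ := hf.bound
  refine ((hv.memLp hΩ).integrable_sq.const_mul (C ^ m)).mono'
    ((((continuousOn_norm_grad hΩ (hf.contMDiffOn.of_le (by norm_num))).pow m).mul
      (hv.contMDiffOn.continuousOn.pow 2)).aestronglyMeasurable hΩ.measurableSet)
    (ae_restrict_of_forall_mem hΩ.measurableSet fun x hx => ?_)
  rw [Real.norm_of_nonneg (by positivity)]
  exact mul_le_mul_of_nonneg_right (pow_le_pow_left₀ (norm_nonneg _) (hC x hx).2.1 m)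
    (sq_nonneg _)

include hΩ hu

/-- For g = exp(√-1 s f) one has |g| = 1, |∇g|² = s²|∇f|² and |2∇g·∇uᵢ + uᵢΔg|² = s²(2∇f·∇uᵢ +
uᵢΔf)² + s⁴|∇f|⁴uᵢ². The cosine and sine are its real and imaginary parts; the cross terms cancel in
the sum. -/
lemma gap_inequality_exp {f : M → ℝ} (hf : IsBoundedC2 n Ω f) (i k : ℕ+) (s : ℝ) :
    ((lam (k + 1) - lam i) + (lam (k + 2) - lam i)) *
        (s ^ 2 * ∫ x in Ω, ‖grad n f x‖ ^ 2 * u i x ^ 2 ∂(riemVolume n M)) ≤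
      s ^ 2 * (∫ x in Ω, (2 * inner ℝ (grad n f x) (grad n (u i) x) + u i x * lap n f x) ^ 2
        ∂(riemVolume n M)) +
      s ^ 4 * (∫ x in Ω, ‖grad n f x‖ ^ 4 * u i x ^ 2 ∂(riemVolume n M)) +
      (lam (k + 1) - lam i) * (lam (k + 2) - lam i) := by
  have hi := hu.isH10 hΩ i
  have hcd : ContDiff ℝ 2 fun t : ℝ => Real.cos (s * t) :=
    Real.contDiff_cos.comp (contDiff_const.mul contDiff_id)
  have hsd : ContDiff ℝ 2 fun t : ℝ => Real.sin (s * t) :=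
    Real.contDiff_sin.comp (contDiff_const.mul contDiff_id)
  -- One constant dominates cos(st), sin(st) and their first two derivatives, whose factors are 1,
  -- ±s and −s².
  have hb : ∀ c : ℝ, |c| ≤ 1 → |c| ≤ 1 + |s| + s ^ 2 ∧ |-s * c| ≤ 1 + |s| + s ^ 2 ∧
      |s * c| ≤ 1 + |s| + s ^ 2 ∧ |-s ^ 2 * c| ≤ 1 + |s| + s ^ 2 := by
    intro c hc
    have h1 := abs_nonneg s
    have h2 := sq_nonneg s
    have h3 := mul_le_mul_of_nonneg_left hc h1
    have h4 := mul_le_mul_of_nonneg_left hc h2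
    simp only [abs_mul, abs_neg, abs_of_nonneg h2]
    refine ⟨?_, ?_, ?_, ?_⟩ <;> linarith
  have hcB : IsBoundedC2 n Ω (fun x => Real.cos (s * f x)) :=
    hf.comp hΩ hcd (fun t => (hb _ (Real.abs_cos_le_one _)).1)
      (fun t => by rw [deriv_cos_mul]; exact (hb _ (Real.abs_sin_le_one _)).2.1)
      (fun t => by rw [deriv_deriv_cos_mul]; exact (hb _ (Real.abs_cos_le_one _)).2.2.2)
  have hsB : IsBoundedC2 n Ω (fun x => Real.sin (s * f x)) :=
    hf.comp hΩ hsd (fun t => (hb _ (Real.abs_sin_le_one _)).1)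
      (fun t => by rw [deriv_sin_mul]; exact (hb _ (Real.abs_cos_le_one _)).2.2.1)
      (fun t => by rw [deriv_deriv_sin_mul]; exact (hb _ (Real.abs_sin_le_one _)).2.2.2)
  have h1 := gap_inequality_real hΩ hu hcB i k
  have h2 := gap_inequality_real hΩ hu hsB i k
  have hgc : ∀ x ∈ Ω, grad n (fun x => Real.cos (s * f x)) x =
      (-s * Real.sin (s * f x)) • grad n f x := fun x hx => by
    rw [grad_comp (θ := fun t => Real.cos (s * t))
      (mdifferentiableAt_of_contMDiffOn hΩ two_ne_zero hf.contMDiffOn hx)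
      (hcd.differentiable two_ne_zero _), deriv_cos_mul]
  have hgs : ∀ x ∈ Ω, grad n (fun x => Real.sin (s * f x)) x =
      (s * Real.cos (s * f x)) • grad n f x := fun x hx => by
    rw [grad_comp (θ := fun t => Real.sin (s * t))
      (mdifferentiableAt_of_contMDiffOn hΩ two_ne_zero hf.contMDiffOn hx)
      (hsd.differentiable two_ne_zero _), deriv_sin_mul]
  have hlc : ∀ x ∈ Ω, lap n (fun x => Real.cos (s * f x)) x =
      -s * Real.sin (s * f x) * lap n f x + -s ^ 2 * Real.cos (s * f x) * ‖grad n f x‖ ^ 2 :=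
    fun x hx => by
      rw [lap_comp (θ := fun t => Real.cos (s * t)) hΩ hcd hf.contMDiffOn hx,
        deriv_deriv_cos_mul, deriv_cos_mul]
  have hls : ∀ x ∈ Ω, lap n (fun x => Real.sin (s * f x)) x =
      s * Real.cos (s * f x) * lap n f x + -s ^ 2 * Real.sin (s * f x) * ‖grad n f x‖ ^ 2 :=
    fun x hx => by
      rw [lap_comp (θ := fun t => Real.sin (s * t)) hΩ hsd hf.contMDiffOn hx,
        deriv_deriv_sin_mul, deriv_sin_mul]
  have i2 := integrableOn_norm_grad_pow_mul_sq hΩ hf hi 2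
  have i4 := integrableOn_norm_grad_pow_mul_sq hΩ hf hi 4
  have iP := (hf.memLp_commutator hΩ hi).integrable_sq
  have ic2 := integrableOn_norm_grad_pow_mul_sq hΩ hcB hi 2
  have is2 := integrableOn_norm_grad_pow_mul_sq hΩ hsB hi 2
  have icP := (hcB.memLp_commutator hΩ hi).integrable_sq
  have isP := (hsB.memLp_commutator hΩ hi).integrable_sq
  have ic0 := ((hi.mul hΩ hcB).memLp hΩ).integrable_sq
  have is0 := ((hi.mul hΩ hsB).memLp hΩ).integrable_sq
  have e2 : s ^ 2 * ∫ x in Ω, ‖grad n f x‖ ^ 2 * u i x ^ 2 ∂(riemVolume n M) =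
      (∫ x in Ω, ‖grad n (fun x => Real.cos (s * f x)) x‖ ^ 2 * u i x ^ 2 ∂(riemVolume n M)) +
      ∫ x in Ω, ‖grad n (fun x => Real.sin (s * f x)) x‖ ^ 2 * u i x ^ 2 ∂(riemVolume n M) := by
    rw [← integral_add ic2 is2, ← integral_const_mul]
    refine setIntegral_congr_fun hΩ.measurableSet fun x hx => ?_
    simp only [hgc x hx, hgs x hx, norm_smul, mul_pow, Real.norm_eq_abs, sq_abs]
    linear_combination (-(s ^ 2 * ‖grad n f x‖ ^ 2 * u i x ^ 2)) *
      Real.sin_sq_add_cos_sq (s * f x)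
  have eP : s ^ 2 * (∫ x in Ω, (2 * inner ℝ (grad n f x) (grad n (u i) x) +
        u i x * lap n f x) ^ 2 ∂(riemVolume n M)) +
      s ^ 4 * (∫ x in Ω, ‖grad n f x‖ ^ 4 * u i x ^ 2 ∂(riemVolume n M)) =
      (∫ x in Ω, (2 * inner ℝ (grad n (fun x => Real.cos (s * f x)) x) (grad n (u i) x) +
        u i x * lap n (fun x => Real.cos (s * f x)) x) ^ 2 ∂(riemVolume n M)) +
      ∫ x in Ω, (2 * inner ℝ (grad n (fun x => Real.sin (s * f x)) x) (grad n (u i) x) +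
        u i x * lap n (fun x => Real.sin (s * f x)) x) ^ 2 ∂(riemVolume n M) := by
    rw [← integral_add icP isP, ← integral_const_mul, ← integral_const_mul,
      ← integral_add (iP.const_mul _) (i4.const_mul _)]
    refine setIntegral_congr_fun hΩ.measurableSet fun x hx => ?_
    simp only [hgc x hx, hgs x hx, hlc x hx, hls x hx, real_inner_smul_left]
    linear_combination (-(s ^ 2 * (2 * inner ℝ (grad n f x) (grad n (u i) x) +
      u i x * lap n f x) ^ 2 + s ^ 4 * (‖grad n f x‖ ^ 4 * u i x ^ 2))) *
      Real.sin_sq_add_cos_sq (s * f x)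
  have e0 : (1 : ℝ) = (∫ x in Ω, (Real.cos (s * f x) * u i x) ^ 2 ∂(riemVolume n M)) +
      ∫ x in Ω, (Real.sin (s * f x) * u i x) ^ 2 ∂(riemVolume n M) := by
    rw [← integral_add ic0 is0, ← hu.integral_sq hΩ i]
    refine integral_congr_ae (Eventually.of_forall fun x => ?_)
    simp only
    linear_combination (-(u i x ^ 2)) * Real.sin_sq_add_cos_sq (s * f x)
  rw [e2, eP]
  linear_combination h1 + h2 - (lam (k + 1) - lam i) * (lam (k + 2) - lam i) * e0

/-- The eigenvalue inequality obtained from the functions `exp (√-1 s f)`. -/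
theorem gap_inequality_sqrt {f : M → ℝ} (hf : IsBoundedC2 n Ω f) {i k : ℕ+} (hik : i < k) :
    ((lam (k + 2) - lam i) + (lam (k + 1) - lam i)) *
        ∫ x in Ω, ‖grad n f x‖ ^ 2 * u i x ^ 2 ∂(riemVolume n M) ≤
      2 * Real.sqrt ((lam (k + 2) - lam i) * (lam (k + 1) - lam i) *
        ∫ x in Ω, ‖grad n f x‖ ^ 4 * u i x ^ 2 ∂(riemVolume n M)) +
      ∫ x in Ω, (2 * inner ℝ (grad n f x) (grad n (u i) x) + u i x * lap n f x) ^ 2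
        ∂(riemVolume n M) := by
  have hk1 : 0 ≤ lam (k + 1) - lam i :=
    sub_nonneg.2 (hu.monotone (hik.le.trans (PNat.lt_add_right k 1).le))
  have hk2 : 0 ≤ lam (k + 2) - lam i :=
    sub_nonneg.2 (hu.monotone (hik.le.trans (PNat.lt_add_right k 2).le))
  have := add_mul_le_two_sqrt_add (S := (lam (k + 1) - lam i) + (lam (k + 2) - lam i))
    (integral_nonneg fun x => by positivity) (mul_nonneg hk1 hk2)
    (gap_inequality_exp hΩ hu hf i k)
  rw [add_comm (lam (k + 2) - lam i), mul_comm (lam (k + 2) - lam i)]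
  exact this

/-- Expansion of `∫ (2 ∇f · ∇uᵢ + uᵢ Δf)²` when `|∇f| = 1`. -/
lemma integral_commutator_sq {f : M → ℝ} (hf : IsBoundedC2 n Ω f)
    (hf3 : ContMDiffOn (𝓡 n) 𝓘(ℝ, ℝ) 3 f Ω)
    {C : ℝ} (hC : ∀ x ∈ Ω, |inner ℝ (grad n (lap n f) x) (grad n f x)| ≤ C) (i : ℕ+) :
    IntegrableOn (fun x => lap n f x ^ 2 * u i x ^ 2) Ω (riemVolume n M) ∧
    IntegrableOn (fun x => inner ℝ (grad n (lap n f) x) (grad n f x) * u i x ^ 2) Ω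
      (riemVolume n M) ∧
    ∫ x in Ω, (2 * inner ℝ (grad n f x) (grad n (u i) x) + u i x * lap n f x) ^ 2
        ∂(riemVolume n M) =
      4 * ((∫ x in Ω, inner ℝ (grad n f x) (grad n (u i) x) ^ 2 ∂(riemVolume n M))
        - 1 / 4 * (∫ x in Ω, lap n f x ^ 2 * u i x ^ 2 ∂(riemVolume n M))
        - 1 / 2 * (∫ x in Ω, inner ℝ (grad n (lap n f) x) (grad n f x) * u i x ^ 2
            ∂(riemVolume n M))) := by
  obtain ⟨B, hB⟩ := hf.bound
  have hi := hu.isH10 hΩ i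
  have hui := hi.contMDiffOn
  have hf1 : ContMDiffOn (𝓡 n) 𝓘(ℝ, ℝ) 1 f Ω := hf.contMDiffOn.of_le (by norm_num)
  have hL : ContMDiffOn (𝓡 n) 𝓘(ℝ, ℝ) 1 (lap n f) Ω :=
    contMDiffOn_lap hΩ (k := 1) (l := 3) ENat.LEInfty.out (by norm_num) hf3
  have cL := hL.continuousOn
  have cR := continuousOn_inner_grad hΩ hL hf1
  have cG := continuousOn_inner_grad hΩ hf1 hui
  have m1 : MemLp (fun x => lap n f x * u i x) 2 ((riemVolume n M).restrict Ω) := by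
    refine (hi.memLp hΩ).of_le_mul (c := B)
      ((cL.mul hui.continuousOn).aestronglyMeasurable hΩ.measurableSet)
      (ae_restrict_of_forall_mem hΩ.measurableSet fun x hx => ?_)
    rw [norm_mul]
    exact mul_le_mul_of_nonneg_right (hB x hx).2.2 (norm_nonneg _)
  have mR : MemLp (fun x => inner ℝ (grad n (lap n f) x) (grad n f x) * u i x) 2
      ((riemVolume n M).restrict Ω) := by
    refine (hi.memLp hΩ).of_le_mul (c := C)
      ((cR.mul hui.continuousOn).aestronglyMeasurable hΩ.measurableSet)
      (ae_restrict_of_forall_mem hΩ.measurableSet fun x hx => ?_)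
    rw [norm_mul]
    exact mul_le_mul_of_nonneg_right (hC x hx) (norm_nonneg _)
  have m2 : MemLp (fun x => lap n f x * (lap n f x * u i x)) 2
      ((riemVolume n M).restrict Ω) := by
    refine m1.of_le_mul (c := B)
      ((cL.mul (cL.mul hui.continuousOn)).aestronglyMeasurable hΩ.measurableSet)
      (ae_restrict_of_forall_mem hΩ.measurableSet fun x hx => ?_)
    rw [norm_mul]
    exact mul_le_mul_of_nonneg_right (hB x hx).2.2 (norm_nonneg _)
  have m3 : MemLp (fun x => lap n f x * u i x * ‖grad n f x‖) 2
      ((riemVolume n M).restrict Ω) := by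
    refine m1.of_le_mul (c := B) (((cL.mul hui.continuousOn).mul
      (continuousOn_norm_grad hΩ hf1)).aestronglyMeasurable hΩ.measurableSet)
      (ae_restrict_of_forall_mem hΩ.measurableSet fun x hx => ?_)
    rw [mul_comm, norm_mul, norm_norm]
    exact mul_le_mul_of_nonneg_right (hB x hx).2.1 (norm_nonneg _)
  have mG := memLp_inner_grad hΩ hf hi
  have m4 : MemLp (fun x => lap n f x * inner ℝ (grad n f x) (grad n (u i) x)) 2
      ((riemVolume n M).restrict Ω) := by
    refine mG.of_le_mul (c := B) ((cL.mul cG).aestronglyMeasurable hΩ.measurableSet)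
      (ae_restrict_of_forall_mem hΩ.measurableSet fun x hx => ?_)
    rw [norm_mul]
    exact mul_le_mul_of_nonneg_right (hB x hx).2.2 (norm_nonneg _)
  obtain ⟨φ, h1, hc, hs, hl0, hl1⟩ := hi.tendsto_integral hΩ
  have l2 := hl0 _ m2
  have l3 := hl1 (fun x => lap n f x * u i x) f (cL.mul hui.continuousOn) hf1 m3
  have l4 := hl0 _ m4
  have lR := hl0 _ mR
  have hLu : ContMDiffOn (𝓡 n) 𝓘(ℝ, ℝ) 1 (fun x => lap n f x * u i x) Ω := hL.mul hui
  -- This is ∫ψΔf = −∫⟨∇ψ, ∇f⟩ for ψ = Δf uᵢ². In the approximation only one factor uᵢ is replaced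
  -- by `φ m`; the product Δf uᵢ φₘ is C¹ because f is C³. The bound `C` gives the square
  -- integrability needed for the limit of the last term.
  have hlim : ∫ x in Ω, lap n f x * (lap n f x * u i x) * u i x ∂(riemVolume n M) =
      -((∫ x in Ω, lap n f x * u i x * inner ℝ (grad n f x) (grad n (u i) x) ∂(riemVolume n M)) +
        (∫ x in Ω, lap n f x * inner ℝ (grad n f x) (grad n (u i) x) * u i x ∂(riemVolume n M)) +
        ∫ x in Ω, inner ℝ (grad n (lap n f) x) (grad n f x) * u i x * u i x
          ∂(riemVolume n M)) := by
    refine tendsto_nhds_unique l2 (((l3.add l4).add lR).neg.congr fun m => ?_)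
    have hφ := isH10_of_hasCompactSupport hΩ (h1 m) (hc m) (hs m)
    have green := integral_mul_lap hΩ hf.contMDiffOn
      (contMDiff_mul_of_tsupport_subset hΩ hLu (h1 m) (hs m)) (hc m).mul_left
      (tsupport_mul_subset_right.trans (hs m))
    have k3 : Integrable (fun x => lap n f x * u i x * inner ℝ (grad n f x) (grad n (φ m) x))
        ((riemVolume n M).restrict Ω) := by
      refine (m3.integrable_mul (hφ.memLp_grad hΩ)).mono
        (((cL.mul hui.continuousOn).mul (continuousOn_inner_grad hΩ hf1
          (h1 m).contMDiffOn)).aestronglyMeasurable hΩ.measurableSet)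
        (Eventually.of_forall fun x => ?_)
      simp only [norm_mul, norm_norm, Pi.mul_apply, mul_assoc]
      gcongr
      exact norm_inner_le_norm _ _
    have k4 : Integrable (fun x => lap n f x * inner ℝ (grad n f x) (grad n (u i) x) * φ m x)
        ((riemVolume n M).restrict Ω) := m4.integrable_mul (hφ.memLp hΩ)
    have kR : Integrable (fun x => inner ℝ (grad n (lap n f) x) (grad n f x) * u i x * φ m x)
        ((riemVolume n M).restrict Ω) := mR.integrable_mul (hφ.memLp hΩ)
    have k34 : Integrable (fun x => lap n f x * u i x * inner ℝ (grad n f x) (grad n (φ m) x) +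
        lap n f x * inner ℝ (grad n f x) (grad n (u i) x) * φ m x)
        ((riemVolume n M).restrict Ω) := k3.add k4
    have e1 : ∫ x in Ω, lap n f x * (lap n f x * u i x) * φ m x ∂(riemVolume n M) =
        ∫ x in Ω, lap n f x * u i x * φ m x * lap n f x ∂(riemVolume n M) :=
      integral_congr_ae (Eventually.of_forall fun x => by ring)
    rw [e1, green, ← integral_add k3 k4, ← integral_add k34 kR, neg_inj]
    refine setIntegral_congr_fun hΩ.measurableSet fun x hx => ?_
    have dL := mdifferentiableAt_of_contMDiffOn hΩ one_ne_zero hL hx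
    have du := mdifferentiableAt_of_contMDiffOn hΩ one_ne_zero hui hx
    rw [grad_mul (mdifferentiableAt_of_contMDiffOn hΩ one_ne_zero hLu hx)
      ((h1 m).mdifferentiableAt one_ne_zero), grad_mul dL du]
    simp only [inner_add_left, real_inner_smul_left]
    rw [real_inner_comm (grad n f x) (grad n (φ m) x),
      real_inner_comm (grad n f x) (grad n (u i) x)]
    ring
  have iL : IntegrableOn (fun x => lap n f x ^ 2 * u i x ^ 2) Ω (riemVolume n M) :=
    m1.integrable_sq.congr (Eventually.of_forall fun x => mul_pow _ _ _)
  have iR : IntegrableOn (fun x => inner ℝ (grad n (lap n f) x) (grad n f x) * u i x ^ 2) Ω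
      (riemVolume n M) := by
    refine (mR.integrable_mul (hi.memLp hΩ)).congr (Eventually.of_forall fun x => ?_)
    simp only [Pi.mul_apply]
    ring
  refine ⟨iL, iR, ?_⟩
  have iG := mG.integrable_sq
  have iX : Integrable (fun x => lap n f x * u i x * inner ℝ (grad n f x) (grad n (u i) x))
      ((riemVolume n M).restrict Ω) := m1.integrable_mul mG
  have eP : ∫ x in Ω, (2 * inner ℝ (grad n f x) (grad n (u i) x) + u i x * lap n f x) ^ 2
      ∂(riemVolume n M) =
      4 * (∫ x in Ω, inner ℝ (grad n f x) (grad n (u i) x) ^ 2 ∂(riemVolume n M)) +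
      4 * (∫ x in Ω, lap n f x * u i x * inner ℝ (grad n f x) (grad n (u i) x)
        ∂(riemVolume n M)) + ∫ x in Ω, lap n f x ^ 2 * u i x ^ 2 ∂(riemVolume n M) := by
    have iGX : Integrable (fun x => 4 * inner ℝ (grad n f x) (grad n (u i) x) ^ 2 +
        4 * (lap n f x * u i x * inner ℝ (grad n f x) (grad n (u i) x)))
        ((riemVolume n M).restrict Ω) := (iG.const_mul 4).add (iX.const_mul 4)
    rw [← integral_const_mul, ← integral_const_mul, ← integral_add (iG.const_mul 4)
      (iX.const_mul 4), ← integral_add iGX iL]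
    exact integral_congr_ae (Eventually.of_forall fun x => by ring)
  have e2 : ∫ x in Ω, lap n f x * (lap n f x * u i x) * u i x ∂(riemVolume n M) =
      ∫ x in Ω, lap n f x ^ 2 * u i x ^ 2 ∂(riemVolume n M) :=
    integral_congr_ae (Eventually.of_forall fun x => by ring)
  have e4 : ∫ x in Ω, lap n f x * inner ℝ (grad n f x) (grad n (u i) x) * u i x
      ∂(riemVolume n M) = ∫ x in Ω, lap n f x * u i x * inner ℝ (grad n f x) (grad n (u i) x)
      ∂(riemVolume n M) := integral_congr_ae (Eventually.of_forall fun x => by ring)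
  have eR : ∫ x in Ω, inner ℝ (grad n (lap n f) x) (grad n f x) * u i x * u i x
      ∂(riemVolume n M) = ∫ x in Ω, inner ℝ (grad n (lap n f) x) (grad n f x) * u i x ^ 2
      ∂(riemVolume n M) := integral_congr_ae (Eventually.of_forall fun x => by ring)
  rw [e2, e4, eR] at hlim
  rw [eP]
  linarith

/-- `(λₖ₊₂ - λₖ₊₁)² ≤ 4 λₖ₊₂ ∫ (2 ∇f · ∇uᵢ + uᵢ Δf)²` when `|∇f| = 1`. -/
lemma gap_sq_le_mul_integral_commutator_sq {f : M → ℝ} (hf : IsBoundedC2 n Ω f)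
    (hf1 : ∀ x ∈ Ω, ‖grad n f x‖ ^ 2 = 1) {i k : ℕ+} (hik : i < k) :
    (lam (k + 2) - lam (k + 1)) ^ 2 ≤
      4 * (∫ x in Ω, (2 * inner ℝ (grad n f x) (grad n (u i) x) + u i x * lap n f x) ^ 2
        ∂(riemVolume n M)) * lam (k + 2) := by
  have h := gap_inequality_sqrt hΩ hu hf hik
  have e2 : ∫ x in Ω, ‖grad n f x‖ ^ 2 * u i x ^ 2 ∂(riemVolume n M) = 1 := by
    rw [← hu.integral_sq hΩ i]
    exact setIntegral_congr_fun hΩ.measurableSet fun x hx => by simp only [hf1 x hx, one_mul]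
  have e4 : ∫ x in Ω, ‖grad n f x‖ ^ 4 * u i x ^ 2 ∂(riemVolume n M) = 1 := by
    rw [← hu.integral_sq hΩ i]
    refine setIntegral_congr_fun hΩ.measurableSet fun x hx => ?_
    simp only [show ‖grad n f x‖ ^ 4 = (‖grad n f x‖ ^ 2) ^ 2 by ring, hf1 x hx, one_pow, one_mul]
  rw [e2, e4, mul_one, mul_one] at h
  set D := ∫ x in Ω, (2 * inner ℝ (grad n f x) (grad n (u i) x) + u i x * lap n f x) ^ 2
        ∂(riemVolume n M)
  have h0 := hu.nonneg hΩ i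
  have hB : 0 ≤ lam (k + 1) - lam i :=
    sub_nonneg.2 (hu.monotone (hik.le.trans (PNat.lt_add_right k 1).le))
  have hA : 0 ≤ lam (k + 2) - lam i :=
    sub_nonneg.2 (hu.monotone (hik.le.trans (PNat.lt_add_right k 2).le))
  have hAB : lam (k + 1) - lam i ≤ lam (k + 2) - lam i :=
    sub_le_sub_right (hu.monotone (by rw [← PNat.coe_le_coe]; simp [PNat.add_coe])) _
  set a := Real.sqrt (lam (k + 2) - lam i) with ha
  set b := Real.sqrt (lam (k + 1) - lam i) with hb
  have ha2 : a ^ 2 = lam (k + 2) - lam i := Real.sq_sqrt hA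
  have hb2 : b ^ 2 = lam (k + 1) - lam i := Real.sq_sqrt hB
  have ha0 : 0 ≤ a := Real.sqrt_nonneg _
  have hb0 : 0 ≤ b := Real.sqrt_nonneg _
  have hba : b ≤ a := Real.sqrt_le_sqrt hAB
  rw [Real.sqrt_mul hA, ← ha, ← hb, ← ha2, ← hb2] at h
  -- At this point `h` reads a² + b² ≤ 2ab + D.
  have hD : (a - b) ^ 2 ≤ D := by nlinarith
  have hD0 : 0 ≤ D := (sq_nonneg _).trans hD
  calc (lam (k + 2) - lam (k + 1)) ^ 2 = (a - b) ^ 2 * (a + b) ^ 2 := by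
        rw [← mul_pow]
        congr 1
        linear_combination -ha2 + hb2
    _ ≤ D * (2 * a) ^ 2 := by
        refine mul_le_mul hD ?_ (sq_nonneg _) hD0
        exact pow_le_pow_left₀ (add_nonneg ha0 hb0) (by linarith) 2
    _ = 4 * D * (lam (k + 2) - lam i) := by rw [← ha2]; ring
    _ ≤ 4 * D * lam (k + 2) := mul_le_mul_of_nonneg_left (by linarith) (by linarith)

end GapEstimates

/-! ### Boundedness near a point of the closure, in coordinates. -/

section BoundedNear

variable {n : ℕ}

/-- `H` is differentiable in `O`, and near `y₀` it is bounded in `O` together with its derivative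
along `X`. -/
structure IsBoundedAlong (O : Set (Euc n)) (y₀ : Euc n) (X : Fin n → Euc n → ℝ)
    (H : Euc n → ℝ) : Prop where
  differentiableOn : DifferentiableOn ℝ H O
  isBigO : H =O[𝓝[O] y₀] fun _ => (1 : ℝ)
  isBigO_deriv : (fun y => ∑ i, X i y * partialDeriv i H y) =O[𝓝[O] y₀] fun _ => (1 : ℝ)

lemma isBigO_one_mul {α : Type*} {l : Filter α} {F G : α → ℝ} (hF : F =O[l] fun _ => (1 : ℝ))
    (hG : G =O[l] fun _ => (1 : ℝ)) : (fun y => F y * G y) =O[l] fun _ => (1 : ℝ) := by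
  simpa only [mul_one] using hF.mul hG

lemma isBigO_one_sum {α ι : Type*} {l : Filter α} {s : Finset ι} {F : ι → α → ℝ}
    (hF : ∀ i ∈ s, F i =O[l] fun _ => (1 : ℝ)) :
    (fun y => ∑ i ∈ s, F i y) =O[l] fun _ => (1 : ℝ) :=
  Asymptotics.IsBigO.fun_sum hF

variable {O : Set (Euc n)} (hO : IsOpen O) {y₀ : Euc n} {X : Fin n → Euc n → ℝ}

include hO

lemma isBigO_one_congr {F G : Euc n → ℝ} (hF : F =O[𝓝[O] y₀] fun _ => (1 : ℝ)) (h : EqOn G F O) :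
    G =O[𝓝[O] y₀] fun _ => (1 : ℝ) :=
  hF.congr' (by filter_upwards [self_mem_nhdsWithin] with y hy using (h hy).symm) EventuallyEq.rfl

lemma IsBoundedAlong.congr {H K : Euc n → ℝ} (hH : IsBoundedAlong O y₀ X H) (h : EqOn K H O) :
    IsBoundedAlong O y₀ X K := by
  refine ⟨hH.differentiableOn.congr h, isBigO_one_congr hO hH.isBigO h,
    isBigO_one_congr hO hH.isBigO_deriv fun y hy => ?_⟩
  refine Finset.sum_congr rfl fun i _ => ?_
  rw [partialDeriv_congr (h.eventuallyEq_of_mem (hO.mem_nhds hy))]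

lemma IsBoundedAlong.mul {H K : Euc n → ℝ} (hH : IsBoundedAlong O y₀ X H)
    (hK : IsBoundedAlong O y₀ X K) : IsBoundedAlong O y₀ X (fun y => H y * K y) := by
  refine ⟨hH.differentiableOn.mul hK.differentiableOn, isBigO_one_mul hH.isBigO hK.isBigO, ?_⟩
  refine isBigO_one_congr hO ((isBigO_one_mul hH.isBigO hK.isBigO_deriv).add
    (isBigO_one_mul hK.isBigO hH.isBigO_deriv)) fun y hy => ?_
  simp only [Finset.mul_sum, ← Finset.sum_add_distrib]
  refine Finset.sum_congr rfl fun i _ => ?_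
  rw [partialDeriv_mul (hH.differentiableOn.differentiableAt (hO.mem_nhds hy))
    (hK.differentiableOn.differentiableAt (hO.mem_nhds hy))]
  ring

lemma IsBoundedAlong.add {H K : Euc n → ℝ} (hH : IsBoundedAlong O y₀ X H)
    (hK : IsBoundedAlong O y₀ X K) : IsBoundedAlong O y₀ X (fun y => H y + K y) := by
  refine ⟨hH.differentiableOn.add hK.differentiableOn, hH.isBigO.add hK.isBigO, ?_⟩
  refine isBigO_one_congr hO (hH.isBigO_deriv.add hK.isBigO_deriv) fun y hy => ?_
  rw [← Finset.sum_add_distrib]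
  refine Finset.sum_congr rfl fun i _ => ?_
  rw [← mul_add, partialDeriv, fderiv_fun_add
    (hH.differentiableOn.differentiableAt (hO.mem_nhds hy))
    (hK.differentiableOn.differentiableAt (hO.mem_nhds hy))]
  rfl

lemma IsBoundedAlong.sum {ι : Type*} {s : Finset ι} {H : ι → Euc n → ℝ}
    (hH : ∀ j ∈ s, IsBoundedAlong O y₀ X (H j)) :
    IsBoundedAlong O y₀ X (fun y => ∑ j ∈ s, H j y) := by
  refine ⟨DifferentiableOn.fun_sum fun j hj => (hH j hj).differentiableOn,
    isBigO_one_sum fun j hj => (hH j hj).isBigO, ?_⟩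
  refine isBigO_one_congr hO (isBigO_one_sum fun j hj => (hH j hj).isBigO_deriv) fun y hy => ?_
  rw [Finset.sum_comm]
  refine Finset.sum_congr rfl fun i _ => ?_
  rw [partialDeriv_sum s
    (fun j hj => (hH j hj).differentiableOn.differentiableAt (hO.mem_nhds hy)), Finset.mul_sum]

omit hO

/-- `H` is differentiable in `O`, and near `y₀` it is bounded in `O` together with its first
derivatives. -/
structure IsBoundedC1Near (O : Set (Euc n)) (y₀ : Euc n) (H : Euc n → ℝ) : Prop where
  differentiableOn : DifferentiableOn ℝ H O
  isBigO : H =O[𝓝[O] y₀] fun _ => (1 : ℝ)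
  isBigO_partialDeriv : ∀ k, partialDeriv k H =O[𝓝[O] y₀] fun _ => (1 : ℝ)

/-- Constant coordinate fields recover the single partial derivatives. Stability under products and
sums is thus inherited from `IsBoundedAlong`. -/
lemma isBoundedC1Near_iff {H : Euc n → ℝ} : IsBoundedC1Near O y₀ H ↔
    ∀ X : Fin n → Euc n → ℝ, (∀ i, X i =O[𝓝[O] y₀] fun _ => (1 : ℝ)) →
      IsBoundedAlong O y₀ X H := by
  refine ⟨fun h X hX => ⟨h.differentiableOn, h.isBigO,
    isBigO_one_sum fun i _ => isBigO_one_mul (hX i) (h.isBigO_partialDeriv i)⟩, fun h => ?_⟩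
  refine ⟨(h (fun _ _ => 0) fun i => Asymptotics.isBigO_zero _ _).differentiableOn,
    (h (fun _ _ => 0) fun i => Asymptotics.isBigO_zero _ _).isBigO, fun k => ?_⟩
  have := (h (fun i _ => if i = k then 1 else 0)
    fun i => Asymptotics.isBigO_const_const _ one_ne_zero _).isBigO_deriv
  simpa using this

include hO

lemma IsBoundedC1Near.mul {H K : Euc n → ℝ} (hH : IsBoundedC1Near O y₀ H)
    (hK : IsBoundedC1Near O y₀ K) : IsBoundedC1Near O y₀ (fun y => H y * K y) :=
  isBoundedC1Near_iff.2 fun X hX =>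
    (isBoundedC1Near_iff.1 hH X hX).mul hO (isBoundedC1Near_iff.1 hK X hX)

lemma IsBoundedC1Near.sum {ι : Type*} {s : Finset ι} {H : ι → Euc n → ℝ}
    (hH : ∀ j ∈ s, IsBoundedC1Near O y₀ (H j)) : IsBoundedC1Near O y₀ (fun y => ∑ j ∈ s, H j y) :=
  isBoundedC1Near_iff.2 fun X hX => .sum hO fun j hj => isBoundedC1Near_iff.1 (hH j hj) X hX

lemma isBoundedC1Near_of_contDiffOn {T : Set (Euc n)} (hT : IsOpen T) (hOT : O ⊆ T) (hy : y₀ ∈ T)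
    {H : Euc n → ℝ} (hH : ContDiffOn ℝ 1 H T) : IsBoundedC1Near O y₀ H := by
  have hb : ∀ K : Euc n → ℝ, ContinuousOn K T → K =O[𝓝[O] y₀] fun _ => (1 : ℝ) := fun K hK =>
    (((hK.continuousAt (hT.mem_nhds hy)).tendsto).mono_left nhdsWithin_le_nhds).isBigO_one ℝ
  exact ⟨(hH.differentiableOn one_ne_zero).mono hOT, hb _ hH.continuousOn, fun k =>
    hb _ (contDiffOn_partialDeriv hT (k := 0) hH (by simp) k).continuousOn⟩

lemma partialDeriv_comm {F : Euc n → ℝ} (hF : ContDiffOn ℝ 2 F O) {y : Euc n} (hy : y ∈ O)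
    (i j : Fin n) :
    partialDeriv i (partialDeriv j F) y = partialDeriv j (partialDeriv i F) y := by
  have hd : DifferentiableAt ℝ (fderiv ℝ F) y :=
    ((hF.fderiv_of_isOpen hO (m := 1) (by norm_num)).differentiableOn
      one_ne_zero).differentiableAt (hO.mem_nhds hy)
  have h : ∀ a b : Fin n, partialDeriv a (partialDeriv b F) y =
      fderiv ℝ (fderiv ℝ F) y (EuclideanSpace.single a 1) (EuclideanSpace.single b 1) := by
    intro a b
    change fderiv ℝ (fun z => fderiv ℝ F z (EuclideanSpace.single b 1)) y _ = _
    rw [fderiv_clm_apply hd (differentiableAt_const _)]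
    simp
  rw [h, h]
  exact (hF.contDiffAt (hO.mem_nhds hy)).isSymmSndFDerivAt (by simp) _ _

/-- A function whose derivatives of order one and two converge at `y₀` has partial derivatives
which are bounded near `y₀` together with their first derivatives. -/
lemma isBoundedC1Near_partialDeriv {F : Euc n → ℝ} (hF : ContDiffOn ℝ 2 F O)
    (hlim : ∀ m : ℕ, m ≤ 2 → ∃ L, Tendsto (iteratedFDeriv ℝ m F) (𝓝[O] y₀) (𝓝 L)) (j : Fin n) :
    IsBoundedC1Near O y₀ (partialDeriv j F) := by
  refine ⟨(contDiffOn_partialDeriv hO (k := 1) hF (by norm_num) j).differentiableOn one_ne_zero,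
    ?_, fun k => ?_⟩
  · obtain ⟨L, hL⟩ := hlim 1 (by norm_num)
    refine Asymptotics.IsBigO.trans (Asymptotics.IsBigO.of_bound 1 ?_) (hL.isBigO_one ℝ)
    filter_upwards with y
    rw [one_mul, norm_iteratedFDeriv_one]
    simpa [partialDeriv] using (fderiv ℝ F y).le_opNorm (EuclideanSpace.single j (1 : ℝ))
  · obtain ⟨L, hL⟩ := hlim 2 le_rfl
    refine Asymptotics.IsBigO.trans (Asymptotics.IsBigO.of_bound 1 ?_) (hL.isBigO_one ℝ)
    filter_upwards [self_mem_nhdsWithin] with y hy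
    have hd : DifferentiableAt ℝ (fderiv ℝ F) y :=
      ((hF.fderiv_of_isOpen hO (m := 1) (by norm_num)).differentiableOn
        one_ne_zero).differentiableAt (hO.mem_nhds hy)
    have h : partialDeriv k (partialDeriv j F) y =
        iteratedFDeriv ℝ 2 F y ![EuclideanSpace.single k 1, EuclideanSpace.single j 1] := by
      rw [iteratedFDeriv_two_apply]
      change fderiv ℝ (fun z => fderiv ℝ F z (EuclideanSpace.single j 1)) y _ = _
      rw [fderiv_clm_apply hd (differentiableAt_const _)]
      simp
    rw [h, one_mul]
    refine ((iteratedFDeriv ℝ 2 F y).le_opNorm _).trans ?_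
    simp [Fin.prod_univ_two]

end BoundedNear

/-! ### From local bounds at the closure to uniform bounds on Ω. -/

section Closure

variable {n : ℕ} {M : Type*} [MetricSpace M] [ChartedSpace (Euc n) M]

/-- A continuous linear map commutes with iterated derivatives, so their limits are carried along.
It serves for real and imaginary parts. -/
lemma C3C2Closure.clm_comp {Ω : Set M} (hΩ : IsOpen Ω) [IsManifold (𝓡 n) ∞ M]
    {E F : Type*} [NormedAddCommGroup E] [NormedSpace ℝ E] [NormedAddCommGroup F] [NormedSpace ℝ F]
    {g : M → E} (hg : C3C2Closure n Ω g) (A : E →L[ℝ] F) : C3C2Closure n Ω (fun x => A (g x)) := by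
  refine ⟨A.contMDiff.comp_contMDiffOn hg.contMDiffOn, fun x₀ hx₀ m hm => ?_⟩
  obtain ⟨L, hL⟩ := hg.limits x₀ hx₀ m hm
  refine ⟨A.compContinuousMultilinearMap L, ?_⟩
  have h1 := ((ContinuousLinearMap.compContinuousMultilinearMapL ℝ (fun _ : Fin m => Euc n) E F
    A).continuous.tendsto L).comp hL
  refine h1.congr' ?_
  filter_upwards [self_mem_nhdsWithin] with y hy
  have hO : IsOpen ((chartAt (Euc n) x₀).target ∩ (chartAt (Euc n) x₀).symm ⁻¹' Ω) :=
    (chartAt (Euc n) x₀).isOpen_inter_preimage_symm hΩ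
  have hc : ContDiffOn ℝ 3 (fun y => g ((chartAt (Euc n) x₀).symm y))
      ((chartAt (Euc n) x₀).target ∩ (chartAt (Euc n) x₀).symm ⁻¹' Ω) := by
    rw [← contMDiffOn_iff_contDiffOn]
    exact hg.contMDiffOn.comp (((contMDiffOn_chart_symm (I := 𝓡 n) (n := ∞) (x := x₀)).of_le
      ENat.LEInfty.out).mono inter_subset_left) (fun y hy => hy.2)
  have := A.iteratedFDeriv_comp_left (hc.contDiffAt (hO.mem_nhds hy)) (i := m)
    (by exact_mod_cast hm.trans (by norm_num))
  exact this.symm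

variable [RiemannianBundle (fun x : M => TangentSpace (𝓡 n) x)]

/-- Each point of the closure has a neighbourhood on whose intersection with Ω the function is
bounded; compactness leaves finitely many such bounds. -/
lemma exists_bound_of_isBigO {Ω : Set M} (hcpt : IsCompact (closure Ω)) {P : M → ℝ}
    (h : ∀ x₀ ∈ closure Ω, inChart n x₀ P =O[𝓝[chartDom n x₀ Ω] (chartAt (Euc n) x₀ x₀)]
      fun _ => (1 : ℝ)) : ∃ C, ∀ x ∈ Ω, |P x| ≤ C := by
  have key : ∃ C, ∀ x ∈ closure Ω ∩ Ω, |P x| ≤ C := by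
    refine hcpt.induction_on (p := fun t => ∃ C, ∀ x ∈ t ∩ Ω, |P x| ≤ C) ⟨0, by simp⟩
      (fun s t hst ⟨C, hC⟩ => ⟨C, fun x hx => hC x ⟨hst hx.1, hx.2⟩⟩)
      (fun s t ⟨C, hC⟩ ⟨D, hD⟩ => ⟨max C D, fun x hx => ?_⟩) fun x₀ hx₀ => ?_
    · rcases hx.1 with h1 | h1
      · exact (hC x ⟨h1, hx.2⟩).trans (le_max_left _ _)
      · exact (hD x ⟨h1, hx.2⟩).trans (le_max_right _ _)
    · set c := chartAt (Euc n) x₀ with hc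
      obtain ⟨C, hC⟩ := (h x₀ hx₀).bound
      have hS : c.source ∈ 𝓝 x₀ := c.open_source.mem_nhds (mem_chart_source _ x₀)
      have ht : Tendsto c (𝓝[Ω] x₀) (𝓝[chartDom n x₀ Ω] (c x₀)) := by
        refine tendsto_nhdsWithin_iff.2 ⟨((c.continuousAt (mem_chart_source _ x₀)).tendsto).mono_left
          nhdsWithin_le_nhds, ?_⟩
        filter_upwards [self_mem_nhdsWithin, nhdsWithin_le_nhds hS] with x hx hxS
        exact ⟨c.map_source hxS, by rw [mem_preimage, c.left_inv hxS]; exact hx⟩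
      have h1 := ht.eventually hC
      have h2 : ∀ᶠ x in 𝓝[Ω] x₀, |P x| ≤ C := by
        filter_upwards [h1, nhdsWithin_le_nhds hS] with x hx hxS
        have e : inChart n x₀ P (c x) = P x := congrArg P (c.left_inv hxS)
        rw [e] at hx
        simpa using hx
      obtain ⟨t, ht, htC⟩ := mem_nhdsWithin_iff_exists_mem_nhds_inter.1 h2
      exact ⟨t, nhdsWithin_le_nhds ht, C, fun x hx => htC hx⟩
  obtain ⟨C, hC⟩ := key
  exact ⟨C, fun x hx => hC x ⟨subset_closure hx, hx⟩⟩

end Closure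

/-! ### Bounds on f, ∇f, Δf and ∇(Δf)·∇f. -/

section ClosureBounds

lemma partialDeriv_sum_mul {n : ℕ} {ι : Type*} (s : Finset ι) {F G : ι → Euc n → ℝ} {y : Euc n}
    (hF : ∀ a ∈ s, DifferentiableAt ℝ (F a) y) (hG : ∀ a ∈ s, DifferentiableAt ℝ (G a) y)
    (i : Fin n) : partialDeriv i (fun z => ∑ a ∈ s, F a z * G a z) y =
      ∑ a ∈ s, (partialDeriv i (F a) y * G a y + F a y * partialDeriv i (G a) y) := by
  rw [partialDeriv_sum s (F := fun a z => F a z * G a z) fun a ha => (hF a ha).mul (hG a ha)]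
  refine Finset.sum_congr rfl fun a ha => ?_
  rw [partialDeriv_mul (hF a ha) (hG a ha)]
  ring

variable {n : ℕ} {M : Type*} [MetricSpace M] [ChartedSpace (Euc n) M]
  [RiemannianBundle (fun x : M => TangentSpace (𝓡 n) x)] [IsManifold (𝓡 n) ∞ M]
  [IsContMDiffRiemannianBundle (𝓡 n) ∞ (Euc n) (fun x : M => TangentSpace (𝓡 n) x)]
  [MeasurableSpace M] [BorelSpace M] {Ω : Set M} (hΩ : IsOpen Ω)

include hΩ

lemma isBoundedC1Near_of_contDiffOn_target (x₀ : M) {H : Euc n → ℝ}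
    (hH : ContDiffOn ℝ ∞ H (chartAt (Euc n) x₀).target) :
    IsBoundedC1Near (chartDom n x₀ Ω) (chartAt (Euc n) x₀ x₀) H :=
  isBoundedC1Near_of_contDiffOn (isOpen_chartDom x₀ hΩ) (chartAt (Euc n) x₀).open_target
    inter_subset_left (mem_chart_target _ x₀) (hH.of_le ENat.LEInfty.out)

lemma C3C2Closure.isBoundedC1Near_partialDeriv {f : M → ℝ} (hf : C3C2Closure n Ω f) {x₀ : M}
    (hx₀ : x₀ ∈ closure Ω) (j : Fin n) :
    IsBoundedC1Near (chartDom n x₀ Ω) (chartAt (Euc n) x₀ x₀)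
      (partialDeriv j (inChart n x₀ f)) :=
  RiemDirichlet.isBoundedC1Near_partialDeriv (isOpen_chartDom x₀ hΩ)
    (contDiffOn_inChart x₀ ENat.LEInfty.out (hf.contMDiffOn.of_le (by norm_num)))
    (hf.limits x₀ hx₀) j

lemma C3C2Closure.isBoundedC1Near_gradCoord {f : M → ℝ} (hf : C3C2Closure n Ω f) {x₀ : M}
    (hx₀ : x₀ ∈ closure Ω) (i : Fin n) :
    IsBoundedC1Near (chartDom n x₀ Ω) (chartAt (Euc n) x₀ x₀)
      (fun y => ∑ j, (gram x₀ y)⁻¹ i j * partialDeriv j (inChart n x₀ f) y) :=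
  .sum (isOpen_chartDom x₀ hΩ) fun j _ => .mul (isOpen_chartDom x₀ hΩ)
    (isBoundedC1Near_of_contDiffOn_target hΩ x₀ (contDiffOn_gram_inv x₀ i j))
    (hf.isBoundedC1Near_partialDeriv hΩ hx₀ j)

lemma isBoundedC1Near_inv_volDensity (x₀ : M) :
    IsBoundedC1Near (chartDom n x₀ Ω) (chartAt (Euc n) x₀ x₀)
      (fun y => (volDensity x₀ y)⁻¹) :=
  isBoundedC1Near_of_contDiffOn_target hΩ x₀
    ((contDiffOn_volDensity x₀).inv fun _ hy => (volDensity_pos x₀ hy).ne')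

/-- In a chart, |∇f|² and Δf are polynomial in the first two derivatives of f, with coefficients
smooth on the whole chart and not just on Ω. All of them are thus bounded near each point of the
closure. -/
lemma C3C2Closure.isBoundedC2 (hcpt : IsCompact (closure Ω)) {f : M → ℝ}
    (hf : C3C2Closure n Ω f) : IsBoundedC2 n Ω f := by
  have hf2 : ContMDiffOn (𝓡 n) 𝓘(ℝ, ℝ) 2 f Ω := hf.contMDiffOn.of_le (by norm_num)
  obtain ⟨B₀, hB₀⟩ := exists_bound_of_isBigO (n := n) hcpt (P := f) fun x₀ hx₀ => by
    obtain ⟨L, hL⟩ := hf.limits x₀ hx₀ 0 (by norm_num)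
    refine Asymptotics.IsBigO.trans (Asymptotics.IsBigO.of_bound 1 ?_) (hL.isBigO_one ℝ)
    filter_upwards with y
    rw [one_mul, norm_iteratedFDeriv_zero]
  obtain ⟨B₁, hB₁⟩ := exists_bound_of_isBigO (n := n) hcpt
    (P := fun x => inner ℝ (grad n f x) (grad n f x)) fun x₀ hx₀ => by
    refine isBigO_one_congr (isOpen_chartDom x₀ hΩ) (isBigO_one_sum (s := Finset.univ) fun i _ =>
      isBigO_one_mul (hf.isBoundedC1Near_partialDeriv hΩ hx₀ i).isBigO
        (hf.isBoundedC1Near_gradCoord hΩ hx₀ i).isBigO) fun y hy => ?_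
    have hd := mdifferentiableAt_of_contMDiffOn hΩ two_ne_zero hf2 hy.2
    exact inner_grad_chart x₀ hy.1 hd hd
  obtain ⟨B₂, hB₂⟩ := exists_bound_of_isBigO (n := n) hcpt (P := lap n f) fun x₀ hx₀ => by
    have hO := isOpen_chartDom (n := n) x₀ hΩ
    refine isBigO_one_congr hO (isBigO_one_mul (isBoundedC1Near_inv_volDensity hΩ x₀).isBigO
      (isBigO_one_sum (s := Finset.univ) (F := fun i => partialDeriv i (gradFlux x₀ f i))
        fun i _ => ?_)) fun y hy => lap_chart_symm hΩ hf2 x₀ hy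
    exact ((isBoundedC1Near_of_contDiffOn_target hΩ x₀ (contDiffOn_volDensity x₀)).mul hO
      (hf.isBoundedC1Near_gradCoord hΩ hx₀ i)).isBigO_partialDeriv i
  refine ⟨hf2, max B₀ (max (Real.sqrt B₁) B₂), fun x hx => ⟨?_, ?_, ?_⟩⟩
  · exact (hB₀ x hx).trans (le_max_left _ _)
  · refine le_trans ?_ ((le_max_left _ _).trans (le_max_right _ _))
    refine Real.le_sqrt_of_sq_le ?_
    rw [← real_inner_self_eq_norm_sq]
    exact (le_abs_self _).trans (hB₁ x hx)
  · exact (hB₂ x hx).trans ((le_max_right _ _).trans (le_max_right _ _))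

/-- If the gradient of `f` has unit length, then differentiating twice the equation `|∇f|² = 1` shows
that the second derivatives of `f` are bounded along the gradient. -/
lemma C3C2Closure.isBoundedAlong_partialDeriv_partialDeriv {f : M → ℝ} (hf : C3C2Closure n Ω f)
    (hf1 : ∀ x ∈ Ω, ‖grad n f x‖ ^ 2 = 1) {x₀ : M} (hx₀ : x₀ ∈ closure Ω) (k j : Fin n) :
    IsBoundedAlong (chartDom n x₀ Ω) (chartAt (Euc n) x₀ x₀)
      (fun i y => ∑ m, (gram x₀ y)⁻¹ i m * partialDeriv m (inChart n x₀ f) y)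
      (partialDeriv k (partialDeriv j (inChart n x₀ f))) := by
  have hO := isOpen_chartDom (n := n) x₀ hΩ
  set O := chartDom n x₀ Ω with hOdef
  set F := inChart n x₀ f with hFdef
  set X : Fin n → Euc n → ℝ := fun i y => ∑ m, (gram x₀ y)⁻¹ i m * partialDeriv m F y with hX
  have hF : ContDiffOn ℝ 3 F O := contDiffOn_inChart x₀ ENat.LEInfty.out hf.contMDiffOn
  have hF1 : ∀ a, ContDiffOn ℝ 2 (partialDeriv a F) O :=
    fun a => contDiffOn_partialDeriv hO hF (by norm_num) a
  have hF2 : ∀ a b, ContDiffOn ℝ 1 (partialDeriv a (partialDeriv b F)) O :=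
    fun a b => contDiffOn_partialDeriv hO (hF1 b) (by norm_num) a
  have dF1 : ∀ a, ∀ y ∈ O, DifferentiableAt ℝ (partialDeriv a F) y := fun a y hy =>
    ((hF1 a).differentiableOn two_ne_zero).differentiableAt (hO.mem_nhds hy)
  have dF2 : ∀ a b, ∀ y ∈ O, DifferentiableAt ℝ (partialDeriv a (partialDeriv b F)) y :=
    fun a b y hy => ((hF2 a b).differentiableOn one_ne_zero).differentiableAt (hO.mem_nhds hy)
  have bF : ∀ a, IsBoundedC1Near O (chartAt (Euc n) x₀ x₀) (partialDeriv a F) :=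
    fun a => hf.isBoundedC1Near_partialDeriv hΩ hx₀ a
  have bX : ∀ a, IsBoundedC1Near O (chartAt (Euc n) x₀ x₀) (X a) :=
    fun a => hf.isBoundedC1Near_gradCoord hΩ hx₀ a
  have cG : ∀ a b, ContDiffOn ℝ ∞ (fun y => (gram x₀ y)⁻¹ a b) O :=
    fun a b => (contDiffOn_gram_inv x₀ a b).mono inter_subset_left
  have dG : ∀ a b, ∀ y ∈ O, DifferentiableAt ℝ (fun y => (gram x₀ y)⁻¹ a b) y := fun a b y hy =>
    ((cG a b).differentiableOn (by simp)).differentiableAt (hO.mem_nhds hy)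
  have bG : ∀ a b, IsBoundedC1Near O (chartAt (Euc n) x₀ x₀)
      (partialDeriv j (fun y => (gram x₀ y)⁻¹ a b)) := fun a b =>
    isBoundedC1Near_of_contDiffOn_target hΩ x₀ (contDiffOn_partialDeriv
      (chartAt (Euc n) x₀).open_target (contDiffOn_gram_inv x₀ a b) (by simp) j)
  have hsymm : ∀ (y : Euc n) (a b : Fin n), (gram x₀ y)⁻¹ a b = (gram x₀ y)⁻¹ b a := fun y a b => by
    simpa using ((gram_isHermitian x₀ y).inv.apply a b).symm
  have hunit : ∀ y ∈ O, ∑ i, partialDeriv i F y * X i y = 1 := by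
    intro y hy
    have hd := mdifferentiableAt_of_contMDiffOn hΩ three_ne_zero hf.contMDiffOn hy.2
    rw [← hf1 _ hy.2, ← real_inner_self_eq_norm_sq]
    exact (inner_grad_chart x₀ hy.1 hd hd).symm
  -- `r` collects the terms of ∂ⱼ(|∇f|²) in which the metric is differentiated. It contains only
  -- first derivatives of f, so its own first derivatives are still bounded.
  set r : Euc n → ℝ := fun y => ∑ i, ∑ m, partialDeriv j (fun y => (gram x₀ y)⁻¹ i m) y *
    (partialDeriv m F y * partialDeriv i F y) with hr
  have br : IsBoundedC1Near O (chartAt (Euc n) x₀ x₀) r :=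
    .sum hO fun i _ => .sum hO fun m _ => .mul hO (bG i m) (.mul hO (bF m) (bF i))
  have dX : ∀ a, ∀ y ∈ O, DifferentiableAt ℝ (X a) y := fun a y hy =>
    (bX a).differentiableOn.differentiableAt (hO.mem_nhds hy)
  have pX : ∀ i, ∀ y ∈ O, partialDeriv j (X i) y =
      ∑ m, (partialDeriv j (fun y => (gram x₀ y)⁻¹ i m) y * partialDeriv m F y +
        (gram x₀ y)⁻¹ i m * partialDeriv j (partialDeriv m F) y) := by
    intro i y hy
    exact partialDeriv_sum_mul _ (fun m _ => dG i m y hy) (fun m _ => dF1 m y hy) j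
  -- The first differentiation of |∇f|² = 1; the two terms with second derivatives of f coincide by
  -- symmetry of the inverse metric.
  have first : ∀ y ∈ O, 2 * ∑ i, X i y * partialDeriv j (partialDeriv i F) y = -r y := by
    intro y hy
    have h1 : partialDeriv j (fun y => ∑ i, partialDeriv i F y * X i y) y = 0 := by
      rw [partialDeriv_congr (H := fun _ => (1 : ℝ))
        (by filter_upwards [hO.mem_nhds hy] with z hz using hunit z hz)]
      simp [partialDeriv]
    rw [partialDeriv_sum_mul _ (fun m _ => dF1 m y hy) (fun m _ => dX m y hy), Finset.sum_add_distrib] at h1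
    have h2 : ∑ i, partialDeriv i F y * ∑ m, (gram x₀ y)⁻¹ i m *
        partialDeriv j (partialDeriv m F) y = ∑ i, X i y * partialDeriv j (partialDeriv i F) y := by
      simp only [hX, Finset.mul_sum, Finset.sum_mul]
      rw [Finset.sum_comm]
      refine Finset.sum_congr rfl fun i _ => Finset.sum_congr rfl fun m _ => ?_
      rw [hsymm y m i]
      ring
    have h3 : ∑ i, partialDeriv i F y * partialDeriv j (X i) y =
        r y + ∑ i, X i y * partialDeriv j (partialDeriv i F) y := by
      rw [← h2, hr]
      simp only
      rw [← Finset.sum_add_distrib]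
      refine Finset.sum_congr rfl fun i _ => ?_
      rw [pX i y hy, Finset.sum_add_distrib, mul_add, Finset.mul_sum]
      congr 1
      exact Finset.sum_congr rfl fun m _ => by ring
    have h4 : ∑ i, partialDeriv j (partialDeriv i F) y * X i y =
        ∑ i, X i y * partialDeriv j (partialDeriv i F) y :=
      Finset.sum_congr rfl fun i _ => mul_comm _ _
    rw [h3, h4] at h1
    linarith
  refine ⟨(hF2 k j).differentiableOn one_ne_zero, (bF j).isBigO_partialDeriv k, ?_⟩
  have b1 := (br.isBigO_partialDeriv k).const_mul_left (-(1 / 2))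
  have b2 : (fun y => ∑ i, partialDeriv k (X i) y * partialDeriv j (partialDeriv i F) y)
      =O[𝓝[O] (chartAt (Euc n) x₀ x₀)] fun _ => (1 : ℝ) :=
    isBigO_one_sum fun i _ => isBigO_one_mul ((bX i).isBigO_partialDeriv k)
      ((bF i).isBigO_partialDeriv j)
  refine isBigO_one_congr hO (b1.sub b2) fun y hy => ?_
  -- The second differentiation: in the product rule the third derivatives of f occur only
  -- contracted with X = ∇f, and every other term is bounded.
  have h1 : partialDeriv k (fun y => ∑ i, X i y * partialDeriv j (partialDeriv i F) y) y =
      -(1 / 2) * partialDeriv k r y := by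
    rw [partialDeriv_congr (H := fun y => -(1 / 2) * r y)
      (by filter_upwards [hO.mem_nhds hy] with z hz; linarith [first z hz])]
    rw [partialDeriv_mul (differentiableAt_const _)
      (br.differentiableOn.differentiableAt (hO.mem_nhds hy))]
    simp [partialDeriv]
  rw [partialDeriv_sum_mul _ (fun i _ => dX i y hy) (fun i _ => dF2 j i y hy)] at h1
  rw [← h1, ← Finset.sum_sub_distrib]
  refine Finset.sum_congr rfl fun i _ => ?_
  have e1 : partialDeriv i (partialDeriv k (partialDeriv j F)) y =
      partialDeriv k (partialDeriv j (partialDeriv i F)) y := by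
    rw [partialDeriv_comm hO (hF1 j) hy]
    refine partialDeriv_congr ?_ k
    filter_upwards [hO.mem_nhds hy] with z hz
    exact partialDeriv_comm hO (hF.of_le (by norm_num)) hz i j
  rw [e1]
  ring

/-- In coordinates Δf is a combination of first and second derivatives of f with smooth
coefficients. Differentiating it along ∇f produces third derivatives only in that direction, where
|∇f| = 1 bounds them. -/
lemma C3C2Closure.exists_bound_inner_grad_lap (hcpt : IsCompact (closure Ω)) {f : M → ℝ}
    (hf : C3C2Closure n Ω f) (hf1 : ∀ x ∈ Ω, ‖grad n f x‖ ^ 2 = 1) :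
    ∃ C, ∀ x ∈ Ω, |inner ℝ (grad n (lap n f) x) (grad n f x)| ≤ C := by
  have hf2 : ContMDiffOn (𝓡 n) 𝓘(ℝ, ℝ) 2 f Ω := hf.contMDiffOn.of_le (by norm_num)
  have hL : ContMDiffOn (𝓡 n) 𝓘(ℝ, ℝ) 1 (lap n f) Ω :=
    contMDiffOn_lap hΩ (k := 1) (l := 3) ENat.LEInfty.out (by norm_num) hf.contMDiffOn
  refine exists_bound_of_isBigO (n := n) hcpt fun x₀ hx₀ => ?_
  have hO := isOpen_chartDom (n := n) x₀ hΩ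
  set F := inChart n x₀ f with hF
  have bX := fun a => (hf.isBoundedC1Near_gradCoord hΩ hx₀ a).isBigO
  have al := fun {H} (h : IsBoundedC1Near (chartDom n x₀ Ω) (chartAt (Euc n) x₀ x₀) H) =>
    isBoundedC1Near_iff.1 h _ bX
  have ca : ∀ a b, ContDiffOn ℝ ∞ (fun y => volDensity x₀ y * (gram x₀ y)⁻¹ a b)
      (chartAt (Euc n) x₀).target :=
    fun a b => (contDiffOn_volDensity x₀).mul (contDiffOn_gram_inv x₀ a b)
  have ba : ∀ a b, IsBoundedC1Near (chartDom n x₀ Ω) (chartAt (Euc n) x₀ x₀)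
      (partialDeriv a fun y => volDensity x₀ y * (gram x₀ y)⁻¹ a b) := fun a b =>
    isBoundedC1Near_of_contDiffOn_target hΩ x₀ (contDiffOn_partialDeriv
      (chartAt (Euc n) x₀).open_target (ca a b) (by simp) a)
  have key : IsBoundedAlong (chartDom n x₀ Ω) (chartAt (Euc n) x₀ x₀)
      (fun i y => ∑ m, (gram x₀ y)⁻¹ i m * partialDeriv m F y)
      (fun y => (volDensity x₀ y)⁻¹ * ∑ a, ∑ b,
        (partialDeriv a (fun y => volDensity x₀ y * (gram x₀ y)⁻¹ a b) y * partialDeriv b F y +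
          volDensity x₀ y * (gram x₀ y)⁻¹ a b * partialDeriv a (partialDeriv b F) y)) :=
    .mul hO (al (isBoundedC1Near_inv_volDensity hΩ x₀)) (.sum hO fun a _ => .sum hO fun b _ =>
      .add hO (.mul hO (al (ba a b)) (al (hf.isBoundedC1Near_partialDeriv hΩ hx₀ b)))
        (.mul hO (al (isBoundedC1Near_of_contDiffOn_target hΩ x₀ (ca a b)))
          (hf.isBoundedAlong_partialDeriv_partialDeriv hΩ hf1 hx₀ a b)))
  have hFc : ContDiffOn ℝ 2 F (chartDom n x₀ Ω) := contDiffOn_inChart x₀ ENat.LEInfty.out hf2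
  have hLap : IsBoundedAlong (chartDom n x₀ Ω) (chartAt (Euc n) x₀ x₀)
      (fun i y => ∑ m, (gram x₀ y)⁻¹ i m * partialDeriv m F y) (inChart n x₀ (lap n f)) := by
    refine key.congr hO fun y hy => ?_
    refine (lap_chart_symm hΩ hf2 x₀ hy).trans ?_
    rw [chartLaplacian_eq]
    congr 1
    refine Finset.sum_congr rfl fun a _ => ?_
    have hda : ∀ b, DifferentiableAt ℝ (fun y => volDensity x₀ y * (gram x₀ y)⁻¹ a b) y :=
      fun b => ((ca a b).differentiableOn (by simp)).differentiableAt
        ((chartAt (Euc n) x₀).open_target.mem_nhds hy.1)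
    have hdF : ∀ b, DifferentiableAt ℝ (partialDeriv b F) y := fun b =>
      ((contDiffOn_partialDeriv hO (k := 1) hFc (by norm_num) b).differentiableOn
        one_ne_zero).differentiableAt (hO.mem_nhds hy)
    have e : gradFlux x₀ f a =
        fun y => ∑ b, (volDensity x₀ y * (gram x₀ y)⁻¹ a b) * partialDeriv b F y := by
      funext z
      rw [gradFlux, Finset.mul_sum]
      exact Finset.sum_congr rfl fun b _ => (mul_assoc _ _ _).symm
    rw [e, partialDeriv_sum_mul _ (fun b _ => hda b) (fun b _ => hdF b)]
  refine isBigO_one_congr hO hLap.isBigO_deriv fun y hy => ?_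
  refine (inner_grad_chart x₀ hy.1 (mdifferentiableAt_of_contMDiffOn hΩ one_ne_zero hL hy.2)
    (mdifferentiableAt_of_contMDiffOn hΩ two_ne_zero hf2 hy.2)).trans ?_
  exact Finset.sum_congr rfl fun i _ => mul_comm _ _

end ClosureBounds

end RiemDirichlet

end

/-! ### The theorem. -/

open RiemDirichlet in
theorem mainTheorem2 {n : ℕ} {M : Type*} [MetricSpace M] [ChartedSpace (Euc n) M]
    [IsManifold (𝓡 n) ∞ M]
    [RiemannianBundle (fun x : M => TangentSpace (𝓡 n) x)]
    [IsContMDiffRiemannianBundle (𝓡 n) ∞ (Euc n) (fun x : M => TangentSpace (𝓡 n) x)]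
    [IsRiemannianManifold (𝓡 n) M] [CompleteSpace M]
    [MeasurableSpace M] [BorelSpace M]
    (Ω : Set M) (hΩ_open : IsOpen Ω) (hΩ_conn : IsConnected Ω)
    (hΩ_bdd : Bornology.IsBounded Ω)
    (lam : ℕ+ → ℝ) (u : ℕ+ → M → ℝ) (hu : IsDirichletEigensystem n Ω lam u)
    (i k : ℕ+) (hik : i < k) :
    -- the inequality for a complex-valued function `g`
    (∀ g : M → ℂ, C3C2Closure n Ω g →
      IntegrableOn (fun x => cGradSq n g x * u i x ^ 2) Ω (riemVolume n M) ∧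
      IntegrableOn (fun x => ‖2 * cGradDot n g (u i) x + u i x * cLap n g x‖ ^ 2) Ω
        (riemVolume n M) ∧
      IntegrableOn (fun x => ‖g x * u i x‖ ^ 2) Ω (riemVolume n M) ∧
      ((lam (k + 1) - lam i) + (lam (k + 2) - lam i)) *
          ∫ x in Ω, cGradSq n g x * u i x ^ 2 ∂(riemVolume n M) ≤
        (∫ x in Ω, ‖2 * cGradDot n g (u i) x + u i x * cLap n g x‖ ^ 2 ∂(riemVolume n M)) +
        (lam (k + 1) - lam i) * (lam (k + 2) - lam i) *
          ∫ x in Ω, ‖g x * u i x‖ ^ 2 ∂(riemVolume n M)) ∧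
    -- the inequality for a real-valued function `f`
    (∀ f : M → ℝ, C3C2Closure n Ω f →
      IntegrableOn (fun x => ‖grad n f x‖ ^ 2 * u i x ^ 2) Ω (riemVolume n M) ∧
      IntegrableOn (fun x => ‖grad n f x‖ ^ 4 * u i x ^ 2) Ω (riemVolume n M) ∧
      IntegrableOn (fun x => (2 * inner ℝ (grad n f x) (grad n (u i) x) + u i x * lap n f x) ^ 2)
        Ω (riemVolume n M) ∧
      ((lam (k + 2) - lam i) + (lam (k + 1) - lam i)) *
          ∫ x in Ω, ‖grad n f x‖ ^ 2 * u i x ^ 2 ∂(riemVolume n M) ≤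
        2 * Real.sqrt ((lam (k + 2) - lam i) * (lam (k + 1) - lam i) *
          ∫ x in Ω, ‖grad n f x‖ ^ 4 * u i x ^ 2 ∂(riemVolume n M)) +
        ∫ x in Ω, (2 * inner ℝ (grad n f x) (grad n (u i) x) + u i x * lap n f x) ^ 2
          ∂(riemVolume n M)) ∧
    -- the gap estimates for a real-valued function `f` with `|∇f| = 1`
    (∀ f : M → ℝ, C3C2Closure n Ω f → (∀ x ∈ Ω, ‖grad n f x‖ ^ 2 = 1) →
      IntegrableOn (fun x => inner ℝ (grad n f x) (grad n (u i) x) ^ 2) Ω (riemVolume n M) ∧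
      IntegrableOn (fun x => lap n f x ^ 2 * u i x ^ 2) Ω (riemVolume n M) ∧
      IntegrableOn (fun x => inner ℝ (grad n (lap n f) x) (grad n f x) * u i x ^ 2) Ω
        (riemVolume n M) ∧
      (lam (k + 2) - lam (k + 1)) ^ 2 ≤
        16 * ((∫ x in Ω, inner ℝ (grad n f x) (grad n (u i) x) ^ 2 ∂(riemVolume n M))
          - 1 / 4 * (∫ x in Ω, lap n f x ^ 2 * u i x ^ 2 ∂(riemVolume n M))
          - 1 / 2 * (∫ x in Ω, inner ℝ (grad n (lap n f) x) (grad n f x) * u i x ^ 2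
              ∂(riemVolume n M))) * lam (k + 2) ∧
      0 ≤ lam i
          - 1 / 4 * (∫ x in Ω, lap n f x ^ 2 * u i x ^ 2 ∂(riemVolume n M))
          - 1 / 2 * (∫ x in Ω, inner ℝ (grad n (lap n f) x) (grad n f x) * u i x ^ 2
              ∂(riemVolume n M)) ∧
      (lam (k + 2) - lam (k + 1)) ^ 2 ≤
        16 * (lam i
          - 1 / 4 * (∫ x in Ω, lap n f x ^ 2 * u i x ^ 2 ∂(riemVolume n M))
          - 1 / 2 * (∫ x in Ω, inner ℝ (grad n (lap n f) x) (grad n f x) * u i x ^ 2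
              ∂(riemVolume n M))) * lam (k + 2) ∧
      lam (k + 2) - lam (k + 1) ≤
        4 * Real.sqrt (lam i
          - 1 / 4 * (∫ x in Ω, lap n f x ^ 2 * u i x ^ 2 ∂(riemVolume n M))
          - 1 / 2 * (∫ x in Ω, inner ℝ (grad n (lap n f) x) (grad n f x) * u i x ^ 2
              ∂(riemVolume n M))) * Real.sqrt (lam (k + 2))) := by
  have : ProperSpace M := properSpace_of_completeSpace n M
  have hcpt : IsCompact (closure Ω) := hΩ_bdd.isCompact_closure
  have hi := hu.isH10 hΩ_open i
  refine ⟨fun g hg => ?_, fun f hf => ?_, fun f hf hf1 => ?_⟩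
  · have hre : IsBoundedC2 n Ω (fun x => (g x).re) :=
      (hg.clm_comp hΩ_open Complex.reCLM).isBoundedC2 hΩ_open hcpt
    have him : IsBoundedC2 n Ω (fun x => (g x).im) :=
      (hg.clm_comp hΩ_open Complex.imCLM).isBoundedC2 hΩ_open hcpt
    have e1 : (fun x => cGradSq n g x * u i x ^ 2) = fun x =>
        ‖grad n (fun x => (g x).re) x‖ ^ 2 * u i x ^ 2 +
          ‖grad n (fun x => (g x).im) x‖ ^ 2 * u i x ^ 2 := by
      funext x
      rw [cGradSq, add_mul]
    have e2 : (fun x => ‖2 * cGradDot n g (u i) x + u i x * cLap n g x‖ ^ 2) = fun x =>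
        (2 * inner ℝ (grad n (fun x => (g x).re) x) (grad n (u i) x) +
          u i x * lap n (fun x => (g x).re) x) ^ 2 +
        (2 * inner ℝ (grad n (fun x => (g x).im) x) (grad n (u i) x) +
          u i x * lap n (fun x => (g x).im) x) ^ 2 := by
      funext x
      rw [Complex.sq_norm, Complex.normSq_apply]
      simp [cGradDot, cLap, sq]
    have e3 : (fun x => ‖g x * u i x‖ ^ 2) = fun x =>
        ((g x).re * u i x) ^ 2 + ((g x).im * u i x) ^ 2 := by
      funext x
      rw [Complex.sq_norm, Complex.normSq_apply]
      simp [sq]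
    have i1 := integrableOn_norm_grad_pow_mul_sq hΩ_open hre hi 2
    have i1' := integrableOn_norm_grad_pow_mul_sq hΩ_open him hi 2
    have i2 := (hre.memLp_commutator hΩ_open hi).integrable_sq
    have i2' := (him.memLp_commutator hΩ_open hi).integrable_sq
    have i3 := ((hi.mul hΩ_open hre).memLp hΩ_open).integrable_sq
    have i3' := ((hi.mul hΩ_open him).memLp hΩ_open).integrable_sq
    rw [e1, e2, e3]
    refine ⟨i1.add i1', i2.add i2', i3.add i3', ?_⟩
    rw [integral_add i1 i1', integral_add i2 i2', integral_add i3 i3']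
    have h := gap_inequality_real hΩ_open hu hre i k
    have h' := gap_inequality_real hΩ_open hu him i k
    linarith
  · have hfb := hf.isBoundedC2 hΩ_open hcpt
    exact ⟨integrableOn_norm_grad_pow_mul_sq hΩ_open hfb hi 2,
      integrableOn_norm_grad_pow_mul_sq hΩ_open hfb hi 4,
      (hfb.memLp_commutator hΩ_open hi).integrable_sq, gap_inequality_sqrt hΩ_open hu hfb hik⟩
  · have hfb := hf.isBoundedC2 hΩ_open hcpt
    obtain ⟨C, hC⟩ := hf.exists_bound_inner_grad_lap hΩ_open hcpt hf1
    obtain ⟨j2, j3, hD⟩ := integral_commutator_sq hΩ_open hu hfb hf.contMDiffOn hC i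
    have j1 := (memLp_inner_grad hΩ_open hfb hi).integrable_sq
    have hgap := gap_sq_le_mul_integral_commutator_sq hΩ_open hu hfb hf1 hik
    have hD0 : 0 ≤ ∫ x in Ω, (2 * inner ℝ (grad n f x) (grad n (u i) x) + u i x * lap n f x) ^ 2
        ∂(riemVolume n M) := integral_nonneg fun x => sq_nonneg _
    -- Pointwise Cauchy–Schwarz with |∇f| = 1, then ∫|∇uᵢ|² = λᵢ.
    have hI : ∫ x in Ω, inner ℝ (grad n f x) (grad n (u i) x) ^ 2 ∂(riemVolume n M) ≤ lam i := by
      rw [← hu.integral_norm_grad_sq hΩ_open i]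
      refine setIntegral_mono_on j1 (hi.memLp_grad hΩ_open).integrable_sq hΩ_open.measurableSet
        fun x hx => ?_
      have h := abs_real_inner_le_norm (grad n f x) (grad n (u i) x)
      have h2 := pow_le_pow_left₀ (abs_nonneg _) h 2
      rwa [sq_abs, mul_pow, hf1 x hx, one_mul] at h2
    have hl := hu.nonneg hΩ_open (k + 2)
    rw [hD] at hgap hD0
    refine ⟨j1, j2, j3, by linarith, ?_⟩
    set I₁ := ∫ x in Ω, inner ℝ (grad n f x) (grad n (u i) x) ^ 2 ∂(riemVolume n M)
    set I₂ := ∫ x in Ω, lap n f x ^ 2 * u i x ^ 2 ∂(riemVolume n M)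
    set I₃ := ∫ x in Ω, inner ℝ (grad n (lap n f) x) (grad n f x) * u i x ^ 2 ∂(riemVolume n M)
    -- The same expression with `I₁` in place of λᵢ is a quarter of the integral of a square, and
    -- `I₁` is at most λᵢ.
    have hQ : 0 ≤ lam i - 1 / 4 * I₂ - 1 / 2 * I₃ := by linarith
    have hsq : (lam (k + 2) - lam (k + 1)) ^ 2 ≤
        16 * (lam i - 1 / 4 * I₂ - 1 / 2 * I₃) * lam (k + 2) := by
      have : (I₁ - 1 / 4 * I₂ - 1 / 2 * I₃) * lam (k + 2) ≤
          (lam i - 1 / 4 * I₂ - 1 / 2 * I₃) * lam (k + 2) :=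
        mul_le_mul_of_nonneg_right (by linarith) hl
      linarith
    refine ⟨hQ, hsq, abs_le_of_sq_le_sq' (hsq.trans_eq ?_) (by positivity) |>.2⟩
    rw [mul_pow, mul_pow, Real.sq_sqrt hQ, Real.sq_sqrt hl]
    norm_num
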